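/- Let $M$ be a compact complex manifold (without boundary) of complex dimension $n\ge 2$, let $\omega_0$ be a Hermitian metric on $M$ and let $\alpha$ be a Gauduchon metric on $M$ (a Hermitian metric with $\partial\bar\partial\alpha^{n-1}=0$); Hermitian metrics are identified with their real $(1,1)$-forms $\omega=\sqrt{-1}\,g_{i\bar j}\,dz^i\wedge d\bar z^j$, and all metrics are smooth. For a Hermitian metric $\omega$ let $\mathrm{Ric}(\omega)=-\sqrt{-1}\partial\bar\partial\log\det(g_{i\bar j})$ be its Chern–Ricci form, and for a positive volume form $\Omega$ let $\mathrm{Ric}(\Omega)=-\sqrt{-1}\partial\bar\partial\log\Omega$, where $\log\Omega$ is the logarithm of the density of $\Omega$ in local holomorphic coordinates. A real $(n-1,n-1)$-form $$\psi=(\sqrt{-1})^{n-1}\sum_{i,j}(-1)^{\frac{n(n+1)}2+i+j+1}\psi^{\bar j i}\,dz^1\wedge\cdots\widehat{dz^i}\cdots\wedge dz^n\wedge d\bar z^1\wedge\cdots\widehat{d\bar z^j}\cdots\wedge d\bar z^n$$ is called positive, $\psi>0$, if the Hermitian matrix $(\psi^{\bar j i})$ is positive definite, and one writes $\det\psi=\det(\psi^{\bar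 j i})$; the quotient of two such determinants does not depend on the coordinates. For a smooth function $v:M\to\mathbb R$ put $$H(v)=\sqrt{-1}\partial\bar\partial v\wedge\alpha^{n-2}+\mathrm{Re}\big(\sqrt{-1}\partial v\wedge\bar\partial(\alpha^{n-2})\big).$$ For $s\ge 0$, a Hermitian metric $\omega$ solves the continuity equation at $s$ if $$\omega^{n-1}=\omega_0^{n-1}-s(n-1)\Big(\mathrm{Ric}(\omega)\wedge\alpha^{n-2}-\mathrm{Re}\Big(\sqrt{-1}\partial\log\frac{\omega^n}{\alpha^n}\wedge\bar\partial(\alpha^{n-2})\Big)\Big)>0.\qquad(1)$$ Let $\hat T>0$ and let $\varphi:M\to\mathbb R$ be a smooth function with $$\omega_0^{n-1}-\hat T(n-1)\Big(\mathrm{Ric}(\omega_0)\wedge\alpha^{n-2}-\mathrm{Re}\Big(\sqrt{-1}\partial\log\frac{\omega_0^n}{\alpha^n}\wedge\bar\partial(\alpha^{n-2})\Big)\Big)+H(\varphi)>0.$$ Put $\Omega=\omega_0^n\,e^{\varphi/((n-1)\hat T)}$, fix $s\in[0,\hat T]$, and put $$\hat\omega_s^{n-1}=\omega_0^{n-1}-s(n-1)\Big(\mathrm{Ric}(\Omega)\wedge\alpha^{n-2}-\mathrm{Re}\Big(\sqrt{-1}\partial\log\frac{\Omega}{\alpha^n}\wedge\bar\partial(\alpha^{n-2})\Big)\Big),\qquad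 \Psi_u=\hat\omega_s^{n-1}+s\,H(u)$$ for smooth $u:M\to\mathbb R$. Consider, for smooth $u:M\to\mathbb R$, the equation $$\log\frac{\det\Psi_u}{e^{\varphi/\hat T}\det\omega_0^{n-1}}-u=0,\qquad \Psi_u>0.\qquad(2)$$ **Proposition 3.1.** (a) There is a Hermitian metric $\omega$ solving (1) if and only if there is a smooth function $u$ solving (2). (b) There is a Gauduchon metric $\omega$ solving (1) if and only if there is a smooth function $u$ solving (2) with $\partial\bar\partial\Psi_u=0$. (c) More precisely, a given Hermitian metric $\omega$ solves (1) if and only if there is a smooth function $u$ solving (2) with $\omega^{n-1}=\Psi_u$. -/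

import Mathlib

open scoped Manifold ContDiff Matrix ComplexConjugate ComplexOrder

noncomputable section

namespace GauduchonContinuity

/-! ## Exterior algebra of the complexified cotangent space of `ℂⁿ` -/

/-- The model space `ℂⁿ`. For a complex manifold `M` modelled on it, Mathlib's tangent space at
`x : M` is by definition `ℂⁿ`, the identification being the one of the preferred chart at `x`;
the complex structure `J` is multiplication by `Complex.I`. -/
abbrev Cn (n : ℕ) : Type := Fin n → ℂ

/-- The complexified cotangent space: real-linear complex-valued functionals. -/
abbrev Cov (n : ℕ) : Type := Cn n →ₗ[ℝ] ℂ

/-- Complex-valued exterior forms on `ℂⁿ` of all degrees; multiplication is the wedge product. -/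
abbrev Lam (n : ℕ) : Type := ExteriorAlgebra ℂ (Cov n)

/-- The `(1,0)`-covector `dz^j`. -/
def dz {n : ℕ} (j : Fin n) : Cov n := LinearMap.proj j

/-- The `(0,1)`-covector `d\bar z^j`. -/
def dzbar {n : ℕ} (j : Fin n) : Cov n := Complex.conjLIE.toLinearEquiv.toLinearMap ∘ₗ LinearMap.proj j

@[simp] theorem dz_apply {n : ℕ} (j : Fin n) (v : Cn n) : dz j v = v j := rfl

@[simp] theorem dzbar_apply {n : ℕ} (j : Fin n) (v : Cn n) : dzbar j v = conj (v j) := rfl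

/-- The real tangent vector `∂/∂x^j`. -/
def ex {n : ℕ} (j : Fin n) : Cn n := Pi.single j 1

/-- The real tangent vector `J ∂/∂x^j = ∂/∂y^j`. -/
def ey {n : ℕ} (j : Fin n) : Cn n := Pi.single j Complex.I

theorem sum_ex_ey {n : ℕ} (v : Cn n) : v = ∑ j, ((v j).re • ex j + (v j).im • ey j) := by
  ext k
  simp only [Finset.sum_apply, Pi.add_apply, Pi.smul_apply, ex, ey, Pi.single_apply]
  rw [Finset.sum_eq_single k]
  · apply Complex.ext <;> simp
  · intro b _ hb
    simp [hb.symm]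
  · simp

/-- The coordinates of a covector with respect to `dz^1, …, dz^n, d\bar z^1, …, d\bar z^n`. -/
def covEquiv (n : ℕ) : Cov n ≃ₗ[ℂ] (Fin n ⊕ₗ Fin n → ℂ) where
  toFun L := fun k => Sum.elim
    (fun j => (1 / 2 : ℂ) * (L (ex j) - Complex.I * L (ey j)))
    (fun j => (1 / 2 : ℂ) * (L (ex j) + Complex.I * L (ey j))) (ofLex k)
  map_add' L L' := by
    ext k
    rcases h : ofLex k with j | j <;> simp [h] <;> ring
  map_smul' c L := by
    ext k
    rcases h : ofLex k with j | j <;> simp [h] <;> ring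
  invFun c := ∑ j, (c (toLex (Sum.inl j)) • dz j + c (toLex (Sum.inr j)) • dzbar j)
  left_inv L := by
    refine LinearMap.ext fun v => ?_
    conv_rhs => rw [sum_ex_ey v]
    simp only [ofLex_toLex, Sum.elim_inl, Sum.elim_inr, LinearMap.sum_apply, LinearMap.add_apply,
      LinearMap.smul_apply, dz_apply, dzbar_apply, map_sum, map_add, map_smul, smul_eq_mul,
      Complex.real_smul]
    refine Finset.sum_congr rfl fun j _ => ?_
    have h1 : v j = (v j).re + (v j).im * Complex.I := (Complex.re_add_im _).symm
    have h2 : conj (v j) = (v j).re - (v j).im * Complex.I := by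
      apply Complex.ext <;> simp
    rw [h2]
    nth_rewrite 1 [h1]
    linear_combination (-(v j).im * L (ey j)) * Complex.I_mul_I
  right_inv c := by
    have hx : ∀ j k : Fin n, (ex j : Cn n) k = if k = j then 1 else 0 := fun j k => by
      simp [ex, Pi.single_apply]
    have hy : ∀ j k : Fin n, (ey j : Cn n) k = if k = j then Complex.I else 0 := fun j k => by
      simp [ey, Pi.single_apply]
    have key : ∀ j : Fin n, ∑ x, (c (toLex (Sum.inl x)) * (if x = j then Complex.I else 0)
        + c (toLex (Sum.inr x)) * conj (if x = j then Complex.I else 0))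
        = Complex.I * (c (toLex (Sum.inl j)) - c (toLex (Sum.inr j))) := by
      intro j
      rw [Finset.sum_eq_single j]
      · simp; ring
      · intro b _ hb
        simp [hb]
      · simp
    have key' : ∀ j : Fin n, ∑ x, (c (toLex (Sum.inl x)) * (if x = j then (1 : ℂ) else 0)
        + c (toLex (Sum.inr x)) * conj (if x = j then (1 : ℂ) else 0))
        = c (toLex (Sum.inl j)) + c (toLex (Sum.inr j)) := by
      intro j
      rw [Finset.sum_eq_single j]
      · simp
      · intro b _ hb
        simp [hb]
      · simp
    ext k
    have hk : k = toLex (ofLex k) := rfl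
    rcases h : ofLex k with j | j <;> rw [h] at hk <;> subst hk <;>
      simp only [ofLex_toLex, Sum.elim_inl, Sum.elim_inr, LinearMap.sum_apply, LinearMap.add_apply,
        LinearMap.smul_apply, dz_apply, dzbar_apply, smul_eq_mul, hx, hy, key, key']
    · linear_combination (-(1 / 2 : ℂ) *
        (c (toLex (Sum.inl j)) - c (toLex (Sum.inr j)))) * Complex.I_mul_I
    · linear_combination ((1 / 2 : ℂ) *
        (c (toLex (Sum.inl j)) - c (toLex (Sum.inr j)))) * Complex.I_mul_I

/-- The basis `dz^1 < … < dz^n < d\bar z^1 < … < d\bar z^n` of the complexified cotangent space. -/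
def covBasis (n : ℕ) : Module.Basis (Fin n ⊕ₗ Fin n) ℂ (Cov n) :=
  Module.Basis.ofEquivFun (covEquiv n)

/-- The basis of exterior forms by the increasingly ordered wedge products of the elements
of `covBasis`. -/
def lamBasis (n : ℕ) : Module.Basis (Finset (Fin n ⊕ₗ Fin n)) ℂ (Lam n) :=
  (covBasis n).ExteriorAlgebra

/-- The coefficient of a form at the basis form of index `S`. -/
def coeff {n : ℕ} (S : Finset (Fin n ⊕ₗ Fin n)) (ψ : Lam n) : ℂ := (lamBasis n).repr ψ S

/-- Pullback of forms under a complex linear map. -/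
def pull {n : ℕ} (A : Cn n →L[ℂ] Cn n) : Lam n →ₐ[ℂ] Lam n :=
  ExteriorAlgebra.map
    { toFun := fun L => L ∘ₗ (A.toLinearMap.restrictScalars ℝ)
      map_add' := fun _ _ => rfl
      map_smul' := fun _ _ => rfl }

/-- The linear map of covectors exchanging `dz^j` and `d\bar z^j`. -/
def covSwap (n : ℕ) : Cov n →ₗ[ℂ] Cov n where
  toFun L := L ∘ₗ LinearMap.pi fun j => dzbar j
  map_add' _ _ := rfl
  map_smul' _ _ := rfl

/-- Complex conjugation of forms: the coefficients are conjugated and `dz^j`, `d\bar z^j` are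
exchanged. -/
def conjForm {n : ℕ} (ψ : Lam n) : Lam n :=
  ∑ S, conj (coeff S ψ) • ExteriorAlgebra.map (covSwap n) (lamBasis n S)

/-- Real part of a form. -/
def reForm {n : ℕ} (ψ : Lam n) : Lam n := (1 / 2 : ℂ) • (ψ + conjForm ψ)

/-! ### Forms of bidegree `(n-1,n-1)` and `(n,n)` -/

/-- The set of indices of
`dz^1 ∧ ⋯ (omit dz^i) ⋯ ∧ dz^n ∧ d\bar z^1 ∧ ⋯ (omit d\bar z^j) ⋯ ∧ d\bar z^n`. -/
def omitIdx {n : ℕ} (i j : Fin n) : Finset (Fin n ⊕ₗ Fin n) :=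
  Finset.univ \ {toLex (Sum.inl i), toLex (Sum.inr j)}

/-- The constant `(√-1)^{n-1} (-1)^{n(n+1)/2+i+j+1}`. (The indices `i`, `j` count from `0` here;
counting from `1` gives the same sign.) -/
def omitSign {n : ℕ} (i j : Fin n) : ℂ :=
  Complex.I ^ (n - 1) * (-1) ^ (n * (n + 1) / 2 + (i : ℕ) + (j : ℕ) + 1)

/-- The coefficient matrix `(ψ^{\bar j i})` of an `(n-1,n-1)`-form
`ψ = (√-1)^{n-1} ∑ (-1)^{n(n+1)/2+i+j+1} ψ^{\bar j i}
  dz^1 ∧ ⋯ (omit dz^i) ⋯ ∧ dz^n ∧ d\bar z^1 ∧ ⋯ (omit d\bar z^j) ⋯ ∧ d\bar z^n`. -/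
def coeffMatrix {n : ℕ} (ψ : Lam n) : Matrix (Fin n) (Fin n) ℂ :=
  Matrix.of fun i j => coeff (omitIdx i j) ψ / omitSign i j

/-- The `(n-1,n-1)`-form with given coefficient matrix. -/
def ofMatrix {n : ℕ} (P : Matrix (Fin n) (Fin n) ℂ) : Lam n :=
  ∑ i, ∑ j, (omitSign i j * P i j) • lamBasis n (omitIdx i j)

/-- Strict positivity of an `(n-1,n-1)`-form: it is of bidegree `(n-1,n-1)` and its coefficient
matrix is Hermitian positive definite. -/
def LamPos {n : ℕ} (ψ : Lam n) : Prop :=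
  ψ = ofMatrix (coeffMatrix ψ) ∧ (coeffMatrix ψ).PosDef

/-- `det ψ := det (ψ^{\bar j i})` for a real `(n-1,n-1)`-form (the coefficient matrix is
Hermitian, so that its determinant is real). -/
def lamDet {n : ℕ} (ψ : Lam n) : ℝ := (coeffMatrix ψ).det.re

/-- The density `ρ` of a real `(n,n)`-form
`ρ (√-1 dz^1 ∧ d\bar z^1) ∧ ⋯ ∧ (√-1 dz^n ∧ d\bar z^n)
  = ρ (√-1)^n (-1)^{n(n-1)/2} dz^1 ∧ ⋯ ∧ dz^n ∧ d\bar z^1 ∧ ⋯ ∧ d\bar z^n`. -/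
def density {n : ℕ} (ψ : Lam n) : ℝ :=
  (coeff Finset.univ ψ / (Complex.I ^ n * (-1) ^ (n * (n - 1) / 2))).re

/-! ### The operators `∂` and `\bar∂` on forms on open subsets of `ℂⁿ` -/

/-- Directional derivative of (the coefficients of) a form on `ℂⁿ`. -/
def dirDeriv {n : ℕ} (F : Cn n → Lam n) (y v : Cn n) : Lam n :=
  ∑ S, fderiv ℝ (fun p => coeff S (F p)) y v • lamBasis n S

/-- `∂F = ∑ dz^j ∧ ∂F/∂z^j`. -/
def delLoc {n : ℕ} (F : Cn n → Lam n) (y : Cn n) : Lam n :=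
  ∑ j, ExteriorAlgebra.ι ℂ (dz j) *
    ((1 / 2 : ℂ) • (dirDeriv F y (ex j) - Complex.I • dirDeriv F y (ey j)))

/-- `\bar∂F = ∑ d\bar z^j ∧ ∂F/∂\bar z^j`. -/
def delbarLoc {n : ℕ} (F : Cn n → Lam n) (y : Cn n) : Lam n :=
  ∑ j, ExteriorAlgebra.ι ℂ (dzbar j) *
    ((1 / 2 : ℂ) • (dirDeriv F y (ex j) + Complex.I • dirDeriv F y (ey j)))

/-- A real function as a form of degree `0`. -/
def scalarLoc {n : ℕ} (f : Cn n → ℝ) : Cn n → Lam n :=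
  fun y => algebraMap ℂ (Lam n) (f y : ℂ)

/-! ## Forms and Hermitian metrics on a complex manifold -/

/-- Complex-valued differential forms on `M` (not necessarily smooth, of mixed degree): the value
at `x` is a form on the tangent space at `x`. Sums and wedge products are pointwise. -/
abbrev Form (n : ℕ) (M : Type*) : Type _ := M → Lam n

section Manifold

variable {n : ℕ} {M : Type*} [TopologicalSpace M] [ChartedSpace (Cn n) M]

/-- Differential at `y` of the inverse of the preferred chart at `x₀`. -/
def chartSymmD (x₀ : M) (y : Cn n) : Cn n →L[ℂ] Cn n :=
  mfderiv 𝓘(ℂ, Cn n) 𝓘(ℂ, Cn n) (chartAt (Cn n) x₀).symm y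

/-- Differential at `x₀` of the preferred chart at `x₀`. -/
def chartD (x₀ : M) : Cn n →L[ℂ] Cn n :=
  mfderiv 𝓘(ℂ, Cn n) 𝓘(ℂ, Cn n) (chartAt (Cn n) x₀) x₀

/-- The expression of a form in the preferred chart at `x₀` (meaningful on the target of that
chart). -/
def localRep (ψ : Form n M) (x₀ : M) : Cn n → Lam n :=
  fun y => pull (chartSymmD x₀ y) (ψ ((chartAt (Cn n) x₀).symm y))

/-- The operator `∂` on forms on `M`, computed in charts. -/
def del (ψ : Form n M) : Form n M :=
  fun x => pull (chartD x) (delLoc (localRep ψ x) (chartAt (Cn n) x x))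

/-- The operator `\bar∂` on forms on `M`, computed in charts. -/
def delbar (ψ : Form n M) : Form n M :=
  fun x => pull (chartD x) (delbarLoc (localRep ψ x) (chartAt (Cn n) x x))

/-- A real function on `M` as a form of degree `0`. -/
def scalar (f : M → ℝ) : Form n M := fun x => algebraMap ℂ (Lam n) (f x : ℂ)

/-- Real part of a form. -/
def reF (ψ : Form n M) : Form n M := fun x => reForm (ψ x)

/-- Strict positivity of an `(n-1,n-1)`-form on `M`. -/
def IsPos (ψ : Form n M) : Prop := ∀ x, LamPos (ψ x)

/-- The quotient of two volume forms. -/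
def volRatio (A B : Form n M) : M → ℝ := fun x => density (A x) / density (B x)

variable (n M) in
/-- A Hermitian metric: a smooth Riemannian metric `g` with `g(JX, JY) = g(X, Y)`. -/
structure HermitianMetric where
  /-- The real inner product on the tangent space at each point. -/
  g : M → Cn n →ₗ[ℝ] Cn n →ₗ[ℝ] ℝ
  symm : ∀ x v w, g x v w = g x w v
  pos : ∀ x v, v ≠ 0 → 0 < g x v v
  J_invariant : ∀ x v w, g x (Complex.I • v) (Complex.I • w) = g x v w
  smooth : ∀ (x₀ : M) (v w : Cn n), ContDiffOn ℝ ∞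
    (fun y => g ((chartAt (Cn n) x₀).symm y) (chartSymmD x₀ y v) (chartSymmD x₀ y w))
    (chartAt (Cn n) x₀).target

/-- The matrix `g_{i\bar j} = (g(∂_{x^i}, ∂_{x^j}) + √-1 g(∂_{x^i}, J ∂_{x^j})) / 2` of a real
bilinear form on `ℂⁿ`. -/
def hermMatrix (b : Cn n → Cn n → ℝ) : Matrix (Fin n) (Fin n) ℂ :=
  Matrix.of fun i j => (1 / 2 : ℂ) * ((b (ex i) (ex j) : ℂ) + Complex.I * (b (ex i) (ey j) : ℂ))

namespace HermitianMetric

/-- The real `(1,1)`-form `√-1 ∑ g_{i\bar j} dz^i ∧ d\bar z^j`, that is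
`(X, Y) ↦ g(JX, Y)`. -/
def form (h : HermitianMetric n M) : Form n M := fun x =>
  Complex.I • ∑ i, ∑ j, hermMatrix (fun v w => h.g x v w) i j •
    (ExteriorAlgebra.ι ℂ (dz i) * ExteriorAlgebra.ι ℂ (dzbar j))

/-- The matrix `(g_{i\bar j})` in the preferred chart at `x₀`. -/
def localMatrix (h : HermitianMetric n M) (x₀ : M) (y : Cn n) : Matrix (Fin n) (Fin n) ℂ :=
  hermMatrix fun v w =>
    h.g ((chartAt (Cn n) x₀).symm y) (chartSymmD x₀ y v) (chartSymmD x₀ y w)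

/-- The Chern-Ricci form `-√-1 ∂\bar∂ log det (g_{i\bar j})`. -/
def ric (h : HermitianMetric n M) : Form n M := fun x =>
  pull (chartD x) (-Complex.I •
    delLoc (delbarLoc (scalarLoc fun y => Real.log (h.localMatrix x y).det.re))
      (chartAt (Cn n) x x))

/-- A Gauduchon metric: `∂\bar∂ ω^{n-1} = 0`. -/
def IsGauduchon (h : HermitianMetric n M) : Prop := del (delbar (h.form ^ (n - 1))) = 0

end HermitianMetric

/-- The Ricci form `-√-1 ∂\bar∂ log Ω` of a volume form `Ω`, where `log Ω` is the logarithm of the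
density of `Ω` in local coordinates. -/
def ricVol (Ω : Form n M) : Form n M := fun x =>
  pull (chartD x) (-Complex.I •
    delLoc (delbarLoc (scalarLoc fun y => Real.log (density (localRep Ω x y))))
      (chartAt (Cn n) x x))

/-! ## The continuity equation and the Monge-Ampère type equation -/

/-- `√-1 ∂\bar∂ u ∧ α^{n-2} + Re(√-1 ∂u ∧ \bar∂(α^{n-2}))`. -/
def hessForm (α : HermitianMetric n M) (u : M → ℝ) : Form n M :=
  (Complex.I • del (delbar (scalar u))) * α.form ^ (n - 2)
    + reF ((Complex.I • del (scalar u)) * delbar (α.form ^ (n - 2)))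

/-- `ω^{n-1} - s (n-1) (Ric(η) ∧ α^{n-2} - Re(√-1 ∂ log(η^n/α^n) ∧ \bar∂(α^{n-2})))` for Hermitian
metrics `ω = ω₀` and `η`. -/
def ceForm (ω₀ α : HermitianMetric n M) (s : ℝ) (η : HermitianMetric n M) : Form n M :=
  ω₀.form ^ (n - 1) - ((s * ((n : ℝ) - 1) : ℝ) : ℂ) •
    (η.ric * α.form ^ (n - 2)
      - reF ((Complex.I • del (scalar fun x => Real.log (volRatio (η.form ^ n) (α.form ^ n) x)))
          * delbar (α.form ^ (n - 2))))

/-- The continuity equation at time `s` for the Hermitian metric `η`. -/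
def SolvesCE (ω₀ α : HermitianMetric n M) (s : ℝ) (η : HermitianMetric n M) : Prop :=
  η.form ^ (n - 1) = ceForm ω₀ α s η ∧ IsPos (η.form ^ (n - 1))

/-- The form `Φ_s`. -/
def PhiForm (ω₀ α : HermitianMetric n M) (s : ℝ) : Form n M := ceForm ω₀ α s ω₀

/-- The volume form `Ω = ω₀^n e^{φ/((n-1) T)}`. -/
def OmegaVol (ω₀ : HermitianMetric n M) (T : ℝ) (φ : M → ℝ) : Form n M := fun x =>
  (Real.exp (φ x / (((n : ℝ) - 1) * T)) : ℂ) • (ω₀.form ^ n) x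

/-- The form `\hat ω_s^{n-1}
  = ω₀^{n-1} - s (n-1) (Ric(Ω) ∧ α^{n-2} - Re(√-1 ∂ log(Ω/α^n) ∧ \bar∂(α^{n-2})))`. -/
def hatForm (ω₀ α : HermitianMetric n M) (T : ℝ) (φ : M → ℝ) (s : ℝ) : Form n M :=
  ω₀.form ^ (n - 1) - ((s * ((n : ℝ) - 1) : ℝ) : ℂ) •
    (ricVol (OmegaVol ω₀ T φ) * α.form ^ (n - 2)
      - reF ((Complex.I • del (scalar fun x =>
            Real.log (volRatio (OmegaVol ω₀ T φ) (α.form ^ n) x)))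
          * delbar (α.form ^ (n - 2))))

/-- The form `\hat ω_s^{n-1} + s (√-1 ∂\bar∂ u ∧ α^{n-2} + Re(√-1 ∂u ∧ \bar∂(α^{n-2})))`. -/
def maForm (ω₀ α : HermitianMetric n M) (T : ℝ) (φ : M → ℝ) (s : ℝ) (u : M → ℝ) : Form n M :=
  hatForm ω₀ α T φ s + (s : ℂ) • hessForm α u

/-- `u` is a smooth solution of the Monge-Ampère type equation
`log (det Ψ / (e^{φ/T} det ω₀^{n-1})) - u = 0`, where `Ψ = maForm … u` is strictly positive. -/
def SolvesMA (ω₀ α : HermitianMetric n M) (T : ℝ) (φ : M → ℝ) (s : ℝ) (u : M → ℝ) : Prop :=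
  ContMDiff 𝓘(ℝ, Cn n) 𝓘(ℝ, ℝ) ∞ u ∧ IsPos (maForm ω₀ α T φ s u) ∧
    ∀ x, Real.log (lamDet (maForm ω₀ α T φ s u x) /
      (Real.exp (φ x / T) * lamDet ((ω₀.form ^ (n - 1)) x))) - u x = 0

end Manifold

end GauduchonContinuity

end

/-! For a Hermitian metric η put u = (n-1) log(η^n/ω₀^n) - φ/T (`potential`). As Ω = ω₀^n
e^{φ/((n-1)T)}, this says η^n = Ω e^{u/(n-1)}. Hence Ric(η) = Ric(Ω) - √-1∂∂̄u/(n-1) and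
log(η^n/α^n) = log(Ω/α^n) + u/(n-1), and the factor s(n-1) turns the right side of the continuity
equation into Ψ_u (`maForm_potential`). On the other hand det(η^{n-1}) is a universal constant times
(det η)^{n-1}, so log(det η^{n-1}/(e^{φ/T} det ω₀^{n-1})) = u for every η (`log_lamDet_div`). So a
solution η yields the solution u. Conversely, if u solves the scalar equation and η^{n-1} = Ψ_u,
that equation forces u to be the potential of η, and η solves the continuity equation.

For existence one needs a metric with η^{n-1} = Ψ_u. A positive (n-1,n-1)-form has exactly one
positive (n-1)-st root, and the root depends smoothly on the form (`rootMetric`). The algebra behind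
this is `formOf_pow_pred`: the (n-1)-st power of a (1,1)-form is governed by the adjugate of its
matrix. The Gauduchon condition involves only η^{n-1}, so it carries over.

Much of the length is analysis in charts. The operators ∂, ∂̄ and Ric are defined at each point in
the preferred chart of that point. Naturality under holomorphic maps (`delLoc_pullF`,
`delbarLoc_pullF`) and pluriharmonicity of log|h|² (`delLoc_delbarLoc_log_normSq`) show that one
formula holds throughout any fixed chart, so that Ψ_u is smooth. -/

noncomputable section

namespace GauduchonContinuity

/-! ## Multiplication of basis forms -/

section Basis

variable {R N : Type*} [CommRing R] [AddCommGroup N] [Module R N]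

theorem ι_mul_ι_comm (x y : N) :
    ExteriorAlgebra.ι R x * ExteriorAlgebra.ι R y
      = -(ExteriorAlgebra.ι R y * ExteriorAlgebra.ι R x) :=
  eq_neg_of_add_eq_zero_left (ExteriorAlgebra.ι_add_mul_swap x y)

theorem list_prod_mul_ι {I : Type*} (v : I → N) (l : List I) (x : N) :
    (l.map fun k => ExteriorAlgebra.ι R (v k)).prod * ExteriorAlgebra.ι R x
      = (-1 : R) ^ l.length •
        (ExteriorAlgebra.ι R x * (l.map fun k => ExteriorAlgebra.ι R (v k)).prod) := by
  induction l with
  | nil => simp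
  | cons a l ih =>
    rw [List.map_cons, List.prod_cons, mul_assoc, ih, mul_smul_comm, ← mul_assoc,
      ι_mul_ι_comm (v a) x, neg_mul, mul_assoc, List.length_cons, pow_succ]
    simp

variable {I : Type*} [LinearOrder I]

theorem basis_eq_prod_sort (b : Module.Basis I R N) (s : Finset I) :
    b.ExteriorAlgebra s = ((s.sort (· ≤ ·)).map fun k => ExteriorAlgebra.ι R (b k)).prod := by
  rw [ExteriorAlgebra.basis_apply_ofCard b (rfl : s.card = s.card)]
  unfold ExteriorAlgebra.ιMulti_family
  rw [ExteriorAlgebra.ιMulti_apply, ← Finset.listMap_orderEmbOfFin_finRange s rfl,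
    List.map_map, List.ofFn_eq_map]
  rfl

/-- The new factor moves left to its sorted place and changes sign once for each larger index it
passes. When `k ≤ a` the whole list is larger than `k`, so it passes everything. -/
theorem sorted_prod_mul_ι (v : I → N) (k : I) (l : List I) (hl : l.Pairwise (· ≤ ·))
    (hk : k ∉ l) :
    (l.map fun k => ExteriorAlgebra.ι R (v k)).prod * ExteriorAlgebra.ι R (v k)
      = (-1 : R) ^ (l.countP fun j => k < j) •
        ((l.orderedInsert (· ≤ ·) k).map fun k => ExteriorAlgebra.ι R (v k)).prod := by
  induction l with
  | nil => simp
  | cons a l ih =>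
    rw [List.pairwise_cons] at hl
    rw [List.mem_cons, not_or] at hk
    by_cases h : k ≤ a
    · have hc : (a :: l).countP (fun j => k < j) = (a :: l).length := by
        rw [List.countP_eq_length]
        intro j hj
        rcases List.mem_cons.1 hj with rfl | hj
        · simpa using lt_of_le_of_ne h hk.1
        · have : k ≠ j := fun e => hk.2 (e ▸ hj)
          simpa using lt_of_le_of_ne (h.trans (hl.1 j hj)) this
      rw [hc, list_prod_mul_ι, List.orderedInsert_cons, if_pos h, List.map_cons (a := k),
        List.prod_cons (a := ExteriorAlgebra.ι R (v k))]
    · rw [List.orderedInsert_cons, if_neg h, List.map_cons, List.prod_cons, mul_assoc,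
        ih hl.2 hk.2, List.countP_cons_of_neg (by simpa using le_of_not_ge h), List.map_cons,
        List.prod_cons, mul_smul_comm]

theorem orderedInsert_sort (s : Finset I) (k : I) (hk : k ∉ s) :
    (s.sort (· ≤ ·)).orderedInsert (· ≤ ·) k = (insert k s).sort (· ≤ ·) := by
  refine List.Perm.eq_of_pairwise (le := (· ≤ ·)) (fun a b _ _ h h' => le_antisymm h h')
    ((Finset.pairwise_sort s _).orderedInsert k _) (Finset.pairwise_sort _ _) ?_
  refine (List.perm_orderedInsert _ _ _).trans ?_
  rw [← Multiset.coe_eq_coe, Finset.sort_eq, Finset.insert_val_of_notMem hk, ← Multiset.cons_coe,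
    Finset.sort_eq]

theorem basis_mul_ι (b : Module.Basis I R N) (s : Finset I) (k : I) (hk : k ∉ s) :
    b.ExteriorAlgebra s * ExteriorAlgebra.ι R (b k)
      = (-1 : R) ^ (s.filter fun j => k < j).card • b.ExteriorAlgebra (insert k s) := by
  rw [basis_eq_prod_sort, basis_eq_prod_sort,
    sorted_prod_mul_ι _ _ _ (Finset.pairwise_sort s _) (by simpa using hk), orderedInsert_sort s k hk]
  congr 2
  rw [← Multiset.coe_countP, Finset.sort_eq, Multiset.countP_eq_card_filter, Finset.card_def,
    Finset.filter_val]

/-- Up to sign the factor of index `k` can be moved to the right end, where it meets its copy and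
squares to zero. -/
theorem basis_mul_ι_of_mem (b : Module.Basis I R N) (s : Finset I) (k : I) (hk : k ∈ s) :
    b.ExteriorAlgebra s * ExteriorAlgebra.ι R (b k) = 0 := by
  rw [← Finset.insert_erase hk]
  have h := basis_mul_ι b (s.erase k) k (by simp)
  set c : R := (-1 : R) ^ ((s.erase k).filter fun j => k < j).card
  have hc : c * c = 1 := by rw [← mul_pow]; simp
  have h' : b.ExteriorAlgebra (insert k (s.erase k))
      = c • (b.ExteriorAlgebra (s.erase k) * ExteriorAlgebra.ι R (b k)) := by
    rw [h, smul_smul, hc, one_smul]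
  rw [h', smul_mul_assoc, mul_assoc, ExteriorAlgebra.ι_sq_zero]
  simp

end Basis

/-! ## Powers of `(1,1)`-forms -/

variable {n : ℕ}

theorem covEquiv_symm_apply (c : Fin n ⊕ₗ Fin n → ℂ) : (covEquiv n).symm c
    = ∑ j, (c (toLex (Sum.inl j)) • dz j + c (toLex (Sum.inr j)) • dzbar j) := rfl

@[simp] theorem covBasis_inl (j : Fin n) : covBasis n (toLex (Sum.inl j)) = dz j := by
  rw [covBasis, Module.Basis.coe_ofEquivFun]
  change (covEquiv n).symm _ = _
  rw [covEquiv_symm_apply, Finset.sum_eq_single j]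
  · simp
  · intro i _ hi
    simp [hi]
  · simp

@[simp] theorem covBasis_inr (j : Fin n) : covBasis n (toLex (Sum.inr j)) = dzbar j := by
  rw [covBasis, Module.Basis.coe_ofEquivFun]
  change (covEquiv n).symm _ = _
  rw [covEquiv_symm_apply, Finset.sum_eq_single j]
  · simp
  · intro i _ hi
    simp [hi]
  · simp

theorem lamBasis_mul_dz (S : Finset (Fin n ⊕ₗ Fin n)) (j : Fin n) (h : toLex (Sum.inl j) ∉ S) :
    lamBasis n S * ExteriorAlgebra.ι ℂ (dz j)
      = (-1 : ℂ) ^ (S.filter fun l => toLex (Sum.inl j) < l).card •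
        lamBasis n (insert (toLex (Sum.inl j)) S) := by
  rw [← covBasis_inl]
  exact basis_mul_ι (covBasis n) S _ h

theorem lamBasis_mul_dzbar (S : Finset (Fin n ⊕ₗ Fin n)) (j : Fin n)
    (h : toLex (Sum.inr j) ∉ S) :
    lamBasis n S * ExteriorAlgebra.ι ℂ (dzbar j)
      = (-1 : ℂ) ^ (S.filter fun l => toLex (Sum.inr j) < l).card •
        lamBasis n (insert (toLex (Sum.inr j)) S) := by
  rw [← covBasis_inr]
  exact basis_mul_ι (covBasis n) S _ h

theorem card_filter_lex (p : Fin n ⊕ₗ Fin n → Prop) [DecidablePred p] :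
    (Finset.univ.filter p).card = (Finset.univ.filter fun i : Fin n => p (toLex (Sum.inl i))).card
      + (Finset.univ.filter fun i : Fin n => p (toLex (Sum.inr i))).card := by
  simp only [Finset.card_filter]
  rw [← (toLex : Fin n ⊕ Fin n ≃ _).sum_comp, Fintype.sum_sum_type]

/-- Passing a covector costs two signs, which cancel: elements of degree two are central. -/
theorem ι_mul_ι_commute {N : Type*} [AddCommGroup N] [Module ℂ N] (x y : N)
    (z : ExteriorAlgebra ℂ N) :
    Commute (ExteriorAlgebra.ι ℂ x * ExteriorAlgebra.ι ℂ y) z := by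
  induction z using ExteriorAlgebra.induction with
  | algebraMap r => exact Algebra.commute_algebraMap_right r _
  | ι z =>
    rw [Commute, SemiconjBy, mul_assoc, ι_mul_ι_comm y z, mul_neg, ← mul_assoc,
      ι_mul_ι_comm x z, neg_mul, neg_neg, mul_assoc]
  | mul a b ha hb => exact ha.mul_right hb
  | add a b ha hb => exact ha.add_right hb

theorem ι_mul_ι_sq {N : Type*} [AddCommGroup N] [Module ℂ N] (x y : N) :
    (ExteriorAlgebra.ι ℂ x * ExteriorAlgebra.ι ℂ y)
      * (ExteriorAlgebra.ι ℂ x * ExteriorAlgebra.ι ℂ y) = 0 := by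
  rw [mul_assoc, ← mul_assoc (ExteriorAlgebra.ι ℂ y), ι_mul_ι_comm y x, neg_mul, mul_assoc,
    ExteriorAlgebra.ι_sq_zero]
  simp

/-- The binomial expansion stops after the linear term. It serves both for adding one variable at a
time and for perturbing a single matrix entry. -/
theorem add_pow_of_sq_zero {A : Type*} [Ring A] (x a : A) (hc : Commute x a) (ha : a * a = 0)
    (k : ℕ) : (x + a) ^ (k + 1) = x ^ (k + 1) + ((k + 1 : ℕ) : A) * (x ^ k * a) := by
  induction k with
  | zero => simp
  | succ k ih =>
    rw [pow_succ, ih]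
    have h1 : x ^ k * a * a = 0 := by rw [mul_assoc, ha, mul_zero]
    have h2 : x ^ k * a * x = x ^ (k + 1) * a := by
      rw [mul_assoc, ← hc.eq, ← mul_assoc, pow_succ]
    rw [add_mul, mul_add, mul_add, mul_assoc _ _ x, h2, mul_assoc _ _ a, h1, ← pow_succ]
    push_cast
    noncomm_ring

/-- Induction on the number of variables. The vanishing of the next power is carried along because
it kills the term `σ ^ (k + 1)` in the expansion of `(σ + a) ^ (k + 1)`. -/
theorem sum_dz_dzbar_pow (k : ℕ) (hk : k ≤ n) :
    (∑ i ∈ Finset.univ.filter (fun i : Fin n => (i : ℕ) < k),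
        ExteriorAlgebra.ι ℂ (dz i) * ExteriorAlgebra.ι ℂ (dzbar i)) ^ k
      = ((k.factorial : ℂ) * (-1) ^ (k * (k - 1) / 2)) •
        lamBasis n (Finset.univ.filter fun l => Sum.elim Fin.val Fin.val (ofLex l) < k) ∧
    (∑ i ∈ Finset.univ.filter (fun i : Fin n => (i : ℕ) < k),
        ExteriorAlgebra.ι ℂ (dz i) * ExteriorAlgebra.ι ℂ (dzbar i)) ^ (k + 1) = 0 := by
  induction k with
  | zero =>
    simp [lamBasis, basis_eq_prod_sort]
  | succ k ih =>
    obtain ⟨h1, h2⟩ := ih (by omega)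
    have hk' : k < n := hk
    have hs : Finset.univ.filter (fun i : Fin n => (i : ℕ) < k + 1)
        = insert ⟨k, hk'⟩ (Finset.univ.filter (fun i : Fin n => (i : ℕ) < k)) := by
      ext i
      simp [Fin.ext_iff]
      omega
    rw [hs, Finset.sum_insert (by simp), add_comm]
    set σ := ∑ i ∈ Finset.univ.filter (fun i : Fin n => (i : ℕ) < k),
        ExteriorAlgebra.ι ℂ (dz i) * ExteriorAlgebra.ι ℂ (dzbar i)
    have hc : Commute σ (ExteriorAlgebra.ι ℂ (dz ⟨k, hk'⟩) * ExteriorAlgebra.ι ℂ (dzbar ⟨k, hk'⟩)) :=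
      (ι_mul_ι_commute _ _ _).symm
    rw [add_pow_of_sq_zero _ _ hc (ι_mul_ι_sq _ _), add_pow_of_sq_zero _ _ hc (ι_mul_ι_sq _ _),
      pow_succ σ (k + 1), h2, h1]
    refine ⟨?_, by simp⟩
    rw [zero_add, smul_mul_assoc, ← mul_assoc, lamBasis_mul_dz _ _ (by simp), smul_mul_assoc,
      lamBasis_mul_dzbar _ _ (by simp)]
    -- The new `dz` has to pass exactly the `k` factors `dzbar` already present; the new `dzbar`
    -- (`e2`) passes nothing. This produces the triangular exponent of the sign.
    have e1 : ((Finset.univ.filter fun l : Fin n ⊕ₗ Fin n =>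
        Sum.elim Fin.val Fin.val (ofLex l) < k).filter
          fun l => toLex (Sum.inl ⟨k, hk'⟩) < l).card = k := by
      rw [Finset.filter_filter, card_filter_lex]
      have a1 : (Finset.univ.filter fun i : Fin n => (i : ℕ) < k ∧ k < (i : ℕ)).card = 0 := by
        simp; intros; omega
      have a2 : (Finset.univ.filter fun i : Fin n => (i : ℕ) < k).card = k := by
        rw [Fin.card_filter_val_lt]; omega
      simpa [Fin.lt_def, -Fin.val_fin_lt, a2] using a1
    have e2 : ((insert (toLex (Sum.inl ⟨k, hk'⟩)) (Finset.univ.filter fun l : Fin n ⊕ₗ Fin n =>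
        Sum.elim Fin.val Fin.val (ofLex l) < k)).filter
          fun l => toLex (Sum.inr ⟨k, hk'⟩) < l).card = 0 := by
      rw [Finset.card_eq_zero, Finset.filter_eq_empty_iff]
      intro l hl
      rcases h : ofLex l with i | i <;> obtain rfl : l = toLex _ := h <;>
      simp [Fin.lt_def, -Fin.val_fin_lt] at hl ⊢
      omega
    have e3 : insert (toLex (Sum.inr ⟨k, hk'⟩)) (insert (toLex (Sum.inl ⟨k, hk'⟩))
        (Finset.univ.filter fun l : Fin n ⊕ₗ Fin n => Sum.elim Fin.val Fin.val (ofLex l) < k))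
        = Finset.univ.filter fun l => Sum.elim Fin.val Fin.val (ofLex l) < k + 1 := by
      ext l
      rcases h : ofLex l with i | i <;> obtain rfl : l = toLex _ := h <;>
      simp [Fin.ext_iff] <;> omega
    rw [e1, e2, e3, smul_smul, smul_smul, ← nsmul_eq_mul, ← Nat.cast_smul_eq_nsmul ℂ, smul_smul]
    congr 1
    have e4 : (k + 1) * (k + 1 - 1) / 2 = k * (k - 1) / 2 + k := by
      rcases k with _ | k
      · rfl
      · rw [show (k + 1 + 1) * (k + 1 + 1 - 1) = (k + 1) * (k + 1 - 1) + (k + 1) * 2 by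
          simp; ring, Nat.add_mul_div_right _ _ (by norm_num)]
    rw [e4, pow_add, Nat.factorial_succ]
    push_cast
    ring

/-- The `(1,1)`-form `√-1 ∑ A_{ij} dz^i ∧ d\bar z^j`. -/
def formOf (A : Matrix (Fin n) (Fin n) ℂ) : Lam n :=
  Complex.I • ∑ i, ∑ j, A i j • (ExteriorAlgebra.ι ℂ (dz i) * ExteriorAlgebra.ι ℂ (dzbar j))

/-- The form `(√-1 dz^1 ∧ d\bar z^1) ∧ ⋯ ∧ (√-1 dz^n ∧ d\bar z^n)`. -/
def volTop (n : ℕ) : Lam n :=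
  (Complex.I ^ n * (-1) ^ (n * (n - 1) / 2)) • lamBasis n Finset.univ

/-- In top degree all alternating maps are multiples of the determinant, so an endomorphism of
covectors acts on the top form through its determinant. -/
theorem map_lamBasis_univ (L : Cov n →ₗ[ℂ] Cov n) :
    ExteriorAlgebra.map L (lamBasis n Finset.univ) = LinearMap.det L • lamBasis n Finset.univ := by
  have hb : lamBasis n Finset.univ = ExteriorAlgebra.ιMulti ℂ _
      (covBasis n ∘ (Finset.univ : Finset (Fin n ⊕ₗ Fin n)).orderEmbOfFin rfl) := by
    rw [lamBasis, ExteriorAlgebra.basis_apply_ofCard _ rfl]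
    rfl
  have hbij : Function.Bijective ((Finset.univ : Finset (Fin n ⊕ₗ Fin n)).orderEmbOfFin rfl) := by
    rw [Fintype.bijective_iff_injective_and_card]
    exact ⟨((Finset.univ : Finset (Fin n ⊕ₗ Fin n)).orderEmbOfFin rfl).injective,
      (Fintype.card_fin _).trans rfl⟩
  set e := Equiv.ofBijective _ hbij
  set b := (covBasis n).reindex e.symm
  have hbe : covBasis n ∘ (Finset.univ : Finset (Fin n ⊕ₗ Fin n)).orderEmbOfFin rfl = b := by
    ext1 i
    rw [Module.Basis.reindex_apply, Equiv.symm_symm]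
    rfl
  rw [hb, hbe, ExteriorAlgebra.map_apply_ιMulti]
  -- An alternating map is determined by its values on injective families of basis vectors; here
  -- these are permutations of `b`, on which both sides change by the same sign.
  have key : ExteriorAlgebra.ιMulti ℂ (Finset.univ : Finset (Fin n ⊕ₗ Fin n)).card (M := Cov n)
      = (LinearMap.toSpanSingleton ℂ (Lam n) (ExteriorAlgebra.ιMulti ℂ _ b)).compAlternatingMap
        b.det := by
    refine Module.Basis.ext_alternating b fun i h => ?_
    let σ : Equiv.Perm _ := Equiv.ofBijective i (Finite.injective_iff_bijective.1 h)
    change ExteriorAlgebra.ιMulti ℂ _ (b ∘ σ) =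
      ((LinearMap.toSpanSingleton ℂ (Lam n) (ExteriorAlgebra.ιMulti ℂ _ b)).compAlternatingMap
        b.det) (b ∘ σ)
    rw [AlternatingMap.map_perm, AlternatingMap.map_perm]
    rw [LinearMap.compAlternatingMap_apply, LinearMap.toSpanSingleton_apply,
      Module.Basis.det_self, one_smul]
  conv_lhs => rw [key]
  rw [LinearMap.compAlternatingMap_apply, LinearMap.toSpanSingleton_apply, Module.Basis.det_comp,
    Module.Basis.det_self, mul_one]

/-- The linear map fixing `dz^i` and sending `d\bar z^i` to `∑ A_{ij} d\bar z^j`. -/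
def barMap (A : Matrix (Fin n) (Fin n) ℂ) : Cov n →ₗ[ℂ] Cov n :=
  (covBasis n).constr ℂ fun l => Sum.elim dz (fun i => ∑ j, A i j • dzbar j) (ofLex l)

theorem barMap_dz (A : Matrix (Fin n) (Fin n) ℂ) (i : Fin n) : barMap A (dz i) = dz i := by
  rw [← covBasis_inl, barMap, Module.Basis.constr_basis]
  simp

theorem barMap_dzbar (A : Matrix (Fin n) (Fin n) ℂ) (i : Fin n) :
    barMap A (dzbar i) = ∑ j, A i j • dzbar j := by
  rw [← covBasis_inr, barMap, Module.Basis.constr_basis]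
  simp

theorem det_barMap (A : Matrix (Fin n) (Fin n) ℂ) : LinearMap.det (barMap A) = A.det := by
  rw [← LinearMap.det_toMatrix ((covBasis n).reindex ofLex)]
  have : LinearMap.toMatrix ((covBasis n).reindex ofLex) ((covBasis n).reindex ofLex) (barMap A)
      = Matrix.fromBlocks 1 0 0 Aᵀ := by
    ext k l
    have hl : ∀ l : Fin n ⊕ Fin n, ((covBasis n).reindex ofLex) l = covBasis n (toLex l) :=
      fun l => by simp
    rw [LinearMap.toMatrix_apply, hl]
    rcases l with l | l
    · rw [covBasis_inl, barMap_dz, ← covBasis_inl]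
      rcases k with k | k <;>
        simp [-covBasis_inl, Finsupp.single_apply, Matrix.one_apply, eq_comm]
    · rw [covBasis_inr, barMap_dzbar]
      simp only [← covBasis_inr]
      rcases k with k | k <;> simp [-covBasis_inr, Finsupp.single_apply]
  rw [this, Matrix.det_fromBlocks_zero₂₁, Matrix.det_one, one_mul, Matrix.det_transpose]

/-- Every (1,1)-form is the image of the standard one under an algebra homomorphism, so its top
power is the standard one multiplied by the determinant of `barMap A`. -/
theorem map_barMap_formOf_one (A : Matrix (Fin n) (Fin n) ℂ) :
    ExteriorAlgebra.map (barMap A) (formOf 1) = formOf A := by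
  rw [formOf, formOf, map_smul, map_sum]
  congr 1
  refine Finset.sum_congr rfl fun i _ => ?_
  rw [Finset.sum_eq_single i (by intro j _ hj; simp [hj.symm]) (by simp)]
  simp [barMap_dz, barMap_dzbar, ExteriorAlgebra.map_apply_ι, Finset.mul_sum]

theorem formOf_one_pow : (formOf (1 : Matrix (Fin n) (Fin n) ℂ)) ^ n
    = (n.factorial : ℂ) • volTop n := by
  have h := (sum_dz_dzbar_pow n le_rfl).1
  have e : formOf (1 : Matrix (Fin n) (Fin n) ℂ) = Complex.I •
      ∑ i : Fin n, ExteriorAlgebra.ι ℂ (dz i) * ExteriorAlgebra.ι ℂ (dzbar i) := by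
    rw [formOf]
    congr 1
    refine Finset.sum_congr rfl fun i _ => ?_
    rw [Finset.sum_eq_single i (by intro j _ hj; simp [hj.symm]) (by simp)]
    simp
  have e1 : Finset.univ.filter (fun i : Fin n => (i : ℕ) < n) = Finset.univ := by
    simp
  have e2 : (Finset.univ.filter fun l : Fin n ⊕ₗ Fin n =>
      Sum.elim Fin.val Fin.val (ofLex l) < n) = Finset.univ := by
    ext l
    rcases h : ofLex l with i | i <;> simp [h]
  rw [e1, e2] at h
  rw [e, smul_pow, h, volTop, smul_smul, smul_smul]
  congr 1
  ring

theorem formOf_pow (A : Matrix (Fin n) (Fin n) ℂ) :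
    formOf A ^ n = ((n.factorial : ℂ) * A.det) • volTop n := by
  rw [← map_barMap_formOf_one, ← map_pow, formOf_one_pow, map_smul, volTop, map_smul,
    map_lamBasis_univ, det_barMap, smul_smul, smul_smul, smul_smul]
  congr 1
  ring

theorem omitIdx_inl_notMem (i j : Fin n) : toLex (Sum.inl i) ∉ omitIdx i j := by
  simp [omitIdx]

theorem insert_omitIdx (i j : Fin n) :
    insert (toLex (Sum.inr j)) (insert (toLex (Sum.inl i)) (omitIdx i j)) = Finset.univ := by
  ext l
  simp [omitIdx]
  tauto

theorem omitIdx_injective {i j k l : Fin n} (h : omitIdx i j = omitIdx k l) : i = k ∧ j = l := by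
  constructor
  · have : toLex (Sum.inl i) ∉ omitIdx k l := h ▸ omitIdx_inl_notMem i j
    simpa [omitIdx] using this
  · have : toLex (Sum.inr j) ∉ omitIdx k l := h ▸ by simp [omitIdx]
    simpa [omitIdx] using this

/-- With indices from 0, `dz i` passes `n - 1 - i` holomorphic and `n - 1` antiholomorphic factors,
and `dzbar j` passes `n - 1 - j`. Only the parity of the total matters. -/
theorem lamBasis_omitIdx_mul (i j : Fin n) :
    lamBasis n (omitIdx i j) * (ExteriorAlgebra.ι ℂ (dz i) * ExteriorAlgebra.ι ℂ (dzbar j))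
      = (-1 : ℂ) ^ (n - 1 + i + j) • lamBasis n Finset.univ := by
  rw [← mul_assoc, lamBasis_mul_dz _ _ (omitIdx_inl_notMem i j), smul_mul_assoc,
    lamBasis_mul_dzbar _ _ (by simp [omitIdx]), insert_omitIdx, smul_smul, ← pow_add]
  congr 1
  have hi := i.2
  have hj := j.2
  have c1 : ((omitIdx i j).filter fun l => toLex (Sum.inl i) < l).card
      = (n - 1 - i) + (n - 1) := by
    have : (omitIdx i j).filter (fun l => toLex (Sum.inl i) < l)
        = Finset.univ.filter fun l => l ∈ omitIdx i j ∧ toLex (Sum.inl i) < l := by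
      ext; simp
    rw [this, card_filter_lex]
    congr 1
    · have : (Finset.univ.filter fun k : Fin n => toLex (Sum.inl k) ∈ omitIdx i j ∧
          toLex (Sum.inl i : Fin n ⊕ Fin n) < toLex (Sum.inl k)) = Finset.Ioi i := by
        ext k
        simp only [omitIdx, Finset.mem_filter, Finset.mem_univ, true_and, Finset.mem_sdiff,
          Finset.mem_insert, Finset.mem_singleton, toLex_inj, Sum.inl.injEq, reduceCtorEq, or_false,
          Sum.Lex.inl_lt_inl_iff, Finset.mem_Ioi]
        exact ⟨fun h => h.2, fun h => ⟨h.ne', h⟩⟩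
      rw [this, Fin.card_Ioi]
    · have : (Finset.univ.filter fun k : Fin n => toLex (Sum.inr k) ∈ omitIdx i j ∧
          toLex (Sum.inl i : Fin n ⊕ Fin n) < toLex (Sum.inr k)) = Finset.univ.erase j := by
        ext k
        simp [omitIdx]
      rw [this, Finset.card_erase_of_mem (by simp), Finset.card_univ, Fintype.card_fin]
  have c2 : ((insert (toLex (Sum.inl i)) (omitIdx i j)).filter
      fun l => toLex (Sum.inr j) < l).card = n - 1 - j := by
    have : (insert (toLex (Sum.inl i)) (omitIdx i j)).filter (fun l => toLex (Sum.inr j) < l)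
        = Finset.univ.filter fun l => l ∈ insert (toLex (Sum.inl i)) (omitIdx i j) ∧
          toLex (Sum.inr j) < l := by
      ext; simp
    rw [this, card_filter_lex]
    have h1 : (Finset.univ.filter fun k : Fin n =>
        toLex (Sum.inl k) ∈ insert (toLex (Sum.inl i)) (omitIdx i j) ∧
          toLex (Sum.inr j : Fin n ⊕ Fin n) < toLex (Sum.inl k)) = ∅ := by
      ext k
      simp
    have h2 : (Finset.univ.filter fun k : Fin n =>
        toLex (Sum.inr k) ∈ insert (toLex (Sum.inl i)) (omitIdx i j) ∧
          toLex (Sum.inr j : Fin n ⊕ Fin n) < toLex (Sum.inr k)) = Finset.Ioi j := by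
      ext k
      simp only [omitIdx, Finset.mem_filter, Finset.mem_univ, true_and, Finset.mem_sdiff,
        Finset.mem_insert, Finset.mem_singleton, toLex_inj, Sum.inr.injEq, reduceCtorEq, false_or,
        Sum.Lex.inr_lt_inr_iff, Finset.mem_Ioi]
      exact ⟨fun h => h.2, fun h => ⟨h.ne', h⟩⟩
    rw [h1, h2, Fin.card_Ioi, Finset.card_empty, zero_add]
  rw [c1, c2]
  apply neg_one_pow_congr
  simp only [Nat.even_iff]
  omega

theorem omitSign_ne_zero (i j : Fin n) : omitSign i j ≠ 0 := by
  simp [omitSign]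

/-- Wedging with one elementary (1,1)-form reads off one matrix entry: every other term already
contains `dz i` or `dzbar j`. The normalisation `omitSign` is what makes the remaining sign
disappear. -/
theorem ofMatrix_mul (P : Matrix (Fin n) (Fin n) ℂ) (i j : Fin n) :
    ofMatrix P * (Complex.I • (ExteriorAlgebra.ι ℂ (dz i) * ExteriorAlgebra.ι ℂ (dzbar j)))
      = P i j • volTop n := by
  have hz : ∀ k l : Fin n, (k ≠ i ∨ l ≠ j) → lamBasis n (omitIdx k l) *
      (ExteriorAlgebra.ι ℂ (dz i) * ExteriorAlgebra.ι ℂ (dzbar j)) = 0 := by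
    intro k l h
    by_cases hk : i = k
    · have hl : j ≠ l := by
        rintro rfl
        exact h.elim (fun h => h hk.symm) fun h => h rfl
      -- Here the repeated factor is `dzbar j`, so the two covectors are swapped to bring it next to
      -- the basis form.
      rw [(ι_mul_ι_commute _ _ _).symm.eq, ι_mul_ι_comm, neg_mul,
        ← (ι_mul_ι_commute _ _ _).symm.eq, ← mul_assoc, ← covBasis_inr]
      unfold lamBasis
      rw [basis_mul_ι_of_mem _ _ _ (by simp [omitIdx, hl])]
      simp
    · rw [← mul_assoc, ← covBasis_inl]
      unfold lamBasis
      rw [basis_mul_ι_of_mem _ _ _ (by simp [omitIdx, hk])]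
      simp
  rw [ofMatrix, Finset.sum_mul, Finset.sum_eq_single i]
  · rw [Finset.sum_mul, Finset.sum_eq_single j]
    · rw [smul_mul_smul_comm, lamBasis_omitIdx_mul, volTop, smul_smul, smul_smul]
      congr 1
      have hn : 0 < n := i.pos
      rw [omitSign]
      have e1 : Complex.I ^ n = Complex.I ^ (n - 1) * Complex.I := by
        rw [← pow_succ]; congr 1; omega
      have e2 : n * (n + 1) / 2 = n * (n - 1) / 2 + n := by
        obtain ⟨m, rfl⟩ : ∃ m, n = m + 1 := ⟨n - 1, by omega⟩
        rw [show (m + 1) * (m + 1 + 1) = (m + 1) * (m + 1 - 1) + (m + 1) * 2 by simp; ring,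
          Nat.add_mul_div_right _ _ (by norm_num)]
      have e3 : (-1 : ℂ) ^ (n * (n + 1) / 2 + (i : ℕ) + (j : ℕ) + 1) * (-1) ^ (n - 1 + i + j)
          = (-1) ^ (n * (n - 1) / 2) := by
        rw [e2, ← pow_add]
        apply neg_one_pow_congr
        simp only [Nat.even_iff]
        omega
      rw [e1, ← e3]
      ring
    · intro l _ hl
      rw [smul_mul_smul_comm, hz _ _ (Or.inr hl), smul_zero]
    · simp
  · intro k _ hk
    rw [Finset.sum_mul]
    refine Finset.sum_eq_zero fun l _ => ?_
    rw [smul_mul_smul_comm, hz _ _ (Or.inl hk), smul_zero]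
  · simp

theorem volTop_ne_zero : volTop n ≠ 0 := by
  rw [volTop, smul_ne_zero_iff]
  exact ⟨by simp, (lamBasis n).ne_zero _⟩

/-! ### Bidegree -/

/-- The forms of bidegree `(p,q)`. -/
def bidegree (n p q : ℕ) : Submodule ℂ (Lam n) :=
  Submodule.span ℂ {ψ | ∃ S : Finset (Fin n ⊕ₗ Fin n), ψ = lamBasis n S ∧
    (Finset.univ.filter fun i => toLex (Sum.inl i) ∈ S).card = p ∧
    (Finset.univ.filter fun i => toLex (Sum.inr i) ∈ S).card = q}

theorem mul_dz_mem_bidegree {p q : ℕ} {ψ : Lam n} (h : ψ ∈ bidegree n p q) (j : Fin n) :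
    ψ * ExteriorAlgebra.ι ℂ (dz j) ∈ bidegree n (p + 1) q := by
  induction h using Submodule.span_induction with
  | mem x hx =>
    obtain ⟨S, rfl, hp, hq⟩ := hx
    by_cases hj : toLex (Sum.inl j) ∈ S
    · rw [← covBasis_inl, lamBasis, basis_mul_ι_of_mem _ _ _ hj]
      exact Submodule.zero_mem _
    · rw [lamBasis_mul_dz _ _ hj]
      refine Submodule.smul_mem _ _ (Submodule.subset_span ⟨_, rfl, ?_, ?_⟩)
      · have : (Finset.univ.filter fun i => toLex (Sum.inl i) ∈ insert (toLex (Sum.inl j)) S)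
            = insert j (Finset.univ.filter fun i => toLex (Sum.inl i) ∈ S) := by
          ext; simp
        rw [this, Finset.card_insert_of_notMem (by simpa using hj), hp]
      · simpa using hq
  | zero => simp
  | add x y _ _ hx hy => rw [add_mul]; exact Submodule.add_mem _ hx hy
  | smul c x _ hx => rw [smul_mul_assoc]; exact Submodule.smul_mem _ _ hx

theorem mul_dzbar_mem_bidegree {p q : ℕ} {ψ : Lam n} (h : ψ ∈ bidegree n p q) (j : Fin n) :
    ψ * ExteriorAlgebra.ι ℂ (dzbar j) ∈ bidegree n p (q + 1) := by
  induction h using Submodule.span_induction with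
  | mem x hx =>
    obtain ⟨S, rfl, hp, hq⟩ := hx
    by_cases hj : toLex (Sum.inr j) ∈ S
    · rw [← covBasis_inr, lamBasis, basis_mul_ι_of_mem _ _ _ hj]
      exact Submodule.zero_mem _
    · rw [lamBasis_mul_dzbar _ _ hj]
      refine Submodule.smul_mem _ _ (Submodule.subset_span ⟨_, rfl, ?_, ?_⟩)
      · simpa using hp
      · have : (Finset.univ.filter fun i => toLex (Sum.inr i) ∈ insert (toLex (Sum.inr j)) S)
            = insert j (Finset.univ.filter fun i => toLex (Sum.inr i) ∈ S) := by
          ext; simp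
        rw [this, Finset.card_insert_of_notMem (by simpa using hj), hq]
  | zero => simp
  | add x y _ _ hx hy => rw [add_mul]; exact Submodule.add_mem _ hx hy
  | smul c x _ hx => rw [smul_mul_assoc]; exact Submodule.smul_mem _ _ hx

theorem formOf_pow_mem_bidegree (A : Matrix (Fin n) (Fin n) ℂ) (k : ℕ) :
    formOf A ^ k ∈ bidegree n k k := by
  induction k with
  | zero =>
    refine Submodule.subset_span ⟨∅, ?_, by simp, by simp⟩
    simp [lamBasis, basis_eq_prod_sort]
  | succ k ih =>
    rw [pow_succ]
    nth_rewrite 2 [formOf]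
    rw [mul_smul_comm, Finset.mul_sum]
    refine Submodule.smul_mem _ _ (Submodule.sum_mem _ fun i _ => ?_)
    rw [Finset.mul_sum]
    refine Submodule.sum_mem _ fun j _ => ?_
    rw [mul_smul_comm, ← mul_assoc]
    exact Submodule.smul_mem _ _ (mul_dzbar_mem_bidegree (mul_dz_mem_bidegree ih i) j)

theorem coeff_lamBasis (S T : Finset (Fin n ⊕ₗ Fin n)) :
    coeff S (lamBasis n T) = if T = S then 1 else 0 := by
  simp [coeff, Finsupp.single_apply]

theorem coeffMatrix_ofMatrix (P : Matrix (Fin n) (Fin n) ℂ) : coeffMatrix (ofMatrix P) = P := by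
  ext i j
  have : coeff (omitIdx i j) (ofMatrix P) = omitSign i j * P i j := by
    have h : coeff (omitIdx i j) (ofMatrix P)
        = ∑ k, ∑ l, (omitSign k l * P k l) * coeff (omitIdx i j) (lamBasis n (omitIdx k l)) := by
      simp only [coeff, ofMatrix, map_sum, map_smul, Finsupp.coe_finsetSum, Finset.sum_apply,
        Finsupp.smul_apply, smul_eq_mul]
    rw [h, Finset.sum_eq_single i, Finset.sum_eq_single j]
    · simp [coeff_lamBasis]
    · intro l _ hl
      rw [coeff_lamBasis, if_neg fun h => hl (omitIdx_injective h).2, mul_zero]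
    · simp
    · intro k _ hk
      refine Finset.sum_eq_zero fun l _ => ?_
      rw [coeff_lamBasis, if_neg fun h => hk (omitIdx_injective h).1, mul_zero]
    · simp
  rw [coeffMatrix, Matrix.of_apply, this, mul_div_cancel_left₀ _ (omitSign_ne_zero i j)]

theorem exists_omitIdx {n : ℕ} (hn : 1 ≤ n) (S : Finset (Fin n ⊕ₗ Fin n))
    (h1 : (Finset.univ.filter fun i => toLex (Sum.inl i) ∈ S).card = n - 1)
    (h2 : (Finset.univ.filter fun i => toLex (Sum.inr i) ∈ S).card = n - 1) :
    ∃ i j, S = omitIdx i j := by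
  have key : ∀ s : Finset (Fin n), s.card = n - 1 → ∃ i, ∀ k, k ∈ s ↔ k ≠ i := by
    intro s hs
    have : sᶜ.card = 1 := by rw [Finset.card_compl, hs, Fintype.card_fin]; omega
    obtain ⟨i, hi⟩ := Finset.card_eq_one.1 this
    refine ⟨i, fun k => ?_⟩
    rw [← Finset.notMem_compl, hi, Finset.mem_singleton]
  obtain ⟨i, hi⟩ := key _ h1
  obtain ⟨j, hj⟩ := key _ h2
  refine ⟨i, j, ?_⟩
  ext l
  rcases h : ofLex l with k | k <;> obtain rfl : l = toLex _ := h
  · simpa [omitIdx] using hi k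
  · simpa [omitIdx] using hj k

theorem eq_ofMatrix_of_mem_bidegree {n : ℕ} (hn : 1 ≤ n) {ψ : Lam n}
    (h : ψ ∈ bidegree n (n - 1) (n - 1)) : ∃ P, ψ = ofMatrix P := by
  induction h using Submodule.span_induction with
  | mem x hx =>
    obtain ⟨S, rfl, hp, hq⟩ := hx
    obtain ⟨i, j, rfl⟩ := exists_omitIdx hn S hp hq
    refine ⟨Matrix.single i j (omitSign i j)⁻¹, ?_⟩
    rw [ofMatrix, Finset.sum_eq_single i, Finset.sum_eq_single j]
    · simp [omitSign_ne_zero]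
    · intro l _ hl
      simp [hl.symm]
    · simp
    · intro k _ hk
      simp [hk.symm]
    · simp
  | zero => exact ⟨0, by simp [ofMatrix]⟩
  | add x y _ _ hx hy =>
    obtain ⟨P, rfl⟩ := hx
    obtain ⟨Q, rfl⟩ := hy
    exact ⟨P + Q, by simp [ofMatrix, mul_add, add_smul, Finset.sum_add_distrib]⟩
  | smul c x _ hx =>
    obtain ⟨P, rfl⟩ := hx
    exact ⟨c • P, by simp [ofMatrix, Finset.smul_sum, smul_smul, mul_left_comm]⟩

theorem formOf_add_single (A : Matrix (Fin n) (Fin n) ℂ) (i j : Fin n) :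
    formOf (A + Matrix.single i j 1) = formOf A
      + Complex.I • (ExteriorAlgebra.ι ℂ (dz i) * ExteriorAlgebra.ι ℂ (dzbar j)) := by
  rw [formOf, formOf, ← smul_add]
  congr 1
  simp only [Matrix.add_apply, add_smul, Finset.sum_add_distrib]
  congr 1
  rw [Finset.sum_eq_single i, Finset.sum_eq_single j]
  · simp
  · intro l _ hl
    simp [hl.symm]
  · simp
  · intro k _ hk
    simp [hk.symm]
  · simp

/-- The determinant is affine in a single entry, with the cofactor as slope. Compared with
`add_pow_of_sq_zero` this identifies the (n-1)-st power of a (1,1)-form. -/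
theorem det_add_single (A : Matrix (Fin n) (Fin n) ℂ) (i j : Fin n) :
    (A + Matrix.single i j 1).det = A.det + A.adjugate j i := by
  have : A + Matrix.single i j 1 = A.updateRow i (A i + Pi.single j 1) := by
    ext k l
    by_cases hk : k = i
    · subst hk
      simp [Matrix.single_apply, Pi.single_apply, eq_comm]
    · simp [hk, Ne.symm hk]
  rw [this, Matrix.det_updateRow_add, Matrix.updateRow_eq_self, Matrix.adjugate_apply]

/-- The `(n-1)`-st power of a `(1,1)`-form in terms of the adjugate of its matrix. -/
theorem formOf_pow_pred (hn : 1 ≤ n) (A : Matrix (Fin n) (Fin n) ℂ) :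
    formOf A ^ (n - 1) = ofMatrix (((n - 1).factorial : ℂ) • A.adjugateᵀ) := by
  obtain ⟨P, hP⟩ := eq_ofMatrix_of_mem_bidegree hn (formOf_pow_mem_bidegree A (n - 1))
  rw [hP]
  congr 1
  ext i j
  set θ : Lam n := Complex.I • (ExteriorAlgebra.ι ℂ (dz i) * ExteriorAlgebra.ι ℂ (dzbar j))
  have h1 := ofMatrix_mul P i j
  -- The top power of the perturbed form is computed twice: by the determinant it gains n! times a
  -- cofactor, by the binomial formula n times the product of `formOf A ^ (n - 1)` with `θ`.
  -- Comparing the two gives the entry `P i j`.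
  have h2 := formOf_pow (A + Matrix.single i j 1)
  have h3 := formOf_pow A
  have hc : Commute (formOf A) θ := ((ι_mul_ι_commute _ _ _).smul_left _).symm
  have hθ : θ * θ = 0 := by
    simp only [θ]
    rw [smul_mul_smul_comm, ι_mul_ι_sq, smul_zero]
  obtain ⟨m, rfl⟩ : ∃ m, n = m + 1 := ⟨n - 1, by omega⟩
  rw [formOf_add_single, add_pow_of_sq_zero _ _ hc hθ, h3, det_add_single, mul_add, add_smul,
    add_right_inj] at h2
  rw [Nat.add_sub_cancel] at hP ⊢
  rw [hP, h1, ← nsmul_eq_mul, ← Nat.cast_smul_eq_nsmul ℂ, smul_smul] at h2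
  have h4 := smul_left_injective ℂ volTop_ne_zero h2
  rw [Nat.factorial_succ] at h4
  have hm : ((m + 1 : ℕ) : ℂ) ≠ 0 := by positivity
  rw [Matrix.smul_apply, Matrix.transpose_apply, smul_eq_mul]
  apply mul_left_cancel₀ hm
  rw [h4]
  push_cast
  ring

/-! ## Pullback of `(1,1)`-forms and Hermitian matrices -/

/-- Pullback of covectors under a complex linear map. -/
def covPull (A : Cn n →L[ℂ] Cn n) : Cov n →ₗ[ℂ] Cov n where
  toFun L := L ∘ₗ (A.toLinearMap.restrictScalars ℝ)
  map_add' _ _ := rfl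
  map_smul' _ _ := rfl

@[simp] theorem covPull_apply (A : Cn n →L[ℂ] Cn n) (L : Cov n) (v : Cn n) :
    covPull A L v = L (A v) := rfl

@[simp] theorem pull_ι (A : Cn n →L[ℂ] Cn n) (L : Cov n) :
    pull A (ExteriorAlgebra.ι ℂ L) = ExteriorAlgebra.ι ℂ (covPull A L) :=
  ExteriorAlgebra.map_apply_ι _ _

theorem pull_pull (A B : Cn n →L[ℂ] Cn n) (ψ : Lam n) :
    pull A (pull B ψ) = pull (B.comp A) ψ := by
  change ((pull A).comp (pull B)) ψ = _
  congr 1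
  apply ExteriorAlgebra.hom_ext
  ext L
  simp only [AlgHom.comp_toLinearMap, LinearMap.comp_apply, AlgHom.toLinearMap_apply, pull_ι]
  rfl

@[simp] theorem pull_id (ψ : Lam n) : pull (ContinuousLinearMap.id ℂ (Cn n)) ψ = ψ := by
  change _ = (AlgHom.id ℂ (Lam n)) ψ
  congr 1
  apply ExteriorAlgebra.hom_ext
  ext L
  simp only [LinearMap.comp_apply, AlgHom.toLinearMap_apply, pull_ι]
  rfl

/-- The matrix of a complex linear map. -/
def matOf (A : Cn n →L[ℂ] Cn n) : Matrix (Fin n) (Fin n) ℂ := LinearMap.toMatrix' A.toLinearMap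

theorem matOf_mulVec (A : Cn n →L[ℂ] Cn n) (v : Cn n) : matOf A *ᵥ v = A v :=
  LinearMap.toMatrix'_mulVec A.toLinearMap v

theorem covPull_dz (A : Cn n →L[ℂ] Cn n) (i : Fin n) : covPull A (dz i) = ∑ k, matOf A i k • dz k := by
  refine LinearMap.ext fun v => ?_
  rw [covPull_apply, dz_apply, ← matOf_mulVec]
  simp [Matrix.mulVec, dotProduct]

theorem covPull_dzbar (A : Cn n →L[ℂ] Cn n) (i : Fin n) :
    covPull A (dzbar i) = ∑ k, conj (matOf A i k) • dzbar k := by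
  refine LinearMap.ext fun v => ?_
  rw [covPull_apply, dzbar_apply, ← matOf_mulVec]
  simp [Matrix.mulVec, dotProduct]

/-- The coefficient matrix of the pullback of the form with coefficient matrix `G`. -/
def pullMat (A : Cn n →L[ℂ] Cn n) (G : Matrix (Fin n) (Fin n) ℂ) : Matrix (Fin n) (Fin n) ℂ :=
  (matOf A)ᵀ * G * (matOf A).map conj

theorem pull_formOf (A : Cn n →L[ℂ] Cn n) (G : Matrix (Fin n) (Fin n) ℂ) :
    pull A (formOf G) = formOf (pullMat A G) := by
  have h : ∀ i j, G i j • (pull A (ExteriorAlgebra.ι ℂ (dz i) * ExteriorAlgebra.ι ℂ (dzbar j)))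
      = ∑ k, ∑ l, (matOf A i k * G i j * conj (matOf A j l)) •
        (ExteriorAlgebra.ι ℂ (dz k) * ExteriorAlgebra.ι ℂ (dzbar l)) := by
    intro i j
    rw [map_mul, pull_ι, pull_ι, covPull_dz, covPull_dzbar, map_sum, map_sum, Finset.sum_mul_sum,
      Finset.smul_sum]
    refine Finset.sum_congr rfl fun k _ => ?_
    rw [Finset.smul_sum]
    refine Finset.sum_congr rfl fun l _ => ?_
    rw [map_smul, map_smul, smul_mul_smul_comm, smul_smul]
    congr 1
    ring
  rw [formOf, formOf, map_smul, map_sum]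
  congr 1
  simp only [map_sum, map_smul, h]
  have e : ∀ k l, pullMat A G k l = ∑ i, ∑ j, matOf A i k * G i j * conj (matOf A j l) := by
    intro k l
    rw [pullMat, Matrix.mul_apply]
    simp only [Matrix.mul_apply, Matrix.transpose_apply, Matrix.map_apply, Finset.sum_mul]
    exact Finset.sum_comm
  simp only [e, Finset.sum_smul]
  calc _ = ∑ i, ∑ k, ∑ j, ∑ l, (matOf A i k * G i j * conj (matOf A j l)) •
        (ExteriorAlgebra.ι ℂ (dz k) * ExteriorAlgebra.ι ℂ (dzbar l)) :=
        Finset.sum_congr rfl fun i _ => Finset.sum_comm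
    _ = ∑ k, ∑ i, ∑ j, ∑ l, (matOf A i k * G i j * conj (matOf A j l)) •
        (ExteriorAlgebra.ι ℂ (dz k) * ExteriorAlgebra.ι ℂ (dzbar l)) := Finset.sum_comm
    _ = ∑ k, ∑ i, ∑ l, ∑ j, (matOf A i k * G i j * conj (matOf A j l)) •
        (ExteriorAlgebra.ι ℂ (dz k) * ExteriorAlgebra.ι ℂ (dzbar l)) :=
        Finset.sum_congr rfl fun k _ => Finset.sum_congr rfl fun i _ => Finset.sum_comm
    _ = _ := Finset.sum_congr rfl fun k _ => Finset.sum_comm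

theorem det_pullMat (A : Cn n →L[ℂ] Cn n) (G : Matrix (Fin n) (Fin n) ℂ) :
    (pullMat A G).det = ((Complex.normSq (matOf A).det : ℝ) : ℂ) * G.det := by
  have h : ((matOf A).map conj).det = conj (matOf A).det := (RingHom.map_det _ _).symm
  rw [pullMat, Matrix.det_mul, Matrix.det_mul, Matrix.det_transpose, h, ← Complex.mul_conj]
  ring

/-! ### J-invariant real bilinear forms and Hermitian matrices. -/

/-- The sesquilinear pairing with matrix `G`. -/
def hermPair (G : Matrix (Fin n) (Fin n) ℂ) (v w : Cn n) : ℂ := v ⬝ᵥ (G *ᵥ star w)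

theorem hermPair_pullMat (A : Cn n →L[ℂ] Cn n) (G : Matrix (Fin n) (Fin n) ℂ) (v w : Cn n) :
    hermPair (pullMat A G) v w = hermPair G (A v) (A w) := by
  have h : star (matOf A *ᵥ w) = (matOf A).map conj *ᵥ star w := by
    ext i
    simp [Matrix.mulVec, dotProduct]
  rw [hermPair, hermPair, ← matOf_mulVec, ← matOf_mulVec, h, pullMat, ← Matrix.mulVec_mulVec,
    ← Matrix.mulVec_mulVec, Matrix.dotProduct_mulVec, Matrix.vecMul_transpose]

/-- The real bilinear form whose matrix is `G`. -/
def hermBilin (G : Matrix (Fin n) (Fin n) ℂ) : Cn n →ₗ[ℝ] Cn n →ₗ[ℝ] ℝ :=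
  LinearMap.mk₂ ℝ (fun v w => 2 * (hermPair G v w).re)
    (fun v v' w => by simp [hermPair, mul_add])
    (fun c v w => by simp [hermPair, smul_dotProduct]; ring)
    (fun v w w' => by simp [hermPair, Matrix.mulVec_add, mul_add])
    (fun c v w => by simp [hermPair, Matrix.mulVec_smul, dotProduct_smul]; ring)

theorem hermBilin_apply (G : Matrix (Fin n) (Fin n) ℂ) (v w : Cn n) :
    hermBilin G v w = 2 * (hermPair G v w).re := rfl

theorem hermMatrix_hermBilin (G : Matrix (Fin n) (Fin n) ℂ) :
    hermMatrix (fun v w => hermBilin G v w) = G := by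
  ext i j
  have h1 : star (ex j : Cn n) = Pi.single j 1 := by
    ext k; simp [ex, Pi.single_apply, apply_ite]
  have h2 : star (ey j : Cn n) = Pi.single j (-Complex.I) := by
    ext k; by_cases hk : k = j <;> simp [ey, hk]
  simp only [hermMatrix, Matrix.of_apply, hermBilin_apply, hermPair, h1, h2]
  apply Complex.ext <;> simp [ex]

/-- J-invariance expresses the values on (y,y) and (y,x) pairs through those on (x,x) and (x,y)
pairs, and the latter are the real and imaginary parts recorded in `hermMatrix`. -/
theorem hermBilin_hermMatrix (b : Cn n →ₗ[ℝ] Cn n →ₗ[ℝ] ℝ)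
    (hJ : ∀ v w, b (Complex.I • v) (Complex.I • w) = b v w) :
    hermBilin (hermMatrix fun v w => b v w) = b := by
  have hx : ∀ i : Fin n, Complex.I • (ex i : Cn n) = ey i := fun i => by
    ext k; simp [ex, ey, Pi.single_apply]
  have hy : ∀ i : Fin n, Complex.I • (ey i : Cn n) = -ex i := fun i => by
    ext k; by_cases hk : k = i <;> simp [ex, ey, hk]
  have hyy : ∀ i j : Fin n, b (ey i) (ey j) = b (ex i) (ex j) := fun i j => by
    rw [← hx, ← hx, hJ]
  have hyx : ∀ i j : Fin n, b (ey i) (ex j) = -b (ex i) (ey j) := fun i j => by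
    rw [← hJ (ex i) (ey j), hx, hy, map_neg, neg_neg]
  refine LinearMap.ext fun v => LinearMap.ext fun w => ?_
  have e : b v w = ∑ i, ∑ j, ((v i).re * (w j).re * b (ex i) (ex j)
      + (v i).re * (w j).im * b (ex i) (ey j) + (v i).im * (w j).re * b (ey i) (ex j)
      + (v i).im * (w j).im * b (ey i) (ey j)) := by
    conv_lhs => rw [sum_ex_ey v, sum_ex_ey w]
    simp only [map_sum, map_add, map_smul, LinearMap.sum_apply, LinearMap.add_apply,
      LinearMap.smul_apply, smul_eq_mul]
    conv_rhs => rw [Finset.sum_comm]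
    refine Finset.sum_congr rfl fun i _ => ?_
    rw [Finset.mul_sum, Finset.mul_sum, ← Finset.sum_add_distrib]
    refine Finset.sum_congr rfl fun j _ => ?_
    ring
  rw [e, hermBilin_apply, hermPair, dotProduct]
  simp only [Matrix.mulVec, dotProduct, Finset.mul_sum, Complex.re_sum]
  refine Finset.sum_congr rfl fun i _ => Finset.sum_congr rfl fun j _ => ?_
  rw [hyy, hyx]
  simp [hermMatrix]
  ring

theorem hermPair_conj (G : Matrix (Fin n) (Fin n) ℂ) (hG : G.IsHermitian) (v w : Cn n) :
    conj (hermPair G v w) = hermPair G w v := by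
  have hG' : ∀ i j, conj (G i j) = G j i := fun i j => hG.apply j i
  simp only [hermPair, dotProduct, Matrix.mulVec, Finset.mul_sum, map_sum, map_mul, hG', Pi.star_apply]
  rw [Finset.sum_comm]
  refine Finset.sum_congr rfl fun i _ => Finset.sum_congr rfl fun j _ => ?_
  simp
  ring

theorem hermBilin_symm (G : Matrix (Fin n) (Fin n) ℂ) (hG : G.IsHermitian) (v w : Cn n) :
    hermBilin G v w = hermBilin G w v := by
  rw [hermBilin_apply, hermBilin_apply, ← hermPair_conj G hG, Complex.conj_re]

theorem hermBilin_J (G : Matrix (Fin n) (Fin n) ℂ) (v w : Cn n) :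
    hermBilin G (Complex.I • v) (Complex.I • w) = hermBilin G v w := by
  rw [hermBilin_apply, hermBilin_apply]
  congr 2
  simp only [hermPair, star_smul, Matrix.mulVec_smul, smul_dotProduct, dotProduct_smul, smul_smul]
  simp

theorem hermBilin_pos (G : Matrix (Fin n) (Fin n) ℂ) (hG : G.PosDef) (v : Cn n) (hv : v ≠ 0) :
    0 < hermBilin G v v := by
  have h := hG.dotProduct_mulVec_pos (star_ne_zero.2 hv)
  rw [star_star] at h
  have := (Complex.lt_def.1 h).1
  rw [hermBilin_apply]
  exact mul_pos two_pos this

theorem hermMatrix_posDef (b : Cn n →ₗ[ℝ] Cn n →ₗ[ℝ] ℝ) (hs : ∀ v w, b v w = b w v)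
    (hJ : ∀ v w, b (Complex.I • v) (Complex.I • w) = b v w) (hb : ∀ v, v ≠ 0 → 0 < b v v) :
    (hermMatrix fun v w => b v w).PosDef := by
  have hJ' : ∀ v w, b v (Complex.I • w) = -b (Complex.I • v) w := fun v w => by
    rw [← hJ v, smul_smul, Complex.I_mul_I]
    simp
  have hH : (hermMatrix fun v w => b v w).IsHermitian := by
    ext i j
    have hx : ∀ i : Fin n, (ey i : Cn n) = Complex.I • (ex i : Cn n) := fun i => by
      ext k; simp [ex, ey, Pi.single_apply]
    simp [hermMatrix]
    rw [hs (ex j) (ex i), hx, hx, hJ' (ex j), hs _ (ex i)]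
    simp
  refine Matrix.PosDef.of_dotProduct_mulVec_pos hH fun x hx => ?_
  -- Matrix positivity conjugates the left vector whereas `hermPair` conjugates the right one, so
  -- the bilinear form is evaluated at `star x`.
  have h1 := hb (star x) (star_ne_zero.2 hx)
  rw [← hermBilin_hermMatrix b hJ, hermBilin_apply] at h1
  have h2 := hermPair_conj _ hH (star x) (star x)
  rw [hermPair, star_star] at h1 h2
  rw [Complex.lt_def]
  refine ⟨by simpa using h1, ?_⟩
  rw [Complex.conj_eq_iff_im] at h2
  rw [h2]
  rfl

theorem hermMatrix_comp (A : Cn n →L[ℂ] Cn n) (b : Cn n →ₗ[ℝ] Cn n →ₗ[ℝ] ℝ)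
    (hJ : ∀ v w, b (Complex.I • v) (Complex.I • w) = b v w) :
    hermMatrix (fun v w => b (A v) (A w)) = pullMat A (hermMatrix fun v w => b v w) := by
  rw [← hermMatrix_hermBilin (pullMat A _)]
  congr 1
  ext v w
  rw [hermBilin_apply, hermPair_pullMat, ← hermBilin_apply, hermBilin_hermMatrix b hJ]

/-! ## Roots of positive `(n-1,n-1)`-forms -/

/-- The matrix whose `(1,1)`-form has the `(n-1,n-1)`-form of matrix `P` as its `(n-1)`-st power. -/
def rootMat (P : Matrix (Fin n) (Fin n) ℂ) : Matrix (Fin n) (Fin n) ℂ :=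
  ((((((n - 1).factorial : ℂ)⁻¹ • Pᵀ).det.re ^ (1 / ((n : ℝ) - 1)) : ℝ)) : ℂ) •
    (((n - 1).factorial : ℂ)⁻¹ • Pᵀ)⁻¹

theorem det_eq_re (G : Matrix (Fin n) (Fin n) ℂ) (hG : G.PosDef) :
    G.det = (G.det.re : ℂ) ∧ 0 < G.det.re := by
  have h := Complex.lt_def.1 hG.det_pos
  exact ⟨Complex.ext rfl h.2.symm, h.1⟩

theorem rootMat_posDef (P : Matrix (Fin n) (Fin n) ℂ) (hP : P.PosDef) : (rootMat P).PosDef := by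
  have hQ : (((n - 1).factorial : ℂ)⁻¹ • Pᵀ).PosDef := by
    refine hP.transpose.smul ?_
    rw [inv_pos]
    exact_mod_cast Nat.factorial_pos _
  refine hQ.inv.smul ?_
  rw [Complex.zero_lt_real]
  exact Real.rpow_pos_of_pos (det_eq_re _ hQ).2 _

/-- With Q = Pᵀ/(n-1)! the equation is adj G = Q. Determinants give (det G)^{n-1} = det Q, hence G =
det G · Q⁻¹ = (det Q)^{1/(n-1)} Q⁻¹, which is the formula for `rootMat`. Here n ≥ 2 makes the
exponent meaningful. -/
theorem adjugate_rootMat (hn : 2 ≤ n) (P : Matrix (Fin n) (Fin n) ℂ) (hP : P.PosDef) :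
    ((n - 1).factorial : ℂ) • (rootMat P).adjugateᵀ = P := by
  have hf : ((n - 1).factorial : ℂ) ≠ 0 := by positivity
  have hQ : (((n - 1).factorial : ℂ)⁻¹ • Pᵀ).PosDef := by
    refine hP.transpose.smul ?_
    rw [inv_pos]
    exact_mod_cast Nat.factorial_pos _
  have h : (rootMat P).adjugate = ((n - 1).factorial : ℂ)⁻¹ • Pᵀ := by
    rw [rootMat]
    set Q := ((n - 1).factorial : ℂ)⁻¹ • Pᵀ
    obtain ⟨h1, h2⟩ := det_eq_re Q hQ
    set d := Q.det.re
    have hu : IsUnit Q.det := by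
      rw [h1]
      exact (Complex.ofReal_ne_zero.2 h2.ne').isUnit
    have hp : ((d ^ (1 / ((n : ℝ) - 1)) : ℝ) : ℂ) ^ (n - 1) = d := by
      rw [← Complex.ofReal_pow, ← Real.rpow_natCast, ← Real.rpow_mul h2.le]
      have : (1 / ((n : ℝ) - 1)) * ((n - 1 : ℕ) : ℝ) = 1 := by
        rw [Nat.cast_sub (by omega), Nat.cast_one]
        have : (n : ℝ) - 1 ≠ 0 := by
          have : (2 : ℝ) ≤ n := by exact_mod_cast hn
          linarith
        field_simp
      rw [this, Real.rpow_one]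
    have ha : (Q⁻¹).adjugate = (d : ℂ)⁻¹ • Q := by
      have h3 : Q⁻¹ * ((Q⁻¹).adjugate) = (d : ℂ)⁻¹ • 1 := by
        rw [Matrix.mul_adjugate, Matrix.det_nonsing_inv, h1, Ring.inverse_eq_inv']
      calc (Q⁻¹).adjugate = Q * (Q⁻¹ * (Q⁻¹).adjugate) := by
            rw [← Matrix.mul_assoc, Matrix.mul_nonsing_inv Q hu, Matrix.one_mul]
        _ = _ := by rw [h3, Matrix.mul_smul, Matrix.mul_one]
    rw [Matrix.adjugate_smul, Fintype.card_fin, hp, ha, smul_smul,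
      mul_inv_cancel₀ (Complex.ofReal_ne_zero.2 h2.ne'), one_smul]
  rw [h, Matrix.transpose_smul, Matrix.transpose_transpose, smul_smul, mul_inv_cancel₀ hf, one_smul]

/-- Uniqueness of the positive root. It makes taking roots commute with changes of coordinates, on
which smoothness of the root metric rests. -/
theorem rootMat_adjugate (hn : 2 ≤ n) (G : Matrix (Fin n) (Fin n) ℂ) (hG : G.PosDef) :
    rootMat (((n - 1).factorial : ℂ) • G.adjugateᵀ) = G := by
  have hf : ((n - 1).factorial : ℂ) ≠ 0 := by positivity
  rw [rootMat, Matrix.transpose_smul, Matrix.transpose_transpose, smul_smul, inv_mul_cancel₀ hf,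
    one_smul, Matrix.det_adjugate, Fintype.card_fin]
  obtain ⟨h1, h2⟩ := det_eq_re G hG
  set d := G.det.re
  have hd : (d : ℂ) ≠ 0 := Complex.ofReal_ne_zero.2 h2.ne'
  have hp : ((((G.det ^ (n - 1)).re) ^ (1 / ((n : ℝ) - 1)) : ℝ) : ℂ) = d := by
    rw [h1, ← Complex.ofReal_pow, Complex.ofReal_re, ← Real.rpow_natCast, ← Real.rpow_mul h2.le]
    have : ((n - 1 : ℕ) : ℝ) * (1 / ((n : ℝ) - 1)) = 1 := by
      rw [Nat.cast_sub (by omega), Nat.cast_one]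
      have : (n : ℝ) - 1 ≠ 0 := by
        have : (2 : ℝ) ≤ n := by exact_mod_cast hn
        linarith
      field_simp
    rw [this, Real.rpow_one]
  have hi : (G.adjugate)⁻¹ = (d : ℂ)⁻¹ • G := by
    apply Matrix.inv_eq_left_inv
    rw [Matrix.smul_mul, Matrix.mul_adjugate, h1, smul_smul, inv_mul_cancel₀ hd, one_smul]
  rw [hp, hi, smul_smul, mul_inv_cancel₀ hd, one_smul]

/-- Comes from det(adj G) = (det G)^{n-1}. The factorial factor depends only on n and cancels in
quotients. -/
theorem lamDet_formOf_pow_pred (hn : 1 ≤ n) (G : Matrix (Fin n) (Fin n) ℂ) (hG : G.PosDef) :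
    lamDet (formOf G ^ (n - 1)) = ((n - 1).factorial : ℝ) ^ n * G.det.re ^ (n - 1) := by
  rw [lamDet, formOf_pow_pred hn, coeffMatrix_ofMatrix, Matrix.det_smul, Matrix.det_transpose,
    Matrix.det_adjugate, Fintype.card_fin, (det_eq_re G hG).1]
  norm_cast

theorem density_formOf_pow (G : Matrix (Fin n) (Fin n) ℂ) :
    density (formOf G ^ n) = (n.factorial : ℝ) * G.det.re := by
  have hc : (Complex.I ^ n * (-1) ^ (n * (n - 1) / 2) : ℂ) ≠ 0 := by simp
  have h : coeff Finset.univ (formOf G ^ n) = ((n.factorial : ℂ) * G.det) *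
      ((Complex.I ^ n * (-1) ^ (n * (n - 1) / 2)) * coeff Finset.univ (lamBasis n Finset.univ)) := by
    rw [formOf_pow, volTop]
    simp only [coeff, map_smul, Finsupp.smul_apply, smul_eq_mul]
  rw [density, h, coeff_lamBasis, if_pos rfl, mul_one, mul_div_cancel_right₀ _ hc]
  simp

/-! ## Calculus of form-valued functions on `ℂⁿ` -/

/-- The norm is transported from the coefficients. It serves only to make derivatives of form-valued
functions available. -/
instance : NormedAddCommGroup (Lam n) :=
  NormedAddCommGroup.induced (Lam n) (Finset (Fin n ⊕ₗ Fin n) → ℂ) (lamBasis n).equivFun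
    (lamBasis n).equivFun.injective

instance : NormedSpace ℂ (Lam n) :=
  NormedSpace.induced ℂ (Lam n) (Finset (Fin n ⊕ₗ Fin n) → ℂ) (lamBasis n).equivFun.toLinearMap

instance : FiniteDimensional ℂ (Lam n) := (lamBasis n).finiteDimensional_of_finite

/-- A complex linear map on forms as a continuous real linear map. -/
def realCLM {E : Type*} [NormedAddCommGroup E] [NormedSpace ℂ E] (T : Lam n →ₗ[ℂ] E) :
    Lam n →L[ℝ] E :=
  (LinearMap.toContinuousLinearMap T).restrictScalars ℝ

/-- The wedge product as a continuous bilinear map. -/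
def mulCLM (n : ℕ) : Lam n →L[ℝ] Lam n →L[ℝ] Lam n :=
  (LinearMap.mul ℂ (Lam n)).toContinuousBilinearMap.bilinearRestrictScalars ℝ

theorem mulCLM_apply (x y : Lam n) : mulCLM n x y = x * y := rfl

/-- The coefficient functional. -/
def coeffL (S : Finset (Fin n ⊕ₗ Fin n)) : Lam n →ₗ[ℂ] ℂ := (lamBasis n).coord S

theorem sum_coeff (ψ : Lam n) : ∑ S, coeff S ψ • lamBasis n S = ψ := (lamBasis n).sum_repr ψ

section Smooth

variable {E : Type*} [NormedAddCommGroup E] [NormedSpace ℝ E] {F G : E → Lam n} {y : E}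

theorem contDiffAt_mul (hF : ContDiffAt ℝ ∞ F y) (hG : ContDiffAt ℝ ∞ G y) :
    ContDiffAt ℝ ∞ (fun p => F p * G p) y :=
  ((mulCLM n).contDiff.contDiffAt.comp y hF).clm_apply hG

theorem contDiffAt_realCLM {H : Type*} [NormedAddCommGroup H] [NormedSpace ℂ H]
    (T : Lam n →ₗ[ℂ] H) (hF : ContDiffAt ℝ ∞ F y) : ContDiffAt ℝ ∞ (fun p => T (F p)) y :=
  (realCLM T).contDiff.contDiffAt.comp y hF

theorem hasFDerivAt_mul {F' G' : E →L[ℝ] Lam n} (hF : HasFDerivAt F F' y)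
    (hG : HasFDerivAt G G' y) :
    ∃ D : E →L[ℝ] Lam n, HasFDerivAt (fun p => F p * G p) D y ∧
      ∀ v, D v = F' v * G y + F y * G' v := by
  refine ⟨_, (mulCLM n).hasFDerivAt_of_bilinear hF hG, fun v => ?_⟩
  simp [mulCLM_apply, add_comm]

end Smooth

/-- Replaces the coefficientwise derivative by the Fréchet derivative, for which product and chain
rules are at hand. -/
theorem dirDeriv_eq {F : Cn n → Lam n} {y : Cn n} (hF : DifferentiableAt ℝ F y) (v : Cn n) :
    dirDeriv F y v = fderiv ℝ F y v := by
  rw [← sum_coeff (fderiv ℝ F y v), dirDeriv]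
  refine Finset.sum_congr rfl fun S _ => ?_
  congr 1
  have : HasFDerivAt (fun p => coeff S (F p)) ((realCLM (coeffL S)).comp (fderiv ℝ F y)) y :=
    (realCLM (coeffL S)).hasFDerivAt.comp y hF.hasFDerivAt
  rw [this.fderiv]
  rfl

theorem dirDeriv_congr {F G : Cn n → Lam n} {y : Cn n} (h : F =ᶠ[nhds y] G) :
    dirDeriv F y = dirDeriv G y := by
  ext1 v
  rw [dirDeriv, dirDeriv]
  refine Finset.sum_congr rfl fun S _ => ?_
  have h' : (fun p => coeff S (F p)) =ᶠ[nhds y] fun p => coeff S (G p) := h.fun_comp (coeff S)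
  rw [h'.fderiv_eq]

/-- The first-order operator `∑ p_j ∧ (∂/∂x^j + c ∂/∂y^j)/2` applied to a derivative. -/
def wirtinger (p : Fin n → Cov n) (c : ℂ) : (Cn n → Lam n) →ₗ[ℂ] Lam n where
  toFun D := ∑ j, ExteriorAlgebra.ι ℂ (p j) * ((1 / 2 : ℂ) • (D (ex j) + c • D (ey j)))
  map_add' D D' := by
    rw [← Finset.sum_add_distrib]
    refine Finset.sum_congr rfl fun j _ => ?_
    rw [← mul_add, ← smul_add, Pi.add_apply, Pi.add_apply, smul_add c, add_add_add_comm]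
  map_smul' a D := by
    rw [Finset.smul_sum]
    refine Finset.sum_congr rfl fun j _ => ?_
    rw [RingHom.id_apply, ← mul_smul_comm, Pi.smul_apply, Pi.smul_apply, smul_comm c a, ← smul_add,
      smul_comm a]

theorem wirtinger_apply (p : Fin n → Cov n) (c : ℂ) (D : Cn n → Lam n) :
    wirtinger p c D
      = ∑ j, ExteriorAlgebra.ι ℂ (p j) * ((1 / 2 : ℂ) • (D (ex j) + c • D (ey j))) := rfl

theorem delLoc_eq_wirtinger (F : Cn n → Lam n) (y : Cn n) :
    delLoc F y = wirtinger dz (-Complex.I) (dirDeriv F y) := by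
  simp only [delLoc, wirtinger_apply, neg_smul, sub_eq_add_neg]

theorem delbarLoc_eq_wirtinger (F : Cn n → Lam n) (y : Cn n) :
    delbarLoc F y = wirtinger dzbar Complex.I (dirDeriv F y) := rfl

theorem delLoc_congr {F G : Cn n → Lam n} {y : Cn n} (h : F =ᶠ[nhds y] G) :
    delLoc F y = delLoc G y := by
  rw [delLoc_eq_wirtinger, delLoc_eq_wirtinger, dirDeriv_congr h]

theorem delbarLoc_congr {F G : Cn n → Lam n} {y : Cn n} (h : F =ᶠ[nhds y] G) :
    delbarLoc F y = delbarLoc G y := by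
  rw [delbarLoc_eq_wirtinger, delbarLoc_eq_wirtinger, dirDeriv_congr h]

theorem delbarLoc_eventuallyEq {F G : Cn n → Lam n} {y : Cn n} (h : F =ᶠ[nhds y] G) :
    delbarLoc F =ᶠ[nhds y] delbarLoc G := by
  filter_upwards [h.eventuallyEq_nhds] with z hz using delbarLoc_congr hz

theorem delLoc_eq {F : Cn n → Lam n} {y : Cn n} (hF : DifferentiableAt ℝ F y) :
    delLoc F y = wirtinger dz (-Complex.I) (fderiv ℝ F y) := by
  rw [delLoc_eq_wirtinger, funext (dirDeriv_eq hF)]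

theorem delbarLoc_eq {F : Cn n → Lam n} {y : Cn n} (hF : DifferentiableAt ℝ F y) :
    delbarLoc F y = wirtinger dzbar Complex.I (fderiv ℝ F y) := by
  rw [delbarLoc_eq_wirtinger, funext (dirDeriv_eq hF)]

theorem eventually_differentiableAt {F : Cn n → Lam n} {y : Cn n} (hF : ContDiffAt ℝ ∞ F y) :
    ∀ᶠ z in nhds y, DifferentiableAt ℝ F z := by
  have h1 : ContDiffAt ℝ 1 F y := hF.of_le (by exact_mod_cast le_top)
  filter_upwards [h1.eventually (by simp)] with z hz using hz.differentiableAt (by simp)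

theorem contDiffAt_wirtinger_fderiv (p : Fin n → Cov n) (c : ℂ) {F : Cn n → Lam n} {y : Cn n}
    (hF : ContDiffAt ℝ ∞ F y) :
    ContDiffAt ℝ ∞ (fun z => wirtinger p c (fderiv ℝ F z)) y := by
  have h : ContDiffAt ℝ ∞ (fderiv ℝ F) y := hF.fderiv_right (by simp)
  have hv : ∀ v, ContDiffAt ℝ ∞ (fun z => fderiv ℝ F z v) y :=
    fun v => h.clm_apply contDiffAt_const
  simp only [wirtinger_apply]
  exact ContDiffAt.sum fun j _ => contDiffAt_mul contDiffAt_const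
    (((hv _).add ((hv _).const_smul c)).const_smul _)

theorem contDiffAt_delLoc {F : Cn n → Lam n} {y : Cn n} (hF : ContDiffAt ℝ ∞ F y) :
    ContDiffAt ℝ ∞ (delLoc F) y :=
  (contDiffAt_wirtinger_fderiv dz (-Complex.I) hF).congr_of_eventuallyEq
    ((eventually_differentiableAt hF).mono fun _ hz => delLoc_eq hz)

theorem contDiffAt_delbarLoc {F : Cn n → Lam n} {y : Cn n} (hF : ContDiffAt ℝ ∞ F y) :
    ContDiffAt ℝ ∞ (delbarLoc F) y :=
  (contDiffAt_wirtinger_fderiv dzbar Complex.I hF).congr_of_eventuallyEq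
    ((eventually_differentiableAt hF).mono fun _ hz => delbarLoc_eq hz)

theorem delLoc_add {F G : Cn n → Lam n} {y : Cn n} (hF : DifferentiableAt ℝ F y)
    (hG : DifferentiableAt ℝ G y) : delLoc (fun z => F z + G z) y = delLoc F y + delLoc G y := by
  rw [delLoc_eq (hF.fun_add hG), delLoc_eq hF, delLoc_eq hG, ← map_add]
  congr 1
  ext1 v
  rw [fderiv_fun_add hF hG]
  rfl

theorem delbarLoc_add {F G : Cn n → Lam n} {y : Cn n} (hF : DifferentiableAt ℝ F y)
    (hG : DifferentiableAt ℝ G y) :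
    delbarLoc (fun z => F z + G z) y = delbarLoc F y + delbarLoc G y := by
  rw [delbarLoc_eq (hF.fun_add hG), delbarLoc_eq hF, delbarLoc_eq hG, ← map_add]
  congr 1
  ext1 v
  rw [fderiv_fun_add hF hG]
  rfl

theorem delLoc_smul (c : ℂ) {F : Cn n → Lam n} {y : Cn n} (hF : DifferentiableAt ℝ F y) :
    delLoc (fun z => c • F z) y = c • delLoc F y := by
  rw [delLoc_eq (hF.fun_const_smul c), delLoc_eq hF, ← map_smul]
  congr 1
  ext1 v
  rw [fderiv_fun_const_smul hF]
  rfl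

theorem delbarLoc_smul (c : ℂ) {F : Cn n → Lam n} {y : Cn n} (hF : DifferentiableAt ℝ F y) :
    delbarLoc (fun z => c • F z) y = c • delbarLoc F y := by
  rw [delbarLoc_eq (hF.fun_const_smul c), delbarLoc_eq hF, ← map_smul]
  congr 1
  ext1 v
  rw [fderiv_fun_const_smul hF]
  rfl

/-! ### Naturality under holomorphic maps -/

/-- Graded commutativity with all signs hidden in the grading involution; it gives the graded
Leibniz rule `wirtinger_mul` without reference to degrees. -/
theorem ι_mul_eq_involute (m : Cov n) (x : Lam n) :
    ExteriorAlgebra.ι ℂ m * x = CliffordAlgebra.involute x * ExteriorAlgebra.ι ℂ m := by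
  induction x using ExteriorAlgebra.induction with
  | algebraMap r =>
    rw [AlgHom.commutes]
    exact (Algebra.commutes r _).symm
  | ι z =>
    rw [show CliffordAlgebra.involute (ExteriorAlgebra.ι ℂ z) = -ExteriorAlgebra.ι ℂ z from
      CliffordAlgebra.involute_ι z, neg_mul, ι_mul_ι_comm]
  | mul a b ha hb => rw [← mul_assoc, ha, mul_assoc, hb, map_mul, mul_assoc]
  | add a b ha hb => rw [mul_add, ha, hb, map_add, add_mul]

theorem wirtinger_mul (p : Fin n → Cov n) (c : ℂ) (D D' : Cn n → Lam n) (x y : Lam n) :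
    wirtinger p c (fun v => D v * y + x * D' v)
      = wirtinger p c D * y + CliffordAlgebra.involute x * wirtinger p c D' := by
  simp only [wirtinger_apply, Finset.sum_mul, Finset.mul_sum]
  rw [← Finset.sum_add_distrib]
  refine Finset.sum_congr rfl fun j _ => ?_
  rw [← mul_assoc (CliffordAlgebra.involute x), ← ι_mul_eq_involute, mul_assoc, mul_assoc, ← mul_add]
  congr 1
  simp only [smul_add, add_mul, mul_add, smul_mul_assoc, mul_smul_comm]
  abel

/-- The part of a covector on which precomposition with `√-1` is multiplication by `-c⁻¹`. -/
def typePart (c : ℂ) (D : Cov n) : Cov n where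
  toFun v := (1 / 2 : ℂ) * (D v + c * D (Complex.I • v))
  map_add' v w := by simp only [smul_add, map_add]; ring
  map_smul' r v := by
    rw [smul_comm, map_smul, map_smul]
    simp only [Complex.real_smul, RingHom.id_apply]
    ring

theorem typePart_apply (c : ℂ) (D : Cov n) (v : Cn n) :
    typePart c D v = (1 / 2 : ℂ) * (D v + c * D (Complex.I • v)) := rfl

/-- A complex linear map commutes with `Complex.I`, so pullback preserves type. This is one place
where holomorphy of coordinate changes enters. -/
theorem covPull_typePart (A : Cn n →L[ℂ] Cn n) (c : ℂ) (D : Cov n) :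
    covPull A (typePart c D) = typePart c (covPull A D) := by
  refine LinearMap.ext fun v => ?_
  rw [covPull_apply, typePart_apply, typePart_apply, covPull_apply, covPull_apply, A.map_smul]

theorem cov_expand (D : Cov n) :
    D = ∑ j, (((1 / 2 : ℂ) * (D (ex j) - Complex.I * D (ey j))) • dz j
      + ((1 / 2 : ℂ) * (D (ex j) + Complex.I * D (ey j))) • dzbar j) :=
  ((covEquiv n).symm_apply_apply D).symm

theorem sum_dz_eq_typePart (D : Cov n) :
    ∑ j, ((1 / 2 : ℂ) * (D (ex j) + -Complex.I * D (ey j))) • dz j = typePart (-Complex.I) D := by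
  refine LinearMap.ext fun v => ?_
  rw [typePart_apply]
  conv_rhs => rw [cov_expand D]
  simp only [LinearMap.sum_apply, LinearMap.add_apply, LinearMap.smul_apply, smul_eq_mul, dz_apply,
    dzbar_apply, Pi.smul_apply, map_mul, Complex.conj_I]
  rw [Finset.mul_sum, ← Finset.sum_add_distrib, Finset.mul_sum]
  refine Finset.sum_congr rfl fun j _ => ?_
  linear_combination ((-1 / 4 : ℂ) * (D (ex j) - Complex.I * D (ey j)) * v j +
    (1 / 4 : ℂ) * (D (ex j) + Complex.I * D (ey j)) * conj (v j)) * (-Complex.I_mul_I)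

theorem sum_dzbar_eq_typePart (D : Cov n) :
    ∑ j, ((1 / 2 : ℂ) * (D (ex j) + Complex.I * D (ey j))) • dzbar j = typePart Complex.I D := by
  refine LinearMap.ext fun v => ?_
  rw [typePart_apply]
  conv_rhs => rw [cov_expand D]
  simp only [LinearMap.sum_apply, LinearMap.add_apply, LinearMap.smul_apply, smul_eq_mul, dz_apply,
    dzbar_apply, Pi.smul_apply, map_mul, Complex.conj_I]
  rw [Finset.mul_sum, ← Finset.sum_add_distrib, Finset.mul_sum]
  refine Finset.sum_congr rfl fun j _ => ?_
  linear_combination ((-1 / 4 : ℂ) * (D (ex j) - Complex.I * D (ey j)) * v j +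
    (1 / 4 : ℂ) * (D (ex j) + Complex.I * D (ey j)) * conj (v j)) * (Complex.I_mul_I)

/-- The hypothesis `hp` says that the operator picks out the part of one type of a differential. It
holds for `dz` with `-Complex.I` and for `dzbar` with `Complex.I`, so one argument covers ∂ and ∂̄.
-/
theorem wirtinger_smul_const {p : Fin n → Cov n} {c : ℂ}
    (hp : ∀ D : Cov n, ∑ j, ((1 / 2 : ℂ) * (D (ex j) + c * D (ey j))) • p j = typePart c D)
    (D : Cov n) (B : Lam n) :
    wirtinger p c (fun v => D v • B) = ExteriorAlgebra.ι ℂ (typePart c D) * B := by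
  rw [← hp, map_sum, Finset.sum_mul, wirtinger_apply]
  refine Finset.sum_congr rfl fun j _ => ?_
  rw [map_smul, smul_mul_assoc, ← mul_smul_comm, smul_smul, ← add_smul, smul_smul]

/-- The dependence of the pullback of a covector on the linear map. -/
def ιPullCLM (L : Cov n) : (Cn n →L[ℂ] Cn n) →L[ℝ] Lam n :=
  LinearMap.toContinuousLinearMap
    { toFun := fun A => ExteriorAlgebra.ι ℂ (covPull A L)
      map_add' := fun A B => by
        rw [← map_add]
        congr 1
        refine LinearMap.ext fun v => ?_
        simp
      map_smul' := fun r A => by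
        rw [RingHom.id_apply, ← Complex.coe_smul r (ExteriorAlgebra.ι ℂ (covPull A L)),
          ← map_smul]
        congr 1
        refine LinearMap.ext fun v => ?_
        simp }

theorem ιPullCLM_apply (L : Cov n) (A : Cn n →L[ℂ] Cn n) :
    ιPullCLM L A = ExteriorAlgebra.ι ℂ (covPull A L) := rfl

/-- Symmetric coefficients contracted with antisymmetric products. The coefficients will be second
derivatives of a coordinate change, or their conjugates. -/
theorem sum_ι_mul_ι_symm (p : Fin n → Cov n) (s : Fin n → Fin n → ℂ) (hs : ∀ i j, s i j = s j i) :
    ∑ j, ExteriorAlgebra.ι ℂ (p j) * ExteriorAlgebra.ι ℂ (∑ k, s j k • p k) = 0 := by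
  have h : ∑ j, ExteriorAlgebra.ι ℂ (p j) * ExteriorAlgebra.ι ℂ (∑ k, s j k • p k)
      = ∑ j, ∑ k, s j k • (ExteriorAlgebra.ι ℂ (p j) * ExteriorAlgebra.ι ℂ (p k)) := by
    refine Finset.sum_congr rfl fun j _ => ?_
    rw [map_sum, Finset.mul_sum]
    simp only [map_smul, mul_smul_comm]
  rw [h]
  have h2 : ∑ j, ∑ k, s j k • (ExteriorAlgebra.ι ℂ (p j) * ExteriorAlgebra.ι ℂ (p k))
      = -∑ j, ∑ k, s j k • (ExteriorAlgebra.ι ℂ (p j) * ExteriorAlgebra.ι ℂ (p k)) := by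
    conv_lhs => rw [Finset.sum_comm]
    rw [← Finset.sum_neg_distrib]
    refine Finset.sum_congr rfl fun j _ => ?_
    rw [← Finset.sum_neg_distrib]
    refine Finset.sum_congr rfl fun k _ => ?_
    rw [ι_mul_ι_comm, hs, smul_neg]
  have h3 := eq_neg_iff_add_eq_zero.1 h2
  rw [← two_smul ℂ] at h3
  exact (smul_eq_zero.1 h3).resolve_left two_ne_zero

/-- The pullback of a form-valued function under a holomorphic map. -/
def pullF (τ : Cn n → Cn n) (F : Cn n → Lam n) (z : Cn n) : Lam n :=
  pull (fderiv ℂ τ z) (F (τ z))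

theorem lamBasis_eq_prod (S : Finset (Fin n ⊕ₗ Fin n)) : lamBasis n S =
    ((S.sort (· ≤ ·)).map fun k => ExteriorAlgebra.ι ℂ (covBasis n k)).prod :=
  basis_eq_prod_sort _ _

theorem pull_lamBasis (A : Cn n →L[ℂ] Cn n) (S : Finset (Fin n ⊕ₗ Fin n)) :
    pull A (lamBasis n S) =
      ((S.sort (· ≤ ·)).map fun k => ιPullCLM (covBasis n k) A).prod := by
  rw [lamBasis_eq_prod, map_list_prod, List.map_map]
  congr 2
  ext1 k
  exact pull_ι A _

theorem pull_eq_sum (A : Cn n →L[ℂ] Cn n) (ψ : Lam n) :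
    pull A ψ = ∑ S, coeff S ψ • pull A (lamBasis n S) := by
  conv_lhs => rw [← sum_coeff ψ]
  simp only [map_sum, map_smul]

theorem hasFDerivAt_fderiv {τ : Cn n → Cn n} {y : Cn n} (hτ : ContDiffAt ℂ ∞ τ y) :
    HasFDerivAt (fderiv ℂ τ) ((fderiv ℂ (fderiv ℂ τ) y).restrictScalars ℝ) y :=
  ((hτ.fderiv_right (m := ∞) (by simp)).differentiableAt (by simp)).hasFDerivAt.restrictScalars ℝ

theorem hasFDerivAt_of_contDiffAt {τ : Cn n → Cn n} {y : Cn n} (hτ : ContDiffAt ℂ ∞ τ y) :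
    HasFDerivAt τ ((fderiv ℂ τ y).restrictScalars ℝ) y :=
  (hτ.differentiableAt (by simp)).hasFDerivAt.restrictScalars ℝ

/-- The pullbacks under `τ` of the covectors of `covBasis` are annihilated by the operator. -/
def BasisClosed (p : Fin n → Cov n) (c : ℂ) (τ : Cn n → Cn n) (y : Cn n) : Prop :=
  ∀ k, wirtinger p c (fun v => ιPullCLM (covBasis n k) (fderiv ℂ (fderiv ℂ τ) y v)) = 0

/-- The pulled-back basis form is a product of pulled-back covectors, each annihilated by the
operator, so the graded Leibniz rule applies along the product. -/
theorem wirtinger_pull_lamBasis {p : Fin n → Cov n} {c : ℂ} {τ : Cn n → Cn n} {y : Cn n}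
    (hτ : ContDiffAt ℂ ∞ τ y) (hc : BasisClosed p c τ y) (S : Finset (Fin n ⊕ₗ Fin n)) :
    ∃ D : Cn n →L[ℝ] Lam n, HasFDerivAt (fun z => pull (fderiv ℂ τ z) (lamBasis n S)) D y ∧
      wirtinger p c D = 0 := by
  simp only [pull_lamBasis]
  induction S.sort (· ≤ ·) with
  | nil =>
    refine ⟨0, by simpa using hasFDerivAt_const _ _, map_zero _⟩
  | cons k l ih =>
    obtain ⟨D, hD, h0⟩ := ih
    simp only [List.map_cons, List.prod_cons]
    obtain ⟨D', hD', h1⟩ := hasFDerivAt_mul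
      ((ιPullCLM (covBasis n k)).hasFDerivAt.comp y (hasFDerivAt_fderiv hτ)) hD
    refine ⟨D', hD', ?_⟩
    rw [funext h1, wirtinger_mul, h0, mul_zero, add_zero]
    exact (congrArg (· * _) (hc k)).trans (zero_mul _)

/-- Expanding F = ∑ F_S e_S, the derivative of the pullback falls either on F_S ∘ τ or on τ^*e_S.
The second contribution vanishes, and in the first the type part of the differential commutes with
pullback. -/
theorem wirtinger_pullF {p : Fin n → Cov n} {c : ℂ}
    (hp : ∀ D : Cov n, ∑ j, ((1 / 2 : ℂ) * (D (ex j) + c * D (ey j))) • p j = typePart c D)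
    {τ : Cn n → Cn n} {y : Cn n} (hτ : ContDiffAt ℂ ∞ τ y) (hc : BasisClosed p c τ y)
    {F : Cn n → Lam n} (hF : DifferentiableAt ℝ F (τ y)) :
    DifferentiableAt ℝ (pullF τ F) y ∧ wirtinger p c (fderiv ℝ (pullF τ F) y)
      = pull (fderiv ℂ τ y) (wirtinger p c (fderiv ℝ F (τ y))) := by
  choose D hD h0 using wirtinger_pull_lamBasis hτ hc
  have hτ' := hasFDerivAt_of_contDiffAt hτ
  set A := fderiv ℂ τ y
  have hF1 : ∀ S, HasFDerivAt (fun z => coeff S (F (τ z)))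
      (((realCLM (coeffL S)).comp (fderiv ℝ F (τ y))).comp (A.restrictScalars ℝ)) y := fun S =>
    (((realCLM (coeffL S)).hasFDerivAt (x := F (τ y))).comp (τ y) hF.hasFDerivAt).comp y hτ'
  have hsum : HasFDerivAt
      (fun z => ∑ S, coeff S (F (τ z)) • pull (fderiv ℂ τ z) (lamBasis n S)) _ y :=
    HasFDerivAt.fun_sum (u := Finset.univ) fun S _ => (hF1 S).smul (hD S)
  have e : pullF τ F = fun z => ∑ S, coeff S (F (τ z)) • pull (fderiv ℂ τ z) (lamBasis n S) :=
    funext fun z => pull_eq_sum _ _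
  rw [e]
  refine ⟨hsum.differentiableAt, ?_⟩
  rw [hsum.fderiv]
  have e1 : (fun v => (∑ S, (coeff S (F (τ y)) • D S +
      (((realCLM (coeffL S)).comp (fderiv ℝ F (τ y))).comp (A.restrictScalars ℝ)).smulRight
        (pull A (lamBasis n S)))) v)
      = ∑ S, (coeff S (F (τ y)) • (D S : Cn n → Lam n) +
        fun v => covPull A ((coeffL S).restrictScalars ℝ ∘ₗ (fderiv ℝ F (τ y)).toLinearMap) v
          • pull A (lamBasis n S)) := by
    ext1 v
    simp only [_root_.sum_apply, Finset.sum_apply]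
    rfl
  have e2 : (fderiv ℝ F (τ y) : Cn n → Lam n) = ∑ S, fun v =>
      (((coeffL S).restrictScalars ℝ ∘ₗ (fderiv ℝ F (τ y)).toLinearMap : Cov n) v)
        • lamBasis n S := by
    ext1 v
    rw [Finset.sum_apply]
    exact (sum_coeff _).symm
  refine (congrArg _ e1).trans ?_
  rw [e2, map_sum, map_sum, map_sum]
  refine Finset.sum_congr rfl fun S _ => ?_
  rw [map_add, map_smul, h0, smul_zero, zero_add, wirtinger_smul_const hp, wirtinger_smul_const hp,
    map_mul, pull_ι, covPull_typePart]

theorem fderiv_fderiv_ey {τ : Cn n → Cn n} {y : Cn n} (j : Fin n) :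
    fderiv ℂ (fderiv ℂ τ) y (ey j) = Complex.I • fderiv ℂ (fderiv ℂ τ) y (ex j) := by
  rw [← map_smul]
  congr 1
  ext k
  simp [ex, ey, Pi.single_apply]

theorem ιPullCLM_dz_I (k : Fin n) (A : Cn n →L[ℂ] Cn n) :
    ιPullCLM (dz k) (Complex.I • A) = Complex.I • ιPullCLM (dz k) A := by
  rw [ιPullCLM_apply, ιPullCLM_apply, ← map_smul]
  rfl

theorem ιPullCLM_dzbar_I (k : Fin n) (A : Cn n →L[ℂ] Cn n) :
    ιPullCLM (dzbar k) (Complex.I • A) = -(Complex.I • ιPullCLM (dzbar k) A) := by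
  rw [ιPullCLM_apply, ιPullCLM_apply, ← map_smul, ← map_neg]
  congr 1
  refine LinearMap.ext fun v => ?_
  simp

theorem fderiv_fderiv_symm {τ : Cn n → Cn n} {y : Cn n} (hτ : ContDiffAt ℂ ∞ τ y) (v w : Cn n) :
    fderiv ℂ (fderiv ℂ τ) y v w = fderiv ℂ (fderiv ℂ τ) y w v :=
  (hτ.isSymmSndFDerivAt (by simpa using WithTop.coe_le_coe.2 (le_top : (2 : ℕ∞) ≤ ⊤))) v w

theorem matOf_apply (A : Cn n →L[ℂ] Cn n) (i k : Fin n) : matOf A i k = A (ex k) i := by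
  rw [matOf, LinearMap.toMatrix'_apply]
  rfl

theorem half_smul_add (x : Lam n) : (1 / 2 : ℂ) • (x + x) = x := by
  rw [← two_smul ℂ, smul_smul]
  norm_num

/-- The pullback of `dz k` has as derivative a symmetric second derivative, which the wedge kills.
The pullback of `dzbar k` has antiholomorphic coefficients, whose z-derivatives vanish. For ∂̄ the
two roles are exchanged. -/
theorem basisClosed_dz {τ : Cn n → Cn n} {y : Cn n} (hτ : ContDiffAt ℂ ∞ τ y) :
    BasisClosed dz (-Complex.I) τ y := by
  intro l
  rcases h : ofLex l with k | k <;> obtain rfl : l = toLex _ := h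
  · rw [covBasis_inl, wirtinger_apply]
    simp only [fderiv_fderiv_ey, ιPullCLM_dz_I, smul_smul, neg_mul, Complex.I_mul_I, neg_neg,
      one_smul, half_smul_add]
    simp only [ιPullCLM_apply, covPull_dz]
    refine sum_ι_mul_ι_symm dz _ fun i j => ?_
    rw [matOf_apply, matOf_apply, fderiv_fderiv_symm hτ]
  · rw [covBasis_inr, wirtinger_apply]
    simp [fderiv_fderiv_ey, ιPullCLM_dzbar_I, smul_smul]

theorem basisClosed_dzbar {τ : Cn n → Cn n} {y : Cn n} (hτ : ContDiffAt ℂ ∞ τ y) :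
    BasisClosed dzbar Complex.I τ y := by
  intro l
  rcases h : ofLex l with k | k <;> obtain rfl : l = toLex _ := h
  · rw [covBasis_inl, wirtinger_apply]
    simp [fderiv_fderiv_ey, ιPullCLM_dz_I, smul_smul]
  · rw [covBasis_inr, wirtinger_apply]
    simp only [fderiv_fderiv_ey, ιPullCLM_dzbar_I, smul_smul, smul_neg, Complex.I_mul_I, neg_smul,
      neg_neg, one_smul, half_smul_add]
    simp only [ιPullCLM_apply, covPull_dzbar]
    refine sum_ι_mul_ι_symm dzbar _ fun i j => ?_
    rw [matOf_apply, matOf_apply, fderiv_fderiv_symm hτ]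

theorem delLoc_pullF {τ : Cn n → Cn n} {y : Cn n} (hτ : ContDiffAt ℂ ∞ τ y)
    {F : Cn n → Lam n} (hF : DifferentiableAt ℝ F (τ y)) :
    delLoc (pullF τ F) y = pull (fderiv ℂ τ y) (delLoc F (τ y)) := by
  have h := wirtinger_pullF sum_dz_eq_typePart hτ (basisClosed_dz hτ) hF
  rw [delLoc_eq h.1, delLoc_eq hF, h.2]

theorem delbarLoc_pullF {τ : Cn n → Cn n} {y : Cn n} (hτ : ContDiffAt ℂ ∞ τ y)
    {F : Cn n → Lam n} (hF : DifferentiableAt ℝ F (τ y)) :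
    delbarLoc (pullF τ F) y = pull (fderiv ℂ τ y) (delbarLoc F (τ y)) := by
  have h := wirtinger_pullF sum_dzbar_eq_typePart hτ (basisClosed_dzbar hτ) hF
  rw [delbarLoc_eq h.1, delbarLoc_eq hF, h.2]

theorem pullF_scalarLoc (τ : Cn n → Cn n) (f : Cn n → ℝ) :
    pullF τ (scalarLoc f) = scalarLoc fun z => f (τ z) := by
  ext1 z
  exact AlgHom.commutes _ _

theorem contDiffAt_scalarLoc {f : Cn n → ℝ} {y : Cn n} (hf : ContDiffAt ℝ ∞ f y) :
    ContDiffAt ℝ ∞ (scalarLoc f) y := by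
  have : scalarLoc f = fun z => ((f z : ℂ)) • (1 : Lam n) :=
    funext fun z => Algebra.algebraMap_eq_smul_one _
  have h : ContDiffAt ℝ ∞ (fun z => (f z : ℂ)) y := Complex.ofRealCLM.contDiff.contDiffAt.comp y hf
  rw [this]
  exact ContDiffAt.smul (𝕜 := ℝ) h (contDiffAt_const (c := (1 : Lam n)))

theorem delLoc_delbarLoc_comp {τ : Cn n → Cn n} {y : Cn n} (hτ : ∀ᶠ z in nhds y, ContDiffAt ℂ ∞ τ z)
    {f : Cn n → ℝ} (hf : ContDiffAt ℝ ∞ f (τ y)) :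
    delLoc (delbarLoc (scalarLoc fun z => f (τ z))) y
      = pull (fderiv ℂ τ y) (delLoc (delbarLoc (scalarLoc f)) (τ y)) := by
  have hf' := contDiffAt_scalarLoc hf
  rw [← delLoc_pullF hτ.self_of_nhds ((contDiffAt_delbarLoc hf').differentiableAt (by simp))]
  apply delLoc_congr
  filter_upwards [hτ, hτ.self_of_nhds.continuousAt.eventually (eventually_differentiableAt hf')]
    with z hz hz'
  rw [← pullF_scalarLoc, delbarLoc_pullF hz hz']
  rfl

theorem scalarLoc_add (f g : Cn n → ℝ) :
    scalarLoc (fun z => f z + g z) = fun z => scalarLoc f z + scalarLoc g z := by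
  ext1 z
  simp [scalarLoc]

theorem delLoc_delbarLoc_add {f g : Cn n → ℝ} {y : Cn n} (hf : ContDiffAt ℝ ∞ f y)
    (hg : ContDiffAt ℝ ∞ g y) :
    delLoc (delbarLoc (scalarLoc fun z => f z + g z)) y
      = delLoc (delbarLoc (scalarLoc f)) y + delLoc (delbarLoc (scalarLoc g)) y := by
  have hf' := contDiffAt_scalarLoc hf
  have hg' := contDiffAt_scalarLoc hg
  rw [← delLoc_add ((contDiffAt_delbarLoc hf').differentiableAt (by simp))
    ((contDiffAt_delbarLoc hg').differentiableAt (by simp))]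
  apply delLoc_congr
  filter_upwards [eventually_differentiableAt hf', eventually_differentiableAt hg'] with z h1 h2
  rw [scalarLoc_add, delbarLoc_add h1 h2]

/-! ### `log |h|²` is pluriharmonic -/

/-- The complex conjugate of a covector. -/
def conjCov (L : Cov n) : Cov n := Complex.conjLIE.toLinearEquiv.toLinearMap ∘ₗ L

@[simp] theorem conjCov_apply (L : Cov n) (v : Cn n) : conjCov L v = conj (L v) := rfl

/-- The conjugate of a complex linear functional, as a form. -/
def ιConjCLM (n : ℕ) : (Cn n →L[ℂ] ℂ) →L[ℝ] Lam n :=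
  LinearMap.toContinuousLinearMap
    { toFun := fun ℓ => ExteriorAlgebra.ι ℂ (conjCov (ℓ.toLinearMap.restrictScalars ℝ))
      map_add' := fun A B => by
        rw [← map_add]
        congr 1
        refine LinearMap.ext fun v => ?_
        simp
      map_smul' := fun r A => by
        rw [RingHom.id_apply, ← Complex.coe_smul r
          (ExteriorAlgebra.ι ℂ (conjCov (A.toLinearMap.restrictScalars ℝ))), ← map_smul]
        congr 1
        refine LinearMap.ext fun v => ?_
        simp }

theorem ιConjCLM_I (ℓ : Cn n →L[ℂ] ℂ) :
    ιConjCLM n (Complex.I • ℓ) = -(Complex.I • ιConjCLM n ℓ) := by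
  change ExteriorAlgebra.ι ℂ _ = -(Complex.I • ExteriorAlgebra.ι ℂ _)
  rw [← map_smul, ← map_neg]
  congr 1
  refine LinearMap.ext fun v => ?_
  simp

theorem delLoc_ιConjCLM {g : Cn n → (Cn n →L[ℂ] ℂ)} {y : Cn n} (hg : DifferentiableAt ℂ g y) :
    delLoc (fun z => ιConjCLM n (g z)) y = 0 := by
  have h : HasFDerivAt (fun z => ιConjCLM n (g z))
      ((ιConjCLM n).comp ((fderiv ℂ g y).restrictScalars ℝ)) y :=
    (ιConjCLM n).hasFDerivAt.comp y (hg.hasFDerivAt.restrictScalars ℝ)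
  have he : ∀ j, fderiv ℂ g y (ey j) = Complex.I • fderiv ℂ g y (ex j) := fun j => by
    rw [← map_smul]
    congr 1
    ext k
    simp [ex, ey, Pi.single_apply]
  rw [delLoc_eq h.differentiableAt, h.fderiv, wirtinger_apply]
  simp [he, ιConjCLM_I, smul_smul]

/-- One has ∂̄ log|h|² = conj(dh/h), the conjugate of a holomorphic 1-form, and ∂ annihilates it by
`delLoc_ιConjCLM`. This makes the Ricci form independent of coordinates. -/
theorem delLoc_delbarLoc_log_normSq {h : Cn n → ℂ} {y : Cn n} (hh : ContDiffAt ℂ ∞ h y)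
    (h0 : h y ≠ 0) :
    delLoc (delbarLoc (scalarLoc fun z => Real.log (Complex.normSq (h z)))) y = 0 := by
  have hg : DifferentiableAt ℂ (fun z => (h z)⁻¹ • fderiv ℂ h z) y :=
    ((hh.differentiableAt (by simp)).inv h0).smul
      ((hh.fderiv_right (m := ∞) (by simp)).differentiableAt (by simp))
  rw [← delLoc_ιConjCLM hg]
  apply delLoc_congr
  have h1 : ContDiffAt ℂ 1 h y := hh.of_le (by exact_mod_cast le_top)
  filter_upwards [h1.eventually (by simp), hh.continuousAt.eventually_ne h0] with z hz hz0
  have hd : HasFDerivAt h ((fderiv ℂ h z).restrictScalars ℝ) z :=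
    (hz.differentiableAt (by simp)).hasFDerivAt.restrictScalars ℝ
  have hre := Complex.reCLM.hasFDerivAt.comp z hd
  have him := Complex.imCLM.hasFDerivAt.comp z hd
  have hN : Complex.normSq (h z) ≠ 0 := by simpa using hz0
  have hlog : HasFDerivAt (fun z => Real.log (Complex.normSq (h z))) _ z :=
    ((hre.mul hre).add (him.mul him)).log hN
  set D := (Complex.normSq (h z))⁻¹ •
    ((h z).re • Complex.reCLM.comp ((fderiv ℂ h z).restrictScalars ℝ) +
      (h z).re • Complex.reCLM.comp ((fderiv ℂ h z).restrictScalars ℝ) +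
      ((h z).im • Complex.imCLM.comp ((fderiv ℂ h z).restrictScalars ℝ) +
        (h z).im • Complex.imCLM.comp ((fderiv ℂ h z).restrictScalars ℝ))) with hD
  have hs : HasFDerivAt (scalarLoc fun z => Real.log (Complex.normSq (h z)))
      ((Complex.ofRealCLM.comp D).smulRight (1 : Lam n)) z := by
    have : scalarLoc (fun z => Real.log (Complex.normSq (h z)))
        = fun z => ((Real.log (Complex.normSq (h z)) : ℂ)) • (1 : Lam n) :=
      funext fun z => Algebra.algebraMap_eq_smul_one _
    rw [this]
    exact (Complex.ofRealCLM.hasFDerivAt.comp z hlog).smul_const _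
  rw [delbarLoc_eq hs.differentiableAt, hs.fderiv]
  -- For a scalar function ∂̄ is the (0,1)-part of the differential; what remains is an identity of
  -- covectors.
  refine (wirtinger_smul_const sum_dzbar_eq_typePart (Complex.ofRealCLM.comp D).toLinearMap 1).trans ?_
  rw [mul_one]
  change ExteriorAlgebra.ι ℂ _ = ExteriorAlgebra.ι ℂ _
  congr 1
  refine LinearMap.ext fun v => ?_
  have hI : fderiv ℂ h z (Complex.I • v) = Complex.I * fderiv ℂ h z v := by
    rw [map_smul, smul_eq_mul]
  have hR : conjCov (((h z)⁻¹ • fderiv ℂ h z).toLinearMap.restrictScalars ℝ) v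
      = ((Complex.normSq (h z))⁻¹ : ℝ) * (h z * conj (fderiv ℂ h z v)) := by
    have : (h z)⁻¹ = conj (h z) * ((Complex.normSq (h z))⁻¹ : ℝ) := Complex.inv_def _
    simp [this]
    ring
  refine Eq.trans ?_ hR.symm
  rw [typePart_apply]
  have hDv : ∀ w, (Complex.ofRealCLM.comp D).toLinearMap w = ((Complex.normSq (h z))⁻¹ : ℝ) *
      (2 * ((h z).re * (fderiv ℂ h z w).re + (h z).im * (fderiv ℂ h z w).im) : ℝ) := by
    intro w
    simp [hD]
    ring
  rw [hDv, hDv, hI]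
  generalize (Complex.normSq (h z))⁻¹ = N
  apply Complex.ext <;> simp <;> ring

/-! ## Complex conjugation of forms -/

/-- The exterior algebra with the conjugate complex structure. -/
def ConjLam (n : ℕ) : Type := Lam n

instance : Ring (ConjLam n) := inferInstanceAs (Ring (Lam n))

instance : Algebra ℂ (ConjLam n) :=
  ((algebraMap ℂ (Lam n)).comp (starRingEnd ℂ)).toAlgebra' fun c x =>
    Algebra.commutes (A := Lam n) (conj c) x

theorem ConjLam.smul_def (c : ℂ) (x : ConjLam n) :
    c • x = (show ConjLam n from (conj c • (show Lam n from x) : Lam n)) := by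
  rw [Algebra.smul_def]
  exact (Algebra.smul_def (A := Lam n) (conj c) x).symm

/-- Complex conjugation of forms as an algebra homomorphism. -/
def conjHom (n : ℕ) : Lam n →ₐ[ℂ] ConjLam n :=
  ExteriorAlgebra.lift ℂ ⟨
    { toFun := fun L => (show ConjLam n from ExteriorAlgebra.ι ℂ (conjCov L))
      map_add' := fun L L' => by
        refine Eq.trans ?_ (map_add (ExteriorAlgebra.ι ℂ) (conjCov L) (conjCov L'))
        change ExteriorAlgebra.ι ℂ _ = ExteriorAlgebra.ι ℂ _
        congr 1
        refine LinearMap.ext fun v => ?_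
        simp
      map_smul' := fun c L => by
        rw [ConjLam.smul_def]
        refine Eq.trans ?_ (map_smul (ExteriorAlgebra.ι ℂ) (conj c) (conjCov L))
        change ExteriorAlgebra.ι ℂ _ = ExteriorAlgebra.ι ℂ _
        congr 1
        refine LinearMap.ext fun v => ?_
        simp }, fun L => ExteriorAlgebra.ι_sq_zero (R := ℂ) (conjCov L)⟩

theorem conjHom_ι (L : Cov n) :
    conjHom n (ExteriorAlgebra.ι ℂ L) = (show ConjLam n from ExteriorAlgebra.ι ℂ (conjCov L)) :=
  ExteriorAlgebra.lift_ι_apply _ _ _ _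

theorem conjCov_covBasis (k : Fin n ⊕ₗ Fin n) :
    conjCov (covBasis n k) = covSwap n (covBasis n k) := by
  rcases h : ofLex k with j | j <;> obtain rfl : k = toLex _ := h
  · rw [covBasis_inl]
    rfl
  · rw [covBasis_inr]
    rfl

theorem conjHom_lamBasis (S : Finset (Fin n ⊕ₗ Fin n)) :
    conjHom n (lamBasis n S)
      = (show ConjLam n from ExteriorAlgebra.map (covSwap n) (lamBasis n S)) := by
  rw [lamBasis_eq_prod]
  induction S.sort (· ≤ ·) with
  | nil => exact (map_one (conjHom n)).trans (map_one (ExteriorAlgebra.map (covSwap n))).symm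
  | cons k l ih =>
    simp only [List.map_cons, List.prod_cons, map_mul, ih, conjHom_ι, ExteriorAlgebra.map_apply_ι,
      conjCov_covBasis]
    rfl

/-- Replaces the conjugation defined through a basis by a multiplicative map determined on
covectors. Compatibility with pullback, and hence of real parts with charts, can then be checked on
generators. -/
theorem conjForm_eq (ψ : Lam n) : conjForm ψ = conjHom n ψ := by
  conv_rhs => rw [← sum_coeff ψ, map_sum]
  refine Finset.sum_congr rfl fun S _ => ?_
  rw [map_smul, ConjLam.smul_def, conjHom_lamBasis]

theorem conjHom_pull (A : Cn n →L[ℂ] Cn n) (ψ : Lam n) :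
    conjHom n (pull A ψ) = (show ConjLam n from pull A (show Lam n from conjHom n ψ)) := by
  induction ψ using ExteriorAlgebra.induction with
  | algebraMap r =>
    rw [AlgHom.commutes, AlgHom.commutes]
    exact (AlgHom.commutes (pull A) (conj r)).symm
  | ι L =>
    rw [pull_ι, conjHom_ι, conjHom_ι]
    exact (pull_ι A (conjCov L)).symm
  | mul a b ha hb =>
    rw [map_mul, map_mul, ha, hb, map_mul]
    exact (map_mul (pull A) (show Lam n from conjHom n a) (show Lam n from conjHom n b)).symm
  | add a b ha hb =>
    rw [map_add, map_add, ha, hb, map_add]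
    exact (map_add (pull A) (show Lam n from conjHom n a) (show Lam n from conjHom n b)).symm

theorem conjForm_pull (A : Cn n →L[ℂ] Cn n) (ψ : Lam n) :
    conjForm (pull A ψ) = pull A (conjForm ψ) := by
  rw [conjForm_eq, conjForm_eq]
  exact conjHom_pull A ψ

theorem reForm_pull (A : Cn n →L[ℂ] Cn n) (ψ : Lam n) :
    reForm (pull A ψ) = pull A (reForm ψ) := by
  rw [reForm, reForm, conjForm_pull, map_smul, map_add]

theorem conjForm_add (φ ψ : Lam n) : conjForm (φ + ψ) = conjForm φ + conjForm ψ := by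
  simp only [conjForm_eq]
  exact map_add (conjHom n) φ ψ

theorem conjForm_smul (c : ℂ) (ψ : Lam n) : conjForm (c • ψ) = conj c • conjForm ψ := by
  simp only [conjForm_eq, map_smul]
  exact ConjLam.smul_def c _

theorem reForm_add (φ ψ : Lam n) : reForm (φ + ψ) = reForm φ + reForm ψ := by
  rw [reForm, reForm, reForm, conjForm_add, ← smul_add, add_add_add_comm]

theorem reForm_ofReal_smul (c : ℝ) (ψ : Lam n) : reForm ((c : ℂ) • ψ) = (c : ℂ) • reForm ψ := by
  rw [reForm, reForm, conjForm_smul, Complex.conj_ofReal, ← smul_add, smul_comm]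

theorem contDiffAt_reForm {E : Type*} [NormedAddCommGroup E] [NormedSpace ℝ E] {F : E → Lam n}
    {y : E} (hF : ContDiffAt ℝ ∞ F y) : ContDiffAt ℝ ∞ (fun z => reForm (F z)) y := by
  refine ContDiffAt.const_smul _ (hF.add ?_)
  refine ContDiffAt.sum fun S _ => ?_
  have h : ContDiffAt ℝ ∞ (fun z => conj (coeff S (F z))) y :=
    Complex.conjCLE.contDiff.contDiffAt.comp y (contDiffAt_realCLM (coeffL S) hF)
  exact ContDiffAt.smul (𝕜 := ℝ) h
    (contDiffAt_const (c := ExteriorAlgebra.map (covSwap n) (lamBasis n S)))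

/-! ## Forms in charts -/

section Charts

variable {M : Type*} [TopologicalSpace M] [ChartedSpace (Cn n) M]

/-- The change of coordinates from the preferred chart at `x` to the one at `x₀`. -/
def chartTrans (x x₀ : M) : Cn n → Cn n := chartAt (Cn n) x₀ ∘ (chartAt (Cn n) x).symm

theorem eventually_target {x₀ : M} {y : Cn n} (hy : y ∈ (chartAt (Cn n) x₀).target) :
    ∀ᶠ z in nhds y, z ∈ (chartAt (Cn n) x₀).target :=
  (chartAt (Cn n) x₀).open_target.mem_nhds hy

theorem chartTrans_self_eventuallyEq (x : M) {y : Cn n} (hy : y ∈ (chartAt (Cn n) x).target) :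
    chartTrans x x =ᶠ[nhds y] id := by
  filter_upwards [(chartAt (Cn n) x).open_target.mem_nhds hy] with z hz
  exact (chartAt (Cn n) x).right_inv hz

theorem chartTrans_domain_eventually {x x₀ : M} {y : Cn n} (hy : y ∈ (chartAt (Cn n) x).target)
    (hy' : (chartAt (Cn n) x).symm y ∈ (chartAt (Cn n) x₀).source) :
    ∀ᶠ z in nhds y, z ∈ (chartAt (Cn n) x).target ∧
      (chartAt (Cn n) x).symm z ∈ (chartAt (Cn n) x₀).source :=
  (eventually_target hy).and
    (((chartAt (Cn n) x).continuousAt_symm hy).eventually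
      ((chartAt (Cn n) x₀).open_source.mem_nhds hy'))

theorem chartTrans_mem_target {x x₀ : M} {y : Cn n}
    (hy' : (chartAt (Cn n) x).symm y ∈ (chartAt (Cn n) x₀).source) :
    chartTrans x x₀ y ∈ (chartAt (Cn n) x₀).target :=
  (chartAt (Cn n) x₀).map_source hy'

theorem symm_chartTrans {x x₀ : M} {y : Cn n}
    (hy' : (chartAt (Cn n) x).symm y ∈ (chartAt (Cn n) x₀).source) :
    (chartAt (Cn n) x₀).symm (chartTrans x x₀ y) = (chartAt (Cn n) x).symm y :=
  (chartAt (Cn n) x₀).left_inv hy'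

/-- The point of a chart seen from its own preferred chart. -/
theorem symm_self_mem_source {x₀ : M} {y : Cn n} (hy : y ∈ (chartAt (Cn n) x₀).target) :
    (chartAt (Cn n) ((chartAt (Cn n) x₀).symm y)).symm
      (chartAt (Cn n) ((chartAt (Cn n) x₀).symm y) ((chartAt (Cn n) x₀).symm y))
        ∈ (chartAt (Cn n) x₀).source := by
  rw [(chartAt (Cn n) _).left_inv (mem_chart_source _ _)]
  exact (chartAt (Cn n) x₀).map_target hy

theorem chartTrans_self_apply {x₀ : M} {y : Cn n} (hy : y ∈ (chartAt (Cn n) x₀).target) :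
    chartTrans ((chartAt (Cn n) x₀).symm y) x₀
      (chartAt (Cn n) ((chartAt (Cn n) x₀).symm y) ((chartAt (Cn n) x₀).symm y)) = y := by
  rw [chartTrans, Function.comp_apply, (chartAt (Cn n) _).left_inv (mem_chart_source _ _),
    (chartAt (Cn n) x₀).right_inv hy]

/-- Smoothness of a form. -/
def IsSmoothForm (ψ : Form n M) : Prop :=
  ∀ x₀ : M, ∀ y ∈ (chartAt (Cn n) x₀).target, ContDiffAt ℝ ∞ (localRep ψ x₀) y

/-- Smoothness of a function, in the preferred charts. -/
def IsSmoothFun (f : M → ℝ) : Prop :=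
  ∀ x₀ : M, ∀ y ∈ (chartAt (Cn n) x₀).target,
    ContDiffAt ℝ ∞ (fun z => f ((chartAt (Cn n) x₀).symm z)) y

namespace IsSmoothForm

variable {ψ χ : Form n M}

theorem add (hψ : IsSmoothForm ψ) (hχ : IsSmoothForm χ) : IsSmoothForm (ψ + χ) := fun x₀ y hy =>
  ((hψ x₀ y hy).add (hχ x₀ y hy)).congr_of_eventuallyEq
    (.of_forall fun _ => map_add (pull _) _ _)

theorem sub (hψ : IsSmoothForm ψ) (hχ : IsSmoothForm χ) : IsSmoothForm (ψ - χ) := fun x₀ y hy =>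
  ((hψ x₀ y hy).sub (hχ x₀ y hy)).congr_of_eventuallyEq
    (.of_forall fun _ => map_sub (pull _) _ _)

theorem mul (hψ : IsSmoothForm ψ) (hχ : IsSmoothForm χ) : IsSmoothForm (ψ * χ) := fun x₀ y hy =>
  (contDiffAt_mul (hψ x₀ y hy) (hχ x₀ y hy)).congr_of_eventuallyEq
    (.of_forall fun _ => map_mul (pull _) _ _)

theorem smul (c : ℂ) (hψ : IsSmoothForm ψ) : IsSmoothForm (c • ψ) := fun x₀ y hy =>
  ((hψ x₀ y hy).const_smul c).congr_of_eventuallyEq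
    (.of_forall fun _ => map_smul (pull _) _ _)

theorem one : IsSmoothForm (1 : Form n M) := fun _ _ _ =>
  (contDiffAt_const (c := (1 : Lam n))).congr_of_eventuallyEq
    (.of_forall fun _ => map_one (pull _))

theorem pow (hψ : IsSmoothForm ψ) (k : ℕ) : IsSmoothForm (ψ ^ k) := by
  induction k with
  | zero => rw [pow_zero]; exact one
  | succ k ih => rw [pow_succ]; exact ih.mul hψ

theorem reF (hψ : IsSmoothForm ψ) : IsSmoothForm (reF ψ) := fun x₀ y hy =>
  (contDiffAt_reForm (hψ x₀ y hy)).congr_of_eventuallyEq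
    (.of_forall fun _ => (reForm_pull _ _).symm)

end IsSmoothForm

theorem localRep_scalar (f : M → ℝ) (x₀ : M) :
    localRep (scalar f : Form n M) x₀ = scalarLoc fun y => f ((chartAt (Cn n) x₀).symm y) := by
  ext1 y
  exact AlgHom.commutes _ _

theorem IsSmoothFun.scalar {f : M → ℝ} (hf : IsSmoothFun (n := n) f) :
    IsSmoothForm (scalar f : Form n M) := fun x₀ y hy => by
  rw [localRep_scalar]
  exact contDiffAt_scalarLoc (hf x₀ y hy)

theorem IsSmoothFun.add {f g : M → ℝ} (hf : IsSmoothFun (n := n) f) (hg : IsSmoothFun (n := n) g) :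
    IsSmoothFun (n := n) fun x => f x + g x :=
  fun x₀ y hy => (hf x₀ y hy).add (hg x₀ y hy)

theorem IsSmoothFun.const_mul {f : M → ℝ} (hf : IsSmoothFun (n := n) f) (c : ℝ) :
    IsSmoothFun (n := n) fun x => c * f x :=
  fun x₀ y hy => contDiffAt_const.mul (hf x₀ y hy)

theorem IsSmoothFun.contMDiff {f : M → ℝ} (hf : IsSmoothFun (n := n) f) :
    ContMDiff 𝓘(ℝ, Cn n) 𝓘(ℝ, ℝ) ∞ f := by
  intro x
  have h := hf x _ (mem_chart_target _ x)
  rw [contMDiffAt_iff]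
  constructor
  · have h1 : ContinuousAt (fun p => f ((chartAt (Cn n) x).symm (chartAt (Cn n) x p))) x :=
      ContinuousAt.comp (f := chartAt (Cn n) x) (x := x) h.continuousAt
        ((chartAt (Cn n) x).continuousAt (mem_chart_source _ x))
    refine h1.congr ?_
    filter_upwards [(chartAt (Cn n) x).open_source.mem_nhds (mem_chart_source _ x)] with p hp
    rw [(chartAt (Cn n) x).left_inv hp]
  · simp only [modelWithCornersSelf_coe, Set.range_id, contDiffWithinAt_univ]
    simpa [Function.comp_def, chartAt_self_eq] using h

/-! ### Holomorphic coordinate changes and chart independence of ∂ and ∂̄. -/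

variable [IsManifold 𝓘(ℂ, Cn n) ω M]

theorem contDiffAt_chartTrans {x x₀ : M} {y : Cn n} (hy : y ∈ (chartAt (Cn n) x).target)
    (hy' : (chartAt (Cn n) x).symm y ∈ (chartAt (Cn n) x₀).source) :
    ContDiffAt ℂ ∞ (chartTrans x x₀) y := by
  have h := contDiffWithinAt_ext_coord_change (I := 𝓘(ℂ, Cn n)) (n := ω) x₀ x (y := y)
    (by simp [hy, hy'])
  simp only [modelWithCornersSelf_coe, Set.range_id, contDiffWithinAt_univ] at h
  have h' := h.of_le (m := ∞) le_top
  simpa [chartTrans] using h'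

/-- The tangent space at a point is ℂⁿ through that point's own preferred chart, so the differential
of an inverse chart is the derivative of the transition into that chart, which varies with `y`. -/
theorem chartSymmD_eq (x₀ : M) {y : Cn n} (hy : y ∈ (chartAt (Cn n) x₀).target) :
    chartSymmD x₀ y = fderiv ℂ (chartTrans x₀ ((chartAt (Cn n) x₀).symm y)) y := by
  have : MDifferentiableAt 𝓘(ℂ, Cn n) 𝓘(ℂ, Cn n) (chartAt (Cn n) x₀).symm y := by
    have : IsManifold 𝓘(ℂ, Cn n) 1 M := IsManifold.of_le (n := ω) le_top
    exact mdifferentiableAt_atlas_symm (ChartedSpace.chart_mem_atlas _) hy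
  rw [chartSymmD, this.mfderiv]
  simp [chartTrans, writtenInExtChartAt]
  rfl

theorem chartD_eq (x : M) : chartD x = ContinuousLinearMap.id ℂ (Cn n) := by
  have : IsManifold 𝓘(ℂ, Cn n) 1 M := IsManifold.of_le (n := ω) le_top
  rw [chartD, mfderiv_chartAt_eq_tangentCoordChange (mem_chart_source _ x)]
  ext1 v
  exact tangentCoordChange_self (mem_extChartAt_source x)

theorem chartSymmD_self (x : M) :
    chartSymmD x (chartAt (Cn n) x x) = ContinuousLinearMap.id ℂ (Cn n) := by
  rw [chartSymmD_eq x (mem_chart_target _ x), (chartAt (Cn n) x).left_inv (mem_chart_source _ x),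
    (chartTrans_self_eventuallyEq x (mem_chart_target _ x)).fderiv_eq]
  exact fderiv_id

theorem chartSymmD_comp {x x₀ : M} {y : Cn n} (hy : y ∈ (chartAt (Cn n) x).target)
    (hy' : (chartAt (Cn n) x).symm y ∈ (chartAt (Cn n) x₀).source) :
    chartSymmD x y = (chartSymmD x₀ (chartTrans x x₀ y)).comp (fderiv ℂ (chartTrans x x₀) y) := by
  rw [chartSymmD_eq x hy, chartSymmD_eq x₀ (chartTrans_mem_target hy'), symm_chartTrans hy']
  set p := (chartAt (Cn n) x).symm y
  have e : chartTrans x p =ᶠ[nhds y] chartTrans x₀ p ∘ chartTrans x x₀ := by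
    filter_upwards [chartTrans_domain_eventually hy hy'] with z hz
    simp only [Function.comp_apply]
    rw [chartTrans, chartTrans, Function.comp_apply, Function.comp_apply, symm_chartTrans hz.2]
  rw [e.fderiv_eq]
  refine fderiv_comp y ?_ ((contDiffAt_chartTrans hy hy').differentiableAt (by simp))
  refine (contDiffAt_chartTrans (chartTrans_mem_target hy') ?_).differentiableAt (by simp)
  rw [symm_chartTrans hy']
  exact mem_chart_source _ p

theorem chartSymmD_comp_fderiv {x₀ : M} {y : Cn n} (hy : y ∈ (chartAt (Cn n) x₀).target) :
    (chartSymmD x₀ y).comp (fderiv ℂ (chartTrans ((chartAt (Cn n) x₀).symm y) x₀)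
      (chartAt (Cn n) ((chartAt (Cn n) x₀).symm y) ((chartAt (Cn n) x₀).symm y)))
      = ContinuousLinearMap.id ℂ (Cn n) := by
  have h := chartSymmD_comp (mem_chart_target _ ((chartAt (Cn n) x₀).symm y))
    (symm_self_mem_source hy)
  rw [chartSymmD_self, chartTrans_self_apply hy] at h
  exact h.symm

/-- In finite dimension a one-sided inverse is two-sided. -/
theorem fderiv_comp_chartSymmD {x₀ : M} {y : Cn n} (hy : y ∈ (chartAt (Cn n) x₀).target) :
    (fderiv ℂ (chartTrans ((chartAt (Cn n) x₀).symm y) x₀)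
      (chartAt (Cn n) ((chartAt (Cn n) x₀).symm y) ((chartAt (Cn n) x₀).symm y))).comp
      (chartSymmD x₀ y) = ContinuousLinearMap.id ℂ (Cn n) := by
  have h := chartSymmD_comp_fderiv hy
  set A := chartSymmD x₀ y
  set B := fderiv ℂ (chartTrans ((chartAt (Cn n) x₀).symm y) x₀)
      (chartAt (Cn n) ((chartAt (Cn n) x₀).symm y) ((chartAt (Cn n) x₀).symm y))
  have h1 : A.toLinearMap * B.toLinearMap = 1 := congrArg ContinuousLinearMap.toLinearMap h
  have h2 := mul_eq_one_comm.1 h1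
  exact ContinuousLinearMap.coe_injective h2

theorem chartSymmD_injective {x₀ : M} {y : Cn n} (hy : y ∈ (chartAt (Cn n) x₀).target) :
    Function.Injective (chartSymmD x₀ y) := by
  intro v w hvw
  have h := fderiv_comp_chartSymmD hy
  have hv := congrArg (fun A : Cn n →L[ℂ] Cn n => A v) h
  have hw := congrArg (fun A : Cn n →L[ℂ] Cn n => A w) h
  simp only [ContinuousLinearMap.comp_apply, ContinuousLinearMap.id_apply] at hv hw
  rw [← hv, ← hw, hvw]

/-- The expressions of a form in two charts are related by pullback. -/
theorem localRep_eq_pullF (ψ : Form n M) {x x₀ : M} {y : Cn n}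
    (hy : y ∈ (chartAt (Cn n) x).target)
    (hy' : (chartAt (Cn n) x).symm y ∈ (chartAt (Cn n) x₀).source) :
    localRep ψ x y = pullF (chartTrans x x₀) (localRep ψ x₀) y := by
  rw [pullF, localRep, localRep, pull_pull, symm_chartTrans hy', chartSymmD_comp hy hy']

theorem pull_chartSymmD_pull {x₀ : M} {y : Cn n} (hy : y ∈ (chartAt (Cn n) x₀).target)
    (ψ : Lam n) : pull (chartSymmD x₀ y)
      (pull (fderiv ℂ (chartTrans ((chartAt (Cn n) x₀).symm y) x₀)
        (chartAt (Cn n) ((chartAt (Cn n) x₀).symm y) ((chartAt (Cn n) x₀).symm y))) ψ) = ψ := by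
  rw [pull_pull, fderiv_comp_chartSymmD hy, pull_id]

theorem localRep_eventuallyEq (ψ : Form n M) {x₀ : M} {y : Cn n}
    (hy : y ∈ (chartAt (Cn n) x₀).target) :
    localRep ψ ((chartAt (Cn n) x₀).symm y)
      =ᶠ[nhds (chartAt (Cn n) ((chartAt (Cn n) x₀).symm y) ((chartAt (Cn n) x₀).symm y))]
      pullF (chartTrans ((chartAt (Cn n) x₀).symm y) x₀) (localRep ψ x₀) := by
  filter_upwards [chartTrans_domain_eventually (mem_chart_target _ ((chartAt (Cn n) x₀).symm y))
    (symm_self_mem_source hy)] with z hz using localRep_eq_pullF ψ hz.1 hz.2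

theorem del_apply (ψ : Form n M) (x : M) :
    del ψ x = delLoc (localRep ψ x) (chartAt (Cn n) x x) := by
  rw [del, chartD_eq, pull_id]

theorem delbar_apply (ψ : Form n M) (x : M) :
    delbar ψ x = delbarLoc (localRep ψ x) (chartAt (Cn n) x x) := by
  rw [delbar, chartD_eq, pull_id]

/-- By definition `del ψ` uses a different chart at every point. Naturality of ∂ under the
transition map brings all these computations into the single chart at `x₀`, so that `del ψ` can be
differentiated again. -/
theorem localRep_del {ψ : Form n M} (hψ : IsSmoothForm ψ) {x₀ : M} {y : Cn n}
    (hy : y ∈ (chartAt (Cn n) x₀).target) :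
    localRep (del ψ) x₀ y = delLoc (localRep ψ x₀) y := by
  have hτ := contDiffAt_chartTrans (mem_chart_target _ ((chartAt (Cn n) x₀).symm y))
    (symm_self_mem_source hy)
  have hd := (hψ x₀ y hy).differentiableAt (by simp)
  rw [localRep, del_apply, delLoc_congr (localRep_eventuallyEq ψ hy),
    delLoc_pullF hτ (by rwa [chartTrans_self_apply hy]), pull_chartSymmD_pull hy,
    chartTrans_self_apply hy]

theorem localRep_delbar {ψ : Form n M} (hψ : IsSmoothForm ψ) {x₀ : M} {y : Cn n}
    (hy : y ∈ (chartAt (Cn n) x₀).target) :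
    localRep (delbar ψ) x₀ y = delbarLoc (localRep ψ x₀) y := by
  have hτ := contDiffAt_chartTrans (mem_chart_target _ ((chartAt (Cn n) x₀).symm y))
    (symm_self_mem_source hy)
  have hd := (hψ x₀ y hy).differentiableAt (by simp)
  rw [localRep, delbar_apply, delbarLoc_congr (localRep_eventuallyEq ψ hy),
    delbarLoc_pullF hτ (by rwa [chartTrans_self_apply hy]), pull_chartSymmD_pull hy,
    chartTrans_self_apply hy]

namespace IsSmoothForm

variable {ψ χ : Form n M}

theorem del (hψ : IsSmoothForm ψ) : IsSmoothForm (del ψ) := fun x₀ y hy =>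
  (contDiffAt_delLoc (hψ x₀ y hy)).congr_of_eventuallyEq
    ((eventually_target hy).mono fun _ hz => localRep_del hψ hz)

theorem delbar (hψ : IsSmoothForm ψ) : IsSmoothForm (delbar ψ) := fun x₀ y hy =>
  (contDiffAt_delbarLoc (hψ x₀ y hy)).congr_of_eventuallyEq
    ((eventually_target hy).mono fun _ hz => localRep_delbar hψ hz)

end IsSmoothForm

theorem del_scalar (f : M → ℝ) (x : M) : (del (scalar f) : Form n M) x
    = delLoc (scalarLoc fun y => f ((chartAt (Cn n) x).symm y)) (chartAt (Cn n) x x) := by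
  rw [del_apply, localRep_scalar]

theorem del_delbar_scalar {f : M → ℝ} (hf : IsSmoothFun (n := n) f) (x : M) :
    (del (delbar (scalar f)) : Form n M) x
      = delLoc (delbarLoc (scalarLoc fun y => f ((chartAt (Cn n) x).symm y)))
        (chartAt (Cn n) x x) := by
  rw [del_apply, ← localRep_scalar]
  exact delLoc_congr ((eventually_target (mem_chart_target _ x)).mono fun _ hz =>
    localRep_delbar hf.scalar hz)

/-- Smoothness at p is given in the preferred chart of p; the transition to another chart is
holomorphic, hence real smooth. -/
theorem isSmoothFun_of_contMDiff {f : M → ℝ} (hf : ContMDiff 𝓘(ℝ, Cn n) 𝓘(ℝ, ℝ) ∞ f) :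
    IsSmoothFun (n := n) f := by
  intro x₀ y hy
  set p := (chartAt (Cn n) x₀).symm y with hp
  have h := (contMDiffAt_iff.1 (hf p)).2
  simp only [modelWithCornersSelf_coe, Set.range_id, contDiffWithinAt_univ] at h
  have h' : ContDiffAt ℝ ∞ (fun z => f ((chartAt (Cn n) p).symm z)) (chartTrans x₀ p y) := by
    simpa [Function.comp_def, chartTrans, hp, chartAt_self_eq] using h
  have hτ : ContDiffAt ℝ ∞ (chartTrans x₀ p) y :=
    (contDiffAt_chartTrans hy (mem_chart_source _ p)).restrict_scalars ℝ
  refine (h'.comp y hτ).congr_of_eventuallyEq ?_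
  filter_upwards [chartTrans_domain_eventually hy (mem_chart_source _ p)] with z hz
  rw [Function.comp_apply, symm_chartTrans hz.2]

end Charts

/-! ## Smooth families of matrices -/

section SmoothMatrix

variable {E : Type*} [NormedAddCommGroup E] [NormedSpace ℝ E]
  {A : E → Matrix (Fin n) (Fin n) ℂ} {y : E}

theorem contDiffAt_det (hA : ∀ i j, ContDiffAt ℝ ∞ (fun z => A z i j) y) :
    ContDiffAt ℝ ∞ (fun z => (A z).det) y := by
  simp only [Matrix.det_apply']
  exact ContDiffAt.sum fun σ _ => contDiffAt_const.mul (contDiffAt_prod fun i _ => hA _ _)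

theorem contDiffAt_det_re (hA : ∀ i j, ContDiffAt ℝ ∞ (fun z => A z i j) y) :
    ContDiffAt ℝ ∞ (fun z => (A z).det.re) y :=
  Complex.reCLM.contDiff.contDiffAt.comp y (contDiffAt_det hA)

theorem contDiffAt_adjugate (hA : ∀ i j, ContDiffAt ℝ ∞ (fun z => A z i j) y) (i j : Fin n) :
    ContDiffAt ℝ ∞ (fun z => (A z).adjugate i j) y := by
  simp only [Matrix.adjugate_apply]
  refine contDiffAt_det fun k l => ?_
  by_cases h : k = j
  · subst h
    simp only [Matrix.updateRow_self]
    exact contDiffAt_const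
  · simp only [Matrix.updateRow_ne h]
    exact hA k l

theorem contDiffAt_formOf (hA : ∀ i j, ContDiffAt ℝ ∞ (fun z => A z i j) y) :
    ContDiffAt ℝ ∞ (fun z => formOf (A z)) y :=
  ContDiffAt.const_smul _ (ContDiffAt.sum fun i _ => ContDiffAt.sum fun j _ =>
    ContDiffAt.smul (𝕜 := ℝ) (hA i j) (contDiffAt_const
      (c := ExteriorAlgebra.ι ℂ (dz i) * ExteriorAlgebra.ι ℂ (dzbar j))))

/-- Adjugate and determinant are polynomial in the entries; the real power and the inverse are
smooth because the determinant is nonzero at `y`. -/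
theorem contDiffAt_rootMat (hA : ∀ i j, ContDiffAt ℝ ∞ (fun z => A z i j) y)
    (hpos : (A y).PosDef) (i j : Fin n) : ContDiffAt ℝ ∞ (fun z => rootMat (A z) i j) y := by
  have hQ : (((n - 1).factorial : ℂ)⁻¹ • (A y)ᵀ).PosDef := by
    refine hpos.transpose.smul ?_
    rw [inv_pos]
    exact_mod_cast Nat.factorial_pos _
  obtain ⟨h1, h2⟩ := det_eq_re _ hQ
  have hq : ∀ i j, ContDiffAt ℝ ∞ (fun z => (((n - 1).factorial : ℂ)⁻¹ • (A z)ᵀ) i j) y :=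
    fun i j => contDiffAt_const.mul (hA j i)
  simp only [rootMat, Matrix.smul_apply, smul_eq_mul, Matrix.inv_def, Ring.inverse_eq_inv']
  refine ContDiffAt.mul ?_ (ContDiffAt.mul ?_ (contDiffAt_adjugate hq i j))
  · exact Complex.ofRealCLM.contDiff.contDiffAt.comp y
      ((contDiffAt_det_re hq).rpow_const_of_ne h2.ne')
  · exact (contDiffAt_det hq).inv (by rw [h1]; exact Complex.ofReal_ne_zero.2 h2.ne')

end SmoothMatrix

theorem delbarLoc_scalarLoc_add_const {n : ℕ} (f : Cn n → ℝ) (c : ℝ) :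
    delbarLoc (scalarLoc fun y => f y + c) = delbarLoc (scalarLoc f) := by
  ext1 y
  rw [delbarLoc_eq_wirtinger, delbarLoc_eq_wirtinger]
  congr 1
  ext1 v
  refine Finset.sum_congr rfl fun S _ => ?_
  have : (fun p => coeff S (scalarLoc (fun y => f y + c) p))
      = fun p => coeff S (scalarLoc f p) + coeff S (algebraMap ℂ (Lam n) c) := by
    ext1 p
    rw [scalarLoc, Complex.ofReal_add, map_add]
    exact map_add (coeffL S) _ _
  rw [this, fderiv_add_const]

theorem pullMat_posDef {n : ℕ} {A : Cn n →L[ℂ] Cn n} (hA : Function.Injective A)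
    {G : Matrix (Fin n) (Fin n) ℂ} (hG : G.PosDef) : (pullMat A G).PosDef := by
  have h : ∀ v w, hermBilin (pullMat A G) v w = hermBilin G (A v) (A w) := fun v w => by
    rw [hermBilin_apply, hermBilin_apply, hermPair_pullMat]
  rw [← hermMatrix_hermBilin (pullMat A G)]
  refine hermMatrix_posDef _ (fun v w => ?_) (hermBilin_J _) fun v hv => ?_
  · rw [h, h, hermBilin_symm G hG.1]
  · rw [h]
    exact hermBilin_pos G hG _ fun h0 => hv (hA (h0.trans (map_zero A).symm))

theorem contDiffAt_det_matOf_fderiv {n : ℕ} {τ : Cn n → Cn n} {y : Cn n} (hτ : ContDiffAt ℂ ∞ τ y) :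
    ContDiffAt ℂ ∞ (fun z => (matOf (fderiv ℂ τ z)).det) y := by
  have hd : ContDiffAt ℂ ∞ (fderiv ℂ τ) y := hτ.fderiv_right (by simp)
  have he : ∀ i j, ContDiffAt ℂ ∞ (fun z => matOf (fderiv ℂ τ z) i j) y := fun i j => by
    simp only [matOf_apply]
    exact contDiffAt_pi.1 (hd.clm_apply contDiffAt_const) i
  simp only [Matrix.det_apply']
  exact ContDiffAt.sum fun σ _ => contDiffAt_const.mul (contDiffAt_prod fun i _ => he _ _)

/-! ## Hermitian metrics in charts -/

section Metric

variable {M : Type*} [TopologicalSpace M] [ChartedSpace (Cn n) M]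

namespace HermitianMetric

variable (h : HermitianMetric n M)

/-- The matrix of the metric at a point. -/
def mat (x : M) : Matrix (Fin n) (Fin n) ℂ := hermMatrix fun v w => h.g x v w

theorem form_eq (x : M) : h.form x = formOf (h.mat x) := rfl

theorem mat_posDef (x : M) : (h.mat x).PosDef :=
  hermMatrix_posDef (h.g x) (h.symm x) (h.J_invariant x) (h.pos x)

theorem localMatrix_eq_pullMat (x₀ : M) (y : Cn n) : h.localMatrix x₀ y
    = pullMat (chartSymmD x₀ y) (h.mat ((chartAt (Cn n) x₀).symm y)) :=
  hermMatrix_comp _ (h.g _) (h.J_invariant _)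

theorem localRep_form (x₀ : M) (y : Cn n) :
    localRep h.form x₀ y = formOf (h.localMatrix x₀ y) := by
  rw [localRep, form_eq, pull_formOf, localMatrix_eq_pullMat]

theorem contDiffAt_localMatrix (x₀ : M) {y : Cn n} (hy : y ∈ (chartAt (Cn n) x₀).target)
    (i j : Fin n) : ContDiffAt ℝ ∞ (fun z => h.localMatrix x₀ z i j) y := by
  have hs : ∀ v w, ContDiffAt ℝ ∞ (fun z => ((h.g ((chartAt (Cn n) x₀).symm z)
      (chartSymmD x₀ z v) (chartSymmD x₀ z w) : ℝ) : ℂ)) y := fun v w =>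
    Complex.ofRealCLM.contDiff.contDiffAt.comp y
      ((h.smooth x₀ v w).contDiffAt ((chartAt (Cn n) x₀).open_target.mem_nhds hy))
  exact contDiffAt_const.mul ((hs _ _).add (contDiffAt_const.mul (hs _ _)))

theorem isSmoothForm : IsSmoothForm h.form := fun x₀ y hy => by
  rw [show localRep h.form x₀ = fun z => formOf (h.localMatrix x₀ z) from
    funext (h.localRep_form x₀)]
  exact contDiffAt_formOf (h.contDiffAt_localMatrix x₀ hy)

end HermitianMetric

variable [IsManifold 𝓘(ℂ, Cn n) ω M]

namespace HermitianMetric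

variable (h : HermitianMetric n M)

theorem localMatrix_posDef (x₀ : M) {y : Cn n} (hy : y ∈ (chartAt (Cn n) x₀).target) :
    (h.localMatrix x₀ y).PosDef := by
  rw [localMatrix_eq_pullMat]
  exact pullMat_posDef (chartSymmD_injective hy) (h.mat_posDef _)

/-- The logarithm of the determinant of the metric in a chart. -/
def logDet (x₀ : M) (y : Cn n) : ℝ := Real.log (h.localMatrix x₀ y).det.re

theorem contDiffAt_logDet (x₀ : M) {y : Cn n} (hy : y ∈ (chartAt (Cn n) x₀).target) :
    ContDiffAt ℝ ∞ (h.logDet x₀) y :=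
  (contDiffAt_det_re (h.contDiffAt_localMatrix x₀ hy)).log
    (det_eq_re _ (h.localMatrix_posDef x₀ hy)).2.ne'

theorem ric_apply (x : M) : h.ric x
    = -Complex.I • delLoc (delbarLoc (scalarLoc (h.logDet x))) (chartAt (Cn n) x x) := by
  rw [ric, chartD_eq, pull_id]
  rfl

theorem localMatrix_chartTrans {x x₀ : M} {y : Cn n} (hy : y ∈ (chartAt (Cn n) x).target)
    (hy' : (chartAt (Cn n) x).symm y ∈ (chartAt (Cn n) x₀).source) :
    h.localMatrix x y
      = pullMat (fderiv ℂ (chartTrans x x₀) y) (h.localMatrix x₀ (chartTrans x x₀ y)) := by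
  rw [localMatrix, chartSymmD_comp hy hy', ← symm_chartTrans hy']
  exact hermMatrix_comp (fderiv ℂ (chartTrans x x₀) y)
    ((h.g ((chartAt (Cn n) x₀).symm (chartTrans x x₀ y))).compl₁₂
      ((chartSymmD x₀ (chartTrans x x₀ y)).toLinearMap.restrictScalars ℝ)
      ((chartSymmD x₀ (chartTrans x x₀ y)).toLinearMap.restrictScalars ℝ))
    (fun v w => by
      simp only [LinearMap.compl₁₂_apply, LinearMap.coe_restrictScalars,
        ContinuousLinearMap.coe_coe, ContinuousLinearMap.map_smul, h.J_invariant])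

/-- The determinant changes by the squared modulus of the holomorphic Jacobian. Its nonvanishing
follows from positivity of the metric in both charts. -/
theorem logDet_chartTrans {x x₀ : M} {y : Cn n} (hy : y ∈ (chartAt (Cn n) x).target)
    (hy' : (chartAt (Cn n) x).symm y ∈ (chartAt (Cn n) x₀).source) :
    Complex.normSq (matOf (fderiv ℂ (chartTrans x x₀) y)).det ≠ 0 ∧
    h.logDet x y = h.logDet x₀ (chartTrans x x₀ y)
      + Real.log (Complex.normSq (matOf (fderiv ℂ (chartTrans x x₀) y)).det) := by
  have h1 := (det_eq_re _ (h.localMatrix_posDef x hy)).2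
  have h2 := (det_eq_re _ (h.localMatrix_posDef x₀ (chartTrans_mem_target hy'))).2
  rw [h.localMatrix_chartTrans hy hy', det_pullMat, Complex.re_ofReal_mul] at h1
  have h3 : Complex.normSq (matOf (fderiv ℂ (chartTrans x x₀) y)).det ≠ 0 := by
    intro h0
    rw [h0, zero_mul] at h1
    exact lt_irrefl _ h1
  refine ⟨h3, ?_⟩
  rw [logDet, logDet, h.localMatrix_chartTrans hy hy', det_pullMat, Complex.re_ofReal_mul,
    Real.log_mul h3 h2.ne', add_comm]

/-- The Ricci form also uses a different chart at each point. The discrepancy is ∂∂̄ log|J|² with J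
a nonvanishing holomorphic Jacobian, which is zero; the rest is naturality. -/
theorem localRep_ric {x₀ : M} {y : Cn n} (hy : y ∈ (chartAt (Cn n) x₀).target) :
    localRep h.ric x₀ y = -Complex.I • delLoc (delbarLoc (scalarLoc (h.logDet x₀))) y := by
  set p : M := (chartAt (Cn n) x₀).symm y with hp
  set c := chartAt (Cn n) p p with hc
  set τ : Cn n → Cn n := chartTrans p x₀ with hτd
  have hτc : τ c = y := chartTrans_self_apply (n := n) hy
  have hdom := chartTrans_domain_eventually (mem_chart_target (Cn n) p) (symm_self_mem_source hy)
  have hτ : ∀ᶠ z in nhds c, ContDiffAt ℂ ∞ τ z :=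
    hdom.mono fun z hz => contDiffAt_chartTrans hz.1 hz.2
  have hdet := contDiffAt_det_matOf_fderiv hτ.self_of_nhds
  have h0 : (matOf (fderiv ℂ τ c)).det ≠ 0 := fun h0 =>
    (h.logDet_chartTrans hdom.self_of_nhds.1 hdom.self_of_nhds.2).1 (by
      rw [← hτd, h0, map_zero])
  have hld : ContDiffAt ℝ ∞ (h.logDet x₀) (τ c) := by
    rw [hτc]
    exact h.contDiffAt_logDet x₀ hy
  have hN : ContDiffAt ℝ ∞
      (fun z => Real.log (Complex.normSq (matOf (fderiv ℂ τ z)).det)) c := by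
    have hdet' := hdet.restrict_scalars ℝ
    have hre := Complex.reCLM.contDiff.contDiffAt.comp c hdet'
    have him := Complex.imCLM.contDiff.contDiffAt.comp c hdet'
    exact ((hre.mul hre).add (him.mul him)).log (by
      change Complex.normSq _ ≠ 0
      rwa [Ne, Complex.normSq_eq_zero])
  have e : scalarLoc (n := n) (h.logDet p) =ᶠ[nhds c]
      scalarLoc fun z => h.logDet x₀ (τ z)
        + Real.log (Complex.normSq (matOf (fderiv ℂ τ z)).det) := by
    filter_upwards [hdom] with z hz
    rw [scalarLoc, scalarLoc, (h.logDet_chartTrans hz.1 hz.2).2]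
  rw [localRep, ← hp, ric_apply, ← hc, delLoc_congr (delbarLoc_eventuallyEq e),
    delLoc_delbarLoc_add (f := fun z => h.logDet x₀ (τ z))
      (hld.comp c (hτ.self_of_nhds.restrict_scalars ℝ)) hN,
    delLoc_delbarLoc_log_normSq hdet h0, add_zero, delLoc_delbarLoc_comp hτ hld, hτc, map_smul]
  congr 1
  exact pull_chartSymmD_pull hy _

theorem isSmoothForm_ric : IsSmoothForm h.ric := fun x₀ _ hy =>
  ((contDiffAt_delLoc (contDiffAt_delbarLoc
    (contDiffAt_scalarLoc (h.contDiffAt_logDet x₀ hy)))).const_smul (-Complex.I)).congr_of_eventuallyEq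
    ((eventually_target hy).mono fun _ hz => h.localRep_ric hz)

end HermitianMetric

/-- If the logarithm of a density differs from `log det g` by a smooth function and a constant, then
its Ricci form differs from that of the metric by the complex Hessian of the function. -/
theorem neg_I_smul_del_delbar_eq (h : HermitianMetric n M) {f : M → ℝ}
    (hf : IsSmoothFun (n := n) f) (c : ℝ) {x : M} {A : Cn n → ℝ}
    (hA : ∀ y ∈ (chartAt (Cn n) x).target,
      A y = h.logDet x y + f ((chartAt (Cn n) x).symm y) + c) :
    -Complex.I • delLoc (delbarLoc (scalarLoc A)) (chartAt (Cn n) x x)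
      = h.ric x - Complex.I • (del (delbar (scalar f)) : Form n M) x := by
  have hx := mem_chart_target (Cn n) x
  have e : scalarLoc (n := n) A =ᶠ[nhds (chartAt (Cn n) x x)]
      scalarLoc fun y => h.logDet x y + f ((chartAt (Cn n) x).symm y) + c := by
    filter_upwards [eventually_target hx] with y hy
    rw [scalarLoc, scalarLoc, hA y hy]
  rw [delLoc_congr (delbarLoc_eventuallyEq e), delbarLoc_scalarLoc_add_const,
    delLoc_delbarLoc_add (h.contDiffAt_logDet x hx) (hf x _ hx), smul_add, ← h.ric_apply,
    del_delbar_scalar hf, neg_smul, sub_eq_add_neg]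

end Metric

theorem coeff_smul {n : ℕ} (S : Finset (Fin n ⊕ₗ Fin n)) (c : ℂ) (ψ : Lam n) :
    coeff S (c • ψ) = c * coeff S ψ := map_smul (coeffL S) c ψ

theorem density_ofReal_smul {n : ℕ} (c : ℝ) (ψ : Lam n) :
    density ((c : ℂ) • ψ) = c * density ψ := by
  rw [density, coeff_smul, mul_div_assoc, Complex.re_ofReal_mul, density]

theorem reF_add {n : ℕ} {M : Type*} (φ ψ : Form n M) : reF (φ + ψ) = reF φ + reF ψ :=
  funext fun _ => reForm_add _ _

theorem reF_ofReal_smul {n : ℕ} {M : Type*} (c : ℝ) (ψ : Form n M) : reF ((c : ℂ) • ψ) = (c : ℂ) • reF ψ :=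
  funext fun _ => reForm_ofReal_smul _ _

/-! ### Logarithms of volume ratios, and the two equations. -/

section Equation

variable {M : Type*} [TopologicalSpace M] [ChartedSpace (Cn n) M]

namespace HermitianMetric

variable (h k : HermitianMetric n M)

/-- The logarithm of the quotient of the determinants of two metrics. -/
def logRatio (x : M) : ℝ := Real.log (h.mat x).det.re - Real.log (k.mat x).det.re

theorem det_mat_pos (x : M) : 0 < (h.mat x).det.re := (det_eq_re _ (h.mat_posDef x)).2

theorem logRatio_add (l : HermitianMetric n M) (x : M) :
    h.logRatio k x + k.logRatio l x = h.logRatio l x := by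
  rw [logRatio, logRatio, logRatio]
  ring

theorem form_pow_apply (m : ℕ) (x : M) : (h.form ^ m) x = formOf (h.mat x) ^ m := rfl

theorem log_volRatio (x : M) :
    Real.log (volRatio (h.form ^ n) (k.form ^ n) x) = h.logRatio k x := by
  have hf : (n.factorial : ℝ) ≠ 0 := by positivity
  rw [volRatio, form_pow_apply, form_pow_apply, density_formOf_pow, density_formOf_pow,
    mul_div_mul_left _ _ hf, Real.log_div (h.det_mat_pos x).ne' (k.det_mat_pos x).ne', logRatio]

theorem log_volRatio_OmegaVol (T : ℝ) (φ : M → ℝ) (x : M) :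
    Real.log (volRatio (OmegaVol h T φ) (k.form ^ n) x)
      = h.logRatio k x + φ x / (((n : ℝ) - 1) * T) := by
  have hf : (n.factorial : ℝ) ≠ 0 := by positivity
  rw [← log_volRatio, volRatio, volRatio, OmegaVol, density_ofReal_smul,
    mul_div_assoc, Real.log_mul (Real.exp_ne_zero _), Real.log_exp, add_comm]
  rw [form_pow_apply, form_pow_apply, density_formOf_pow, density_formOf_pow]
  exact div_ne_zero (mul_ne_zero hf (h.det_mat_pos x).ne') (mul_ne_zero hf (k.det_mat_pos x).ne')

end HermitianMetric

variable [IsManifold 𝓘(ℂ, Cn n) ω M]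

/-! ## Linearity of the complex Hessian -/

section Hessian

variable {f g : M → ℝ}

theorem del_scalar_add (hf : IsSmoothFun (n := n) f) (hg : IsSmoothFun (n := n) g) :
    (del (scalar fun x => f x + g x) : Form n M) = del (scalar f) + del (scalar g) := by
  ext1 x
  have hx := mem_chart_target (Cn n) x
  have h : ∀ {k : M → ℝ}, IsSmoothFun (n := n) k → DifferentiableAt ℝ
      (scalarLoc fun y => k ((chartAt (Cn n) x).symm y)) (chartAt (Cn n) x x) := fun hk =>
    (contDiffAt_scalarLoc (hk x _ hx)).differentiableAt (by simp)
  rw [Pi.add_apply, del_scalar, del_scalar, del_scalar, ← delLoc_add (h hf) (h hg), ← scalarLoc_add]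

theorem del_delbar_scalar_add (hf : IsSmoothFun (n := n) f) (hg : IsSmoothFun (n := n) g) :
    (del (delbar (scalar fun x => f x + g x)) : Form n M)
      = del (delbar (scalar f)) + del (delbar (scalar g)) := by
  ext1 x
  have hx := mem_chart_target (Cn n) x
  rw [Pi.add_apply, del_delbar_scalar hf, del_delbar_scalar hg, del_delbar_scalar (hf.add hg),
    ← delLoc_delbarLoc_add (hf x _ hx) (hg x _ hx)]

theorem scalarLoc_const_mul (c : ℝ) (k : Cn n → ℝ) :
    (scalarLoc fun z => c * k z) = fun z => (c : ℂ) • scalarLoc k z := by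
  ext1 z
  rw [scalarLoc, scalarLoc, Complex.ofReal_mul, map_mul, ← Algebra.smul_def]

theorem del_scalar_const_mul (c : ℝ) (hf : IsSmoothFun (n := n) f) :
    (del (scalar fun x => c * f x) : Form n M) = (c : ℂ) • del (scalar f) := by
  ext1 x
  rw [Pi.smul_apply, del_scalar, del_scalar, scalarLoc_const_mul, delLoc_smul]
  exact (contDiffAt_scalarLoc (hf x _ (mem_chart_target _ x))).differentiableAt (by simp)

theorem del_delbar_scalar_const_mul (c : ℝ) (hf : IsSmoothFun (n := n) f) :
    (del (delbar (scalar fun x => c * f x)) : Form n M) = (c : ℂ) • del (delbar (scalar f)) := by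
  ext1 x
  have h := contDiffAt_scalarLoc (hf x _ (mem_chart_target _ x))
  rw [Pi.smul_apply, del_delbar_scalar hf, del_delbar_scalar (hf.const_mul c),
    ← delLoc_smul _ ((contDiffAt_delbarLoc h).differentiableAt (by simp))]
  apply delLoc_congr
  filter_upwards [eventually_differentiableAt h] with z hz
  rw [scalarLoc_const_mul, delbarLoc_smul _ hz]

theorem hessForm_const_mul (α : HermitianMetric n M) (c : ℝ) (hf : IsSmoothFun (n := n) f) :
    hessForm α (fun x => c * f x) = (c : ℂ) • hessForm α f := by
  rw [hessForm, hessForm, del_scalar_const_mul c hf, del_delbar_scalar_const_mul c hf,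
    smul_comm Complex.I, smul_comm Complex.I, smul_mul_assoc (c : ℂ), smul_mul_assoc (c : ℂ),
    reF_ofReal_smul, smul_add]

/-- Used with `g` = u/(n-1): adding `g` to the logarithm of a volume form changes its Ricci form by
-√-1∂∂̄g, and the whole bracket changes by minus the Hessian operator of `g`. -/
theorem ricci_part_sub_hessForm (α : HermitianMetric n M) (R : Form n M)
    (hf : IsSmoothFun (n := n) f) (hg : IsSmoothFun (n := n) g) :
    (R - Complex.I • del (delbar (scalar g))) * α.form ^ (n - 2)
        - reF ((Complex.I • del (scalar fun x => f x + g x)) * delbar (α.form ^ (n - 2)))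
      = (R * α.form ^ (n - 2)
        - reF ((Complex.I • del (scalar f)) * delbar (α.form ^ (n - 2)))) - hessForm α g := by
  rw [hessForm, del_scalar_add hf hg, smul_add, add_mul, reF_add, sub_mul]
  abel

theorem isSmoothForm_hessForm (α : HermitianMetric n M) (hf : IsSmoothFun (n := n) f) :
    IsSmoothForm (hessForm α f) :=
  ((hf.scalar.delbar.del.smul _).mul (α.isSmoothForm.pow _)).add
    ((hf.scalar.del.smul _).mul (α.isSmoothForm.pow _).delbar).reF

end Hessian

/-! ## Quotients of volume forms -/

namespace HermitianMetric

variable (h k : HermitianMetric n M)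

/-- The Jacobian term depends on the chart and not on the metric, so it cancels when two metrics are
compared. -/
theorem logDet_eq {x₀ : M} {y : Cn n} (hy : y ∈ (chartAt (Cn n) x₀).target) :
    h.logDet x₀ y = Real.log (Complex.normSq (matOf (chartSymmD x₀ y)).det)
      + Real.log (h.mat ((chartAt (Cn n) x₀).symm y)).det.re := by
  have h1 := (det_eq_re _ (h.localMatrix_posDef x₀ hy)).2
  rw [localMatrix_eq_pullMat, det_pullMat, Complex.re_ofReal_mul] at h1
  rw [logDet, localMatrix_eq_pullMat, det_pullMat, Complex.re_ofReal_mul,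
    Real.log_mul (left_ne_zero_of_mul h1.ne') (h.det_mat_pos _).ne']

theorem logDet_eq_add_logRatio {x₀ : M} {y : Cn n} (hy : y ∈ (chartAt (Cn n) x₀).target) :
    h.logDet x₀ y = k.logDet x₀ y + h.logRatio k ((chartAt (Cn n) x₀).symm y) := by
  rw [h.logDet_eq hy, k.logDet_eq hy, logRatio]
  ring

theorem isSmoothFun_logRatio : IsSmoothFun (n := n) (h.logRatio k) := fun x₀ y hy => by
  refine ((h.contDiffAt_logDet x₀ hy).sub (k.contDiffAt_logDet x₀ hy)).congr_of_eventuallyEq ?_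
  filter_upwards [eventually_target hy] with z hz
  rw [h.logDet_eq_add_logRatio k hz, add_sub_cancel_left]

theorem ric_eq_sub : h.ric = k.ric - Complex.I • del (delbar (scalar (h.logRatio k))) := by
  ext1 x
  rw [h.ric_apply, neg_I_smul_del_delbar_eq k (h.isSmoothFun_logRatio k) 0 fun y hy => by
    rw [h.logDet_eq_add_logRatio k hy, add_zero]]
  rfl

theorem ricVol_OmegaVol (T : ℝ) (φ : M → ℝ)
    (hφ : IsSmoothFun (n := n) fun x => φ x / (((n : ℝ) - 1) * T)) :
    ricVol (OmegaVol h T φ)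
      = h.ric - Complex.I • del (delbar (scalar fun x => φ x / (((n : ℝ) - 1) * T))) := by
  ext1 x
  rw [ricVol, chartD_eq, pull_id]
  -- The density of ω₀^n is n! times the determinant, which accounts for the additive constant.
  rw [neg_I_smul_del_delbar_eq h hφ (Real.log n.factorial) fun y hy => ?_]
  · rfl
  have hd := (det_eq_re _ (h.localMatrix_posDef x hy)).2
  rw [localRep, OmegaVol, map_smul, density_ofReal_smul, form_pow_apply,
    map_pow, pull_formOf, ← localMatrix_eq_pullMat, density_formOf_pow,
    Real.log_mul (Real.exp_ne_zero _) (mul_ne_zero (by positivity) hd.ne'),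
    Real.log_mul (by positivity) hd.ne', Real.log_exp, logDet]
  ring

end HermitianMetric

/-! ## Comparison of the two equations -/

variable (ω₀ α : HermitianMetric n M) (T : ℝ) (φ : M → ℝ) (s : ℝ)

/-- The function `(n-1) log (η^n / ω₀^n) - φ / T`. -/
def potential (η : HermitianMetric n M) (x : M) : ℝ :=
  ((n : ℝ) - 1) * η.logRatio ω₀ x - φ x / T

variable {φ}

theorem isSmoothFun_potential (hφ : IsSmoothFun (n := n) φ) (η : HermitianMetric n M) :
    IsSmoothFun (n := n) (potential ω₀ T φ η) := by
  have := ((η.isSmoothFun_logRatio ω₀).const_mul ((n : ℝ) - 1)).add (hφ.const_mul (-T⁻¹))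
  convert this using 2 with x
  rw [potential]
  ring

/-- The heart of the comparison: for every metric, solution or not, the right side of the continuity
equation is the Monge-Ampère form of its potential. -/
theorem maForm_potential (hn : 2 ≤ n) (hφ : IsSmoothFun (n := n) φ) (η : HermitianMetric n M) :
    maForm ω₀ α T φ s (potential ω₀ T φ η) = ceForm ω₀ α s η := by
  have hn' : (n : ℝ) - 1 ≠ 0 := by
    have : (2 : ℝ) ≤ n := by exact_mod_cast hn
    linarith
  have ha : IsSmoothFun (n := n) fun x => φ x / (((n : ℝ) - 1) * T) := by
    convert hφ.const_mul ((((n : ℝ) - 1) * T)⁻¹) using 2 with x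
    ring
  have hv := (isSmoothFun_potential ω₀ T hφ η).const_mul ((n : ℝ) - 1)⁻¹
  -- With this `v` the volume forms satisfy η^n = Ω e^v.
  set v : M → ℝ := fun x => ((n : ℝ) - 1)⁻¹ * potential ω₀ T φ η x with hvd
  have hfv : η.logRatio ω₀ = fun x => φ x / (((n : ℝ) - 1) * T) + v x := by
    ext1 x
    simp only [hvd, potential]
    rw [mul_sub, inv_mul_cancel_left₀ hn', div_mul_eq_div_div_swap, div_eq_inv_mul (φ x / T)]
    ring
  have hL : (fun x => Real.log (volRatio (η.form ^ n) (α.form ^ n) x))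
      = fun x => Real.log (volRatio (OmegaVol ω₀ T φ) (α.form ^ n) x) + v x := by
    ext1 x
    rw [η.log_volRatio α, ω₀.log_volRatio_OmegaVol α, ← η.logRatio_add ω₀ α, hfv]
    ring
  have hLs : IsSmoothFun (n := n)
      fun x => Real.log (volRatio (OmegaVol ω₀ T φ) (α.form ^ n) x) := by
    simp only [ω₀.log_volRatio_OmegaVol α]
    exact (ω₀.isSmoothFun_logRatio α).add ha
  have hR : η.ric = ricVol (OmegaVol ω₀ T φ) - Complex.I • del (delbar (scalar v)) := by
    rw [η.ric_eq_sub ω₀, ω₀.ricVol_OmegaVol T φ ha, hfv, del_delbar_scalar_add ha hv, smul_add]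
    abel
  -- The coefficient s(n-1) meets the factor 1/(n-1) in `v` and leaves `s` in front of the Hessian
  -- operator of the potential.
  rw [ceForm, hL, hR, ricci_part_sub_hessForm α _ hLs hv, hvd,
    hessForm_const_mul α _ (isSmoothFun_potential ω₀ T hφ η), maForm, hatForm, smul_sub _ _ (_ • _),
    smul_smul, ← Complex.ofReal_mul, mul_assoc, mul_inv_cancel₀ hn', mul_one]
  abel

theorem isSmoothForm_maForm (hφ : IsSmoothFun (n := n) φ) {u : M → ℝ}
    (hu : IsSmoothFun (n := n) u) : IsSmoothForm (maForm ω₀ α T φ s u) := by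
  have ha : IsSmoothFun (n := n) fun x => φ x / (((n : ℝ) - 1) * T) := by
    convert hφ.const_mul ((((n : ℝ) - 1) * T)⁻¹) using 2 with x
    ring
  have hLs : IsSmoothFun (n := n)
      fun x => Real.log (volRatio (OmegaVol ω₀ T φ) (α.form ^ n) x) := by
    simp only [ω₀.log_volRatio_OmegaVol α]
    exact (ω₀.isSmoothFun_logRatio α).add ha
  rw [maForm, hatForm, ω₀.ricVol_OmegaVol T φ ha]
  exact ((ω₀.isSmoothForm.pow _).sub ((((ω₀.isSmoothForm_ric.sub (ha.scalar.delbar.del.smul _)).mul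
    (α.isSmoothForm.pow _)).sub
      ((hLs.scalar.del.smul _).mul (α.isSmoothForm.pow _).delbar).reF).smul _)).add
    ((isSmoothForm_hessForm α hu).smul _)

/-- Since this holds for every metric, the scalar equation for Ψ = η^{n-1} says exactly that u is
the potential of η. -/
theorem log_lamDet_div (hn : 2 ≤ n) (η : HermitianMetric n M) (x : M) :
    Real.log (lamDet ((η.form ^ (n - 1)) x) /
      (Real.exp (φ x / T) * lamDet ((ω₀.form ^ (n - 1)) x))) = potential ω₀ T φ η x := by
  have h1 := η.det_mat_pos x
  have h0 := ω₀.det_mat_pos x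
  have hf : (((n - 1).factorial : ℝ) ^ n) ≠ 0 := by positivity
  have hn' : ((n - 1 : ℕ) : ℝ) = (n : ℝ) - 1 := by
    rw [Nat.cast_sub (by omega), Nat.cast_one]
  rw [η.form_pow_apply, ω₀.form_pow_apply, lamDet_formOf_pow_pred (by omega) _ (η.mat_posDef x),
    lamDet_formOf_pow_pred (by omega) _ (ω₀.mat_posDef x), mul_left_comm, mul_div_mul_left _ _ hf,
    Real.log_div (by positivity) (by positivity), Real.log_mul (by positivity) (by positivity),
    Real.log_exp, Real.log_pow, Real.log_pow, hn', potential, HermitianMetric.logRatio]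
  ring

theorem SolvesCE.solvesMA {η : HermitianMetric n M} (hn : 2 ≤ n) (hφ : IsSmoothFun (n := n) φ)
    (h : SolvesCE ω₀ α s η) : SolvesMA ω₀ α T φ s (potential ω₀ T φ η) ∧
      η.form ^ (n - 1) = maForm ω₀ α T φ s (potential ω₀ T φ η) := by
  have e : η.form ^ (n - 1) = maForm ω₀ α T φ s (potential ω₀ T φ η) := by
    rw [maForm_potential ω₀ α T s hn hφ]
    exact h.1
  refine ⟨⟨(isSmoothFun_potential ω₀ T hφ η).contMDiff, e ▸ h.2, fun x => ?_⟩, e⟩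
  rw [← e, log_lamDet_div ω₀ T hn, sub_self]

theorem SolvesMA.solvesCE {η : HermitianMetric n M} (hn : 2 ≤ n) (hφ : IsSmoothFun (n := n) φ)
    {u : M → ℝ} (h : SolvesMA ω₀ α T φ s u) (e : η.form ^ (n - 1) = maForm ω₀ α T φ s u) :
    SolvesCE ω₀ α s η := by
  have hu : u = potential ω₀ T φ η := by
    ext1 x
    rw [← log_lamDet_div ω₀ T hn, e]
    exact (sub_eq_zero.1 (h.2.2 x)).symm
  refine ⟨?_, e ▸ h.2.1⟩
  rw [e, hu, maForm_potential ω₀ α T s hn hφ]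

/-! ## Roots of positive forms -/

theorem formOf_rootMat_pow (hn : 2 ≤ n) {ψ : Lam n} (h : LamPos ψ) :
    formOf (rootMat (coeffMatrix ψ)) ^ (n - 1) = ψ := by
  rw [formOf_pow_pred (by omega), adjugate_rootMat hn _ h.2, ← h.1]

theorem adjugate_posDef {G : Matrix (Fin n) (Fin n) ℂ} (hG : G.PosDef) : G.adjugate.PosDef := by
  have hd := hG.det_pos
  have h : G.adjugate = G.det • G⁻¹ := by
    rw [Matrix.inv_def, Ring.inverse_eq_inv', smul_smul, mul_inv_cancel₀ hd.ne', one_smul]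
  rw [h]
  exact hG.inv.smul hd

/-- The (n-1)-st power commutes with pullback, and the positive root is unique, so the root commutes
with pullback as well. -/
theorem pullMat_rootMat (hn : 2 ≤ n) {ψ : Lam n} (h : LamPos ψ) {A : Cn n →L[ℂ] Cn n}
    (hA : Function.Injective A) : (coeffMatrix (pull A ψ)).PosDef ∧
      pullMat A (rootMat (coeffMatrix ψ)) = rootMat (coeffMatrix (pull A ψ)) := by
  have hG := pullMat_posDef hA (rootMat_posDef _ h.2)
  have e : coeffMatrix (pull A ψ)
      = ((n - 1).factorial : ℂ) • (pullMat A (rootMat (coeffMatrix ψ))).adjugateᵀ := by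
    conv_lhs => rw [← formOf_rootMat_pow hn h]
    rw [map_pow, pull_formOf, formOf_pow_pred (by omega), coeffMatrix_ofMatrix]
  rw [e, rootMat_adjugate hn _ hG]
  refine ⟨(adjugate_posDef hG).transpose.smul ?_, rfl⟩
  exact_mod_cast Nat.factorial_pos _

theorem contDiffAt_hermBilin {E : Type*} [NormedAddCommGroup E] [NormedSpace ℝ E]
    {A : E → Matrix (Fin n) (Fin n) ℂ} {y : E}
    (hA : ∀ i j, ContDiffAt ℝ ∞ (fun z => A z i j) y) (v w : Cn n) :
    ContDiffAt ℝ ∞ (fun z => hermBilin (A z) v w) y := by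
  simp only [hermBilin_apply, hermPair, dotProduct, Matrix.mulVec]
  exact contDiffAt_const.mul (Complex.reCLM.contDiff.contDiffAt.comp y
    (ContDiffAt.sum fun i _ => contDiffAt_const.mul
      (ContDiffAt.sum fun j _ => (hA i j).mul contDiffAt_const)))

theorem contDiffAt_coeffMatrix {E : Type*} [NormedAddCommGroup E] [NormedSpace ℝ E]
    {F : E → Lam n} {y : E} (hF : ContDiffAt ℝ ∞ F y) (i j : Fin n) :
    ContDiffAt ℝ ∞ (fun z => coeffMatrix (F z) i j) y := by
  have h : ContDiffAt ℝ ∞ (fun z => coeff (omitIdx i j) (F z)) y :=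
    contDiffAt_realCLM (coeffL (omitIdx i j)) hF
  exact h.div_const _

/-- The Hermitian metric whose `(n-1)`-st power is a given positive form. -/
def rootMetric (hn : 2 ≤ n) (ψ : Form n M) (hψ : IsSmoothForm ψ) (hpos : IsPos ψ) :
    HermitianMetric n M where
  g x := hermBilin (rootMat (coeffMatrix (ψ x)))
  symm x := hermBilin_symm _ (rootMat_posDef _ (hpos x).2).1
  pos x := hermBilin_pos _ (rootMat_posDef _ (hpos x).2)
  J_invariant _ := hermBilin_J _
  smooth x₀ v w y hy := by
    -- In the chart at `x₀` the metric is the root of the coefficient matrix of the form's local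
    -- expression, a smooth function; `h.1` supplies the positivity needed at `y`.
    have h := pullMat_rootMat hn (hpos ((chartAt (Cn n) x₀).symm y)) (chartSymmD_injective hy)
    refine ContDiffAt.contDiffWithinAt ?_
    refine (contDiffAt_hermBilin (contDiffAt_rootMat (contDiffAt_coeffMatrix (hψ x₀ y hy)) h.1)
      v w).congr_of_eventuallyEq ?_
    filter_upwards [eventually_target hy] with z hz
    rw [localRep, ← (pullMat_rootMat hn (hpos _) (chartSymmD_injective hz)).2, hermBilin_apply,
      hermBilin_apply, hermPair_pullMat]

theorem rootMetric_form_pow (hn : 2 ≤ n) (ψ : Form n M) (hψ : IsSmoothForm ψ) (hpos : IsPos ψ) :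
    (rootMetric hn ψ hψ hpos).form ^ (n - 1) = ψ := by
  ext1 x
  rw [HermitianMetric.form_pow_apply]
  refine Eq.trans ?_ (formOf_rootMat_pow hn (hpos x))
  congr 2
  exact hermMatrix_hermBilin _

theorem SolvesMA.exists_metric (hn : 2 ≤ n) (hφ : IsSmoothFun (n := n) φ) {u : M → ℝ}
    (h : SolvesMA ω₀ α T φ s u) :
    ∃ η : HermitianMetric n M, η.form ^ (n - 1) = maForm ω₀ α T φ s u ∧ SolvesCE ω₀ α s η := by
  have e := rootMetric_form_pow hn _
    (isSmoothForm_maForm ω₀ α T s hφ (isSmoothFun_of_contMDiff h.1)) h.2.1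
  exact ⟨_, e, SolvesMA.solvesCE ω₀ α T s hn hφ h e⟩

end Equation

end GauduchonContinuity

end

/-! ### The proposition. -/

open GauduchonContinuity in
theorem proposition3p1 (n : ℕ) (hn : 2 ≤ n)
    (M : Type*) [TopologicalSpace M] [T2Space M] [CompactSpace M]
    [ChartedSpace (Cn n) M] [IsManifold 𝓘(ℂ, Cn n) ω M]
    (ω₀ α : HermitianMetric n M) (hα : α.IsGauduchon)
    (T : ℝ) (hT : 0 < T)
    (φ : M → ℝ) (hφ : ContMDiff 𝓘(ℝ, Cn n) 𝓘(ℝ, ℝ) ∞ φ)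
    (hpos : IsPos (PhiForm ω₀ α T + hessForm α φ))
    (s : ℝ) (hs : s ∈ Set.Icc 0 T) :
    ((∃ η : HermitianMetric n M, SolvesCE ω₀ α s η) ↔
      ∃ u : M → ℝ, SolvesMA ω₀ α T φ s u) ∧
    ((∃ η : HermitianMetric n M, η.IsGauduchon ∧ SolvesCE ω₀ α s η) ↔
      ∃ u : M → ℝ, SolvesMA ω₀ α T φ s u ∧ del (delbar (maForm ω₀ α T φ s u)) = 0) ∧
    (∀ η : HermitianMetric n M, SolvesCE ω₀ α s η ↔
      ∃ u : M → ℝ, SolvesMA ω₀ α T φ s u ∧ η.form ^ (n - 1) = maForm ω₀ α T φ s u) := by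
  have hφ' : IsSmoothFun (n := n) φ := isSmoothFun_of_contMDiff hφ
  refine ⟨⟨?_, ?_⟩, ⟨?_, ?_⟩, fun η => ⟨fun h => ⟨_, h.solvesMA ω₀ α T s hn hφ'⟩, ?_⟩⟩
  · rintro ⟨η, h⟩
    exact ⟨_, (h.solvesMA ω₀ α T s hn hφ').1⟩
  · rintro ⟨u, h⟩
    obtain ⟨η, -, hη⟩ := h.exists_metric ω₀ α T s hn hφ'
    exact ⟨η, hη⟩
  -- The Gauduchon condition depends on the metric only through `η.form ^ (n - 1)`, which equals the
  -- Monge-Ampère form, so it transfers along that equality.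
  · rintro ⟨η, hG, h⟩
    have := h.solvesMA ω₀ α T s hn hφ'
    exact ⟨_, this.1, this.2 ▸ hG⟩
  · rintro ⟨u, h, hG⟩
    obtain ⟨η, e, hη⟩ := h.exists_metric ω₀ α T s hn hφ'
    refine ⟨η, ?_, hη⟩
    rw [HermitianMetric.IsGauduchon, e, hG]
  · rintro ⟨u, h, e⟩
    exact h.solvesCE ω₀ α T s hn hφ' e
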